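/- **Setting.** Let $n:\mathbb R\to\mathbb R$ be a Schwartz function with $\int n=\pm1$, and let $$\eta(z)=z-\frac14\int_{\mathbb R}\frac{n(s)}{s-z}\,ds,\qquad \eta_\pm(\lambda)=\eta(\lambda\pm i0).$$ Let $\Sigma$ be an oriented contour consisting of $\mathbb R$ (oriented from left to right) and finitely many compact simple $C^1$ arcs which meet $\mathbb R$ and each other only at a finite set of nodes (containing the end points of the arcs). Closed curves such as a circle or an oval are cut into arcs. $\Sigma$ is symmetric about $\mathbb R$, and the reflection maps the left side of each arc to the left side of its mirror arc. The left side of $\Sigma$ is the $+$ side. Let $T,X\subset\mathbb R$ be open (e.g. $T=\mathbb R$, $X=(0,\infty)$). For $t\in T$, $x\in X$ let $$J(t,x,z)=e^{-i(zt-x\eta(z))\sigma_3}\hat J(z)e^{i(zt-x\eta(z))\sigma_3}\ (z\in\Sigma\setminus\mathbb R),\qquad J(t,x,\lambda)=e^{-i(\lambda t-x\eta_+(\lambda))\sigma_3}\hat J(x,\lambda)e^{i(\lambda t-x\eta_-(\lambda))\sigma_3}\ (\lambda\in\mathbb R),$$ where $\hat J(z)^{-1}=\hat J(\bar z)^\dagger$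 for $z\in\Sigma\setminus\mathbb R$, $\hat J(x,\lambda)$ has positive definite real part $\frac12(\hat J+\hat J^\dagger)$, $\hat J(x,\lambda)=I+O(1/\lambda)$ as $\lambda\to\pm\infty$, and, if $n(\lambda)=0$, then $\hat J(x,\lambda)$ does not depend on $x$. Let $M(t,x,z)$ be a solution of the regular Riemann–Hilbert problem: $M$ is analytic in $z\in\mathbb C\setminus\Sigma$ and bounded; it has boundary values $M_\pm$ at the points of $\Sigma$ other than nodes, with $M_-=M_+J$; $\det J=1$; $M=I+O(1/z)$ as $z\to\infty$. Put $\Phi=M e^{-i(zt-x\eta(z))\sigma_3}$ and $Q=M_+-I$ on $\Sigma$. Differentiability (smoothness) of $M$ in $t$ and $x$ means differentiability ($C^\infty$) of $(t,x)\mapsto(1+|z|)(M(t,x,z)-I)$ with values in the Banach space of bounded continuous functions of $z\in\mathbb C\setminus\Sigma$. **Theorem.** $Q$ solves the singular integral equation $Q=C_+[(I+Q)(I-J)]$ on $\Sigma$ away from the nodes, where $C_+$ denotes the $+$ boundary value of $\frac1{2\pi i}\int_\Sigma\frac{(\cdot)(s)}{s-z}ds$; and $\Phi$ has boundary values $\Phi_\pm(t,x,\lambda)=\Phi(t,x,\lambda\pm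 i0)$ at every real non-node $\lambda$. There are matrix functions $H(t,x)$ and $F(t,x,\lambda)$ such that the following holds. 1. At every $(t,x)\in T\times X$ at which $M$ is differentiable in $t$ and in $x$ (hence almost everywhere if this is so at almost every point, and everywhere if $M$ is smooth): * $H=\lim_{z\to\infty}-i[\sigma_3,z(M-I)]$, that is, $H=-i[\sigma_3,m]$ with $m$ the $1/z$-term of $M$, and $$H=-i\,\frac1{2\pi i}\int_\Sigma\bigl[\sigma_3,(I+Q)(J-I)\bigr]\,ds,$$ where the integral converges absolutely; * with the absolutely convergent integral $G(t,x,z)=\frac14\int_{\mathbb R}\frac{F(t,x,s)n(s)}{s-z}ds$, $$\Phi_t=-(iz\sigma_3+H)\Phi,\qquad \Phi_x=(iz\sigma_3+H-iG)\Phi\qquad(z\notin\Sigma);$$ * at every real $\lambda$ that is not a node, $G_\pm=G(t,x,\lambda\pm i0)$ exist, and $\partial_t\Phi_\pm=-(i\lambda\sigma_3+H)\Phi_\pm$, $\partial_x\Phi_\pm=(i\lambda\sigma_3+H-iG_\pm)\Phi_\pm$; moreover the boundary values of $\Phi_x\Phi^{-1}$ exist and $$\tfrac{\pi n(\lambda)}2F(t,x,\lambda)=\Phi_x\Phi^{-1}\big|_{\lambda+i0}-\Phi_x\Phi^{-1}\big|_{\lambda-i0};$$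 * $\operatorname{tr}F(t,x,\lambda)=0$ for all $\lambda\in\mathbb R$. 2. Suppose moreover that $\hat J(x,\lambda)$ is Hermitian for $x\in X$, $\lambda\in\mathbb R$ (the form which the reflection symmetry takes on $\mathbb R$). Then there are functions $\mathcal E(t,x)\in\mathbb C$, $\mathcal N(t,x,\lambda)\in\mathbb R$, $\rho(t,x,\lambda)\in\mathbb C$ such that, at the same points $(t,x)$, $$H=\frac12\begin{pmatrix}0&\mathcal E\\-\bar{\mathcal E}&0\end{pmatrix},\qquad F=\begin{pmatrix}\mathcal N&\rho\\\bar\rho&-\mathcal N\end{pmatrix}.$$ If $M$ is smooth in $(t,x)$ on $T\times X$, then $\mathcal E$ has partial derivatives in $t$ and $x$, $n\rho$ is integrable in $\lambda$, and the Maxwell–Bloch equations hold on $T\times X$, for all $\lambda\in\mathbb R$: $$\mathcal E_t+\mathcal E_x=\int_{\mathbb R}n(\lambda)\rho(t,x,\lambda)\,d\lambda,\qquad \rho_t+2i\lambda\rho=\mathcal N\mathcal E,\qquad \mathcal N_t=-\tfrac12(\bar{\mathcal E}\rho+\mathcal E\bar\rho).$$ -/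

import Mathlib

open Complex Filter Topology MeasureTheory Set
open scoped Matrix ComplexOrder ContDiff BoundedContinuousFunction

noncomputable section

namespace MaxwellBloch

/-- Complex `2 × 2` matrices. -/
abbrev Mat2 : Type := Matrix (Fin 2) (Fin 2) ℂ

/-- The Pauli matrix `σ₃`. -/
def sigma3 : Mat2 := !![1, 0; 0, -1]

/-- `e^{w σ₃} = diag (e^w, e^{-w})`. -/
def expSigma3 (w : ℂ) : Mat2 := !![Complex.exp w, 0; 0, Complex.exp (-w)]

/-- Approach to the real point `l` from the open upper half-plane (`z → l + i0`). -/
def above (l : ℝ) : Filter ℂ := 𝓝[{z : ℂ | 0 < z.im}] (l : ℂ)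

/-- Approach to the real point `l` from the open lower half-plane (`z → l - i0`). -/
def below (l : ℝ) : Filter ℂ := 𝓝[{z : ℂ | z.im < 0}] (l : ℂ)

/-- Approach to `γ s` from the left of the oriented curve `γ`: near a point where `γ` is `C¹` with
`γ' ≠ 0`, the points on the left are exactly the `γ u + r i γ'(s)` with `u` near `s` and small
`r > 0`. -/
def leftOf (γ : ℝ → ℂ) (s : ℝ) : Filter ℂ :=
  Filter.map (fun q : ℝ × ℝ => γ q.1 + (q.2 : ℂ) * (I * deriv γ s)) (𝓝 s ×ˢ 𝓝[>] (0 : ℝ))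

/-- Approach to `γ s` from the right of the oriented curve `γ`. -/
def rightOf (γ : ℝ → ℂ) (s : ℝ) : Filter ℂ :=
  Filter.map (fun q : ℝ × ℝ => γ q.1 + (q.2 : ℂ) * (I * deriv γ s)) (𝓝 s ×ˢ 𝓝[<] (0 : ℝ))

/-- An oriented contour, symmetric in the real axis: the real line (oriented from left to right)
together with finitely many compact oriented simple `C¹` arcs (a circle or an oval is cut into its
upper and lower halves). The finite set `nodes` contains the end points of the arcs and
all points where two arcs meet or where an arc meets the real line. The mirror image of an arc is
again one of the arcs, and the orientations are such that the left-hand side of an arc is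
reflected to the left-hand side of its mirror image (as for a clockwise circle, or
for a pair of arcs that both run downwards). -/
structure Contour where
  p : ℕ
  arc : Fin p → ℝ → ℂ
  nodes : Finset ℂ
  contDiffOn_arc : ∀ k, ContDiffOn ℝ 1 (arc k) (Icc 0 1)
  deriv_arc_ne_zero : ∀ k, ∀ s ∈ Ioo (0 : ℝ) 1, deriv (arc k) s ≠ 0
  injOn_arc : ∀ k, InjOn (arc k) (Ioo 0 1)
  arc_zero_mem : ∀ k, arc k 0 ∈ nodes
  arc_one_mem : ∀ k, arc k 1 ∈ nodes
  meet_mem : ∀ k l, k ≠ l → ∀ s ∈ Icc (0 : ℝ) 1, ∀ u ∈ Icc (0 : ℝ) 1,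
    arc k s = arc l u → arc k s ∈ nodes
  meet_real_mem : ∀ k, ∀ s ∈ Icc (0 : ℝ) 1, (arc k s).im = 0 → arc k s ∈ nodes
  mirror : Fin p → Fin p
  arc_mirror : ∀ k, ∀ s ∈ Icc (0 : ℝ) 1, arc (mirror k) s = (starRingEnd ℂ) (arc k (1 - s))

namespace Contour

/-- The point set `Σ` of the contour. -/
def carrier (C : Contour) : Set ℂ := {z : ℂ | z.im = 0} ∪ ⋃ k, C.arc k '' Icc 0 1

/-- `C.HasSides z P N`: `z` is a point of the contour other than a node, `P` is the approach to `z`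
from the left (`+`) side, and `N` the approach to `z` from the right (`-`) side. -/
inductive HasSides (C : Contour) : ℂ → Filter ℂ → Filter ℂ → Prop
  | real (l : ℝ) (hl : (l : ℂ) ∉ C.nodes) : HasSides C (l : ℂ) (above l) (below l)
  | arc (k : Fin C.p) (s : ℝ) (hs : s ∈ Ioo (0 : ℝ) 1) (hn : C.arc k s ∉ C.nodes) :
      HasSides C (C.arc k s) (leftOf (C.arc k) s) (rightOf (C.arc k) s)

/-- Absolute integrability along the contour (of every entry). -/
def IntegrableAlong (C : Contour) (f : ℂ → Mat2) : Prop :=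
  ∀ i j, Integrable (fun l : ℝ => f (l : ℂ) i j) ∧
    ∀ k, IntervalIntegrable (fun s : ℝ => deriv (C.arc k) s * f (C.arc k s) i j) volume 0 1

/-- The contour integral `∫_Σ f(s) ds` (entry by entry). -/
def integral (C : Contour) (f : ℂ → Mat2) : Mat2 :=
  Matrix.of fun i j => (∫ l : ℝ, f (l : ℂ) i j) +
    ∑ k, ∫ s in (0 : ℝ)..1, deriv (C.arc k) s * f (C.arc k s) i j

end Contour

/-- The matrix function `f` of a real variable is differentiable at `t` with derivative `f'`. -/
def HasMatDerivAt (f : ℝ → Mat2) (f' : Mat2) (t : ℝ) : Prop :=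
  ∀ i j, HasDerivAt (fun τ => f τ i j) (f' i j) t

/-- The derivative of a matrix function of a real variable, entry by entry. -/
def matDeriv (f : ℝ → Mat2) (t : ℝ) : Mat2 :=
  Matrix.of fun i j => deriv (fun τ => f τ i j) t

/-- `M` solves the regular Riemann-Hilbert problem on the contour `C` with jump matrix `J`:
`M` is analytic off `Σ` and bounded up to `Σ`, `M₋ = M₊ J` on `Σ` away from the nodes, `det J = 1`,
and `M = I + O(1/z)` as `z → ∞`. -/
structure IsRHSolution (C : Contour) (J M : ℂ → Mat2) : Prop where
  analytic : ∀ i j, DifferentiableOn ℂ (fun z => M z i j) C.carrierᶜ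
  bounded : ∃ K : ℝ, ∀ z ∉ C.carrier, ∀ i j, ‖M z i j‖ ≤ K
  jump : ∀ (z : ℂ) (P N : Filter ℂ), C.HasSides z P N →
    ∃ A : Mat2, Tendsto M P (𝓝 A) ∧ Tendsto M N (𝓝 (A * J z))
  det_jump : ∀ z ∈ C.carrier, z ∉ C.nodes → (J z).det = 1
  asymp : ∀ i j, (fun z => (M z - 1) i j) =O[Bornology.cobounded ℂ ⊓ 𝓟 C.carrierᶜ] (fun z => z⁻¹)

/-- `η(z) = z - ¼ ∫ n(s)/(s - z) ds`. -/
def eta (n : SchwartzMap ℝ ℝ) (z : ℂ) : ℂ :=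
  z - (1 / 4) * ∫ s : ℝ, (n s : ℂ) / ((s : ℂ) - z)

/-- `η₊(l) = η(l + i0)`. -/
def etaPlus (n : SchwartzMap ℝ ℝ) (l : ℝ) : ℂ := limUnder (above l) (eta n)

/-- `η₋(l) = η(l - i0)`. -/
def etaMinus (n : SchwartzMap ℝ ℝ) (l : ℝ) : ℂ := limUnder (below l) (eta n)

/-- The jump matrix built from the data `Jarc` (off the real line) and `Jreal` (on it). -/
def jumpMatrix (n : SchwartzMap ℝ ℝ) (Jarc : ℂ → Mat2) (Jreal : ℝ → ℝ → Mat2)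
    (t x : ℝ) (z : ℂ) : Mat2 :=
  if z.im = 0 then
    expSigma3 (-(I * (z * t - x * etaPlus n z.re))) * Jreal x z.re *
      expSigma3 (I * (z * t - x * etaMinus n z.re))
  else
    expSigma3 (-(I * (z * t - x * eta n z))) * Jarc z * expSigma3 (I * (z * t - x * eta n z))

/-- `Φ(t,x,z) = M(t,x,z) e^{-i(zt - xη(z))σ₃}`. -/
def waveMatrix (n : SchwartzMap ℝ ℝ) (M : ℝ → ℝ → ℂ → Mat2) (t x : ℝ) (z : ℂ) : Mat2 :=
  M t x z * expSigma3 (-(I * (z * t - x * eta n z)))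

/-- `¼ ∫ F(s) n(s)/(s - z) ds` for a fixed matrix function `F` on the real line. -/
def gMatrix (n : SchwartzMap ℝ ℝ) (F : ℝ → Mat2) (z : ℂ) : Mat2 :=
  Matrix.of fun i j => (1 / 4) * ∫ s : ℝ, (n s : ℂ) / ((s : ℂ) - z) * F s i j

end MaxwellBloch

end

/-!
All analytic information comes from Cauchy's formula for the contour `Σ`. A function `f` which is
bounded and holomorphic off `Σ`, has one-sided limits at the points of `Σ` other than nodes and is
`O(1/z)` at infinity is the Cauchy integral of its jump (`cauchy_formula`). It is proved by testing
`∂̄`: Green's formula in charts next to the points of `Σ` and a partition of unity show that, away from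
the nodes, the distribution `∂̄ f` is integration of the jump along `Σ` (`weakJumpOn_compl_nodes`);
cutoffs at infinity and at the nodes then give the formula, where boundedness makes the nodes
invisible. Two consequences are Liouville's theorem, by which a bounded function without jumps is
constant (`eq_of_no_jump`), and the moment formula, by which an integrable jump has the leading
coefficient at infinity as its integral (`tendsto_moment`). The singular integral equation for
`Q = M₊ - I` is Cauchy's formula for `M - I`.

Functions whose quotient by `1 + |z|` has a limit along a given approach to `Σ`, or is holomorphic, form
closed subspaces of the Banach space of bounded continuous functions off `Σ`. Hence the derivatives
`M_t` and `M_x` are again holomorphic, decay at infinity and have boundary values, and these are the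
derivatives of the boundary values of `M` (`hasMatDerivAt_bdry`). Together with the boundary values of
`η`, which are found by removing the singularity of the Cauchy kernel (`tendsto_cauchyTransform_above`),
this reduces the Lax pair to a study of the logarithmic derivatives of `Φ`. In terms of `Φ` the jump
relation reads `Φ₋ = Φ₊ Ĵ`, where `Ĵ` does not depend on `t`, and depends on `x` only on the part of the
real line where `n ≠ 0`.

* `Φ_t Φ⁻¹ + i z σ₃` is bounded and has no jump; it is a constant `-H` (`waveT_eq`). As an equation for
  `M` this says `-i [σ₃, z (M - I)] = M_t + H M`, which gives `H` as a limit at infinity, shows that the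
  jump of `[σ₃, M]` is `O(1/z²)` and so integrable, and, by the moment formula, represents `H` as an
  integral (`potential_eq_integral`).
* `R = Φ_x Φ⁻¹ - i z σ₃ - H` decays at infinity and jumps only where `n ≠ 0` on the real line. If the
  jump is written as `π n F / 2`, Cauchy's formula becomes `R = -i G` (`remainder_eq_gMatrix`). The
  function `F` is set to `0` at the zeros of `n` and at the nodes, which does not affect the integrals:
  the jump vanishes at the zeros of `n`, and there are finitely many nodes.
* `det M = 1`, again by Liouville's theorem, so that `Φ_x Φ⁻¹` and `F` have trace `0`.

If `Ĵ` is Hermitian on the real line, `M(z) M(z̄)ᴴ` has no jump and is `I` (`mul_conjTranspose_M`). The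
mirror image of a node need not be a node; it is added to the nodes for this argument. Differentiation
in `t` and `x` shows that `H` is skew-Hermitian and `F` is Hermitian.

If `M` is smooth, the mixed second derivatives of `M` and of its boundary values agree, which is the
zero-curvature equation `R_t = -(H_t + H_x) - [i z σ₃ + H, R]` (`hasMatDerivAt_bdry_remainder`). Its jump
on the real line is the equation `F_t = -[i l σ₃ + H, F]` (`hasMatDerivAt_jumpF`), whose entries are the
equations for `ρ` and `𝒩`. At infinity, since `R` and `R_t` decay, it determines the `1/z`-term of the
off-diagonal entries of `R`; by the moment formula this term is also the integral of `n F`, and the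
comparison is the equation for `ℰ` (`integral_jumpF`).
-/

namespace MaxwellBloch

/-! ### The Cauchy-Riemann operator and Green's formula -/

/-- The Cauchy-Riemann operator `∂̄ = ½ (∂_x + i ∂_y)`. -/
noncomputable def dbar (ψ : ℂ → ℂ) (w : ℂ) : ℂ :=
  (1 / 2) * (fderiv ℝ ψ w 1 + I * fderiv ℝ ψ w I)

lemma realLinear_apply (L : ℂ →L[ℝ] ℂ) (v : ℂ) : L v = v.re * L 1 + v.im * L I := by
  conv_lhs => rw [← Complex.re_add_im v]
  have h1 : (v.re : ℂ) = v.re • (1 : ℂ) := by simp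
  have h2 : (v.im : ℂ) * I = v.im • I := by simp
  rw [map_add, h1, h2, map_smul, map_smul]
  simp

lemma continuous_dbar {ψ : ℂ → ℂ} (hψ : ContDiff ℝ 1 ψ) : Continuous (dbar ψ) := by
  have h := hψ.continuous_fderiv (by norm_num)
  unfold dbar
  fun_prop

lemma dbar_eq_zero_of_notMem_tsupport {ψ : ℂ → ℂ} {w : ℂ} (hw : w ∉ tsupport ψ) :
    dbar ψ w = 0 := by
  have : fderiv ℝ ψ w = 0 := by
    by_contra h
    exact hw (support_fderiv_subset ℝ h)
  simp [dbar, this]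

lemma hasCompactSupport_dbar {ψ : ℂ → ℂ} (hc : HasCompactSupport ψ) :
    HasCompactSupport (dbar ψ) :=
  HasCompactSupport.intro hc fun _ hw => dbar_eq_zero_of_notMem_tsupport hw

lemma integrable_mul_dbar {g ψ : ℂ → ℂ} {K : ℝ} (hgm : Measurable g) (hgK : ∀ w, ‖g w‖ ≤ K)
    (hψ : ContDiff ℝ 1 ψ) (hc : HasCompactSupport ψ) : Integrable (fun w => g w * dbar ψ w) :=
  ((continuous_dbar hψ).integrable_of_hasCompactSupport (hasCompactSupport_dbar hc)).bdd_mul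
    hgm.aestronglyMeasurable (Eventually.of_forall hgK)

lemma dbar_holomorphic_mul {g ψ : ℂ → ℂ} {w : ℂ} (hg : DifferentiableAt ℂ g w)
    (hψ : DifferentiableAt ℝ ψ w) : dbar (fun z => g z * ψ z) w = g w * dbar ψ w := by
  have h1 : HasFDerivAt g ((fderiv ℂ g w).restrictScalars ℝ) w :=
    hg.hasFDerivAt.restrictScalars ℝ
  have h2 := (h1.mul hψ.hasFDerivAt).fderiv
  have h3 : (fderiv ℂ g w) I = I * (fderiv ℂ g w) 1 := by
    have := (fderiv ℂ g w).map_smul I 1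
    simp at this ⊢
  have h2' : fderiv ℝ (fun z => g z * ψ z) w = _ := h2
  simp only [dbar, h2']
  simp only [_root_.add_apply, _root_.smul_apply,
    ContinuousLinearMap.coe_restrictScalars', h3, smul_eq_mul]
  linear_combination (1 / 2 * ψ w * (fderiv ℂ g w) 1) * I_sq

/-- A test function supported where `g` is holomorphic does not see `g`: `∂̄ g = 0` weakly. -/
theorem integral_mul_dbar_eq_zero {g ψ : ℂ → ℂ} {U : Set ℂ} (hU : IsOpen U)
    (hg : DifferentiableOn ℂ g U) (hψ : ContDiff ℝ 1 ψ) (hc : HasCompactSupport ψ)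
    (hs : tsupport ψ ⊆ U) : ∫ w, g w * dbar ψ w = 0 := by
  have hgd : ∀ x ∈ tsupport ψ, DifferentiableAt ℂ g x := fun x hx =>
    hg.differentiableAt (hU.mem_nhds (hs hx))
  have hfd : ∀ x ∈ tsupport ψ, ∀ v, fderiv ℝ g x v = deriv g x * v := by
    intro x hx v
    have h1 : HasFDerivAt g ((fderiv ℂ g x).restrictScalars ℝ) x :=
      (hgd x hx).hasFDerivAt.restrictScalars ℝ
    rw [h1.fderiv, ContinuousLinearMap.coe_restrictScalars']
    have := (fderiv ℂ g x).map_smul v 1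
    simp only [smul_eq_mul, mul_one] at this
    rw [this, fderiv_apply_one_eq_deriv, mul_comm]
  have key : ∀ k : ℂ → ℂ, ContinuousOn k U → ∀ φ : ℂ → ℂ, Continuous φ → tsupport φ ⊆ tsupport ψ →
      Integrable (fun x => k x * φ x) := by
    intro k hk φ hφ hs'
    have hts : tsupport (fun x => k x * φ x) ⊆ tsupport φ := tsupport_mul_subset_right
    have hcont : Continuous (fun x => k x * φ x) :=
      ContinuousOn.continuous_of_tsupport_subset (hk.mul hφ.continuousOn) hU
        (hts.trans (hs'.trans hs))
    exact hcont.integrable_of_hasCompactSupport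
      (IsCompact.of_isClosed_subset hc (isClosed_tsupport _) (hts.trans hs'))
  have hdc : ContinuousOn (deriv g) U := (hg.deriv hU).continuousOn
  have hψf := hψ.continuous_fderiv (by norm_num)
  have hI : ∀ v : ℂ, Integrable (fun x => g x * fderiv ℝ ψ x v) := fun v =>
    key g hg.continuousOn _ (by fun_prop) (tsupport_fderiv_apply_subset ℝ v)
  have hparts : ∀ v : ℂ, ∫ x, g x * fderiv ℝ ψ x v = - ∫ x, deriv g x * v * ψ x := by
    intro v
    have heq : (fun x => fderiv ℝ g x v * ψ x) = fun x => deriv g x * v * ψ x := by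
      ext x
      by_cases hx : x ∈ tsupport ψ
      · rw [hfd x hx]
      · rw [image_eq_zero_of_notMem_tsupport hx]; simp
    have h := integral_mul_fderiv_eq_neg_fderiv_mul_of_integrable (μ := volume) (f := g) (g := ψ)
      (v := v) (by rw [heq]; exact key _ (hdc.mul_const v) ψ hψ.continuous le_rfl)
      (hI v) (key g hg.continuousOn ψ hψ.continuous le_rfl)
      (fun x hx => (hgd x hx).restrictScalars ℝ) (fun x _ => hψ.differentiable (by norm_num) x)
    rw [h, heq]
  have : ∀ w, g w * dbar ψ w
      = (1 / 2) * (g w * fderiv ℝ ψ w 1 + I * (g w * fderiv ℝ ψ w I)) := by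
    intro w; simp only [dbar]; ring
  simp_rw [this]
  rw [integral_const_mul, integral_add (hI 1) ((hI I).const_mul I), integral_const_mul, hparts,
    hparts]
  have h2 : ∀ x, deriv g x * I * ψ x = I * (deriv g x * 1 * ψ x) := fun x => by ring
  simp_rw [h2]
  rw [integral_const_mul]
  linear_combination (-(1 / 2) * ∫ (x : ℂ), deriv g x * 1 * ψ x) * I_sq

/-! ### Green's formula on one side of a `C¹` curve -/

/-- Coordinates next to a curve: `u + i r ↦ γ u + r c` with a fixed transversal direction `c`. -/
noncomputable def chart (γ : ℝ → ℂ) (c ζ : ℂ) : ℂ := γ ζ.re + ζ.im * c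

/-- The real derivative of `chart`. -/
noncomputable def chartDeriv (p c : ℂ) : ℂ →L[ℝ] ℂ :=
  reCLM.smulRight p + imCLM.smulRight c

lemma chartDeriv_apply (p c v : ℂ) : chartDeriv p c v = v.re * p + v.im * c := by
  simp [chartDeriv]

lemma hasFDerivAt_chart {γ : ℝ → ℂ} {c p ζ : ℂ} (h : HasDerivAt γ p ζ.re) :
    HasFDerivAt (chart γ c) (chartDeriv p c) ζ := by
  have h1 := h.hasFDerivAt.comp ζ reCLM.hasFDerivAt
  have h2 : HasFDerivAt (fun ζ : ℂ => (ζ.im : ℂ) * c) (imCLM.smulRight c) ζ := by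
    have := (imCLM.smulRight c).hasFDerivAt (x := ζ)
    refine this.congr_of_eventuallyEq (Eventually.of_forall fun x => ?_)
    simp
  refine (h1.add h2).congr_fderiv ?_
  ext v; simp [chartDeriv]

lemma det_chartDeriv (p c : ℂ) :
    (chartDeriv p c).det = ((starRingEnd ℂ) p * c).im := by
  have : (chartDeriv p c).det = LinearMap.det (chartDeriv p c : ℂ →ₗ[ℝ] ℂ) := rfl
  rw [this, ← LinearMap.det_toMatrix basisOneI, Matrix.det_fin_two]
  simp [LinearMap.toMatrix_apply, chartDeriv_apply]
  ring

lemma chart_dbar_identity (L : ℂ →L[ℝ] ℂ) (p c : ℂ) :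
    p * L c - c * L p =
      -(2 * I) * ((((starRingEnd ℂ) p * c).im : ℝ) * ((1 / 2) * (L 1 + I * L I))) := by
  rw [realLinear_apply L c, realLinear_apply L p]
  have hp := Complex.re_add_im p
  have hc := Complex.re_add_im c
  have : (((starRingEnd ℂ) p * c).im : ℝ) = p.re * c.im - p.im * c.re := by
    simp; ring
  rw [this]
  conv_lhs => rw [← hp, ← hc]
  simp only [Complex.add_re, Complex.add_im, Complex.mul_re, Complex.mul_im, Complex.ofReal_re,
    Complex.ofReal_im, Complex.I_re, Complex.I_im]
  push_cast
  linear_combination ((p.re : ℂ) * c.im - p.im * c.re) * L I * I_sq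

section Green

variable {γ γ' : ℝ → ℂ} {a b δ K : ℝ} {c : ℂ} {g gp gm ψ : ℂ → ℂ} {U : Set ℂ}

/-- Green's formula in differential form: the derivative of the integrals of `g ψ` over the
translates `γ + r c` of a curve is an integral of `∂̄ (g ψ) = g ∂̄ψ`, the end points being outside
the support of `ψ`. -/
lemma hasDerivAt_slice (hab : a < b) (hγ : ∀ u ∈ Icc a b, HasDerivAt γ (γ' u) u)
    (hγ' : ContinuousOn γ' (Icc a b)) (hU : IsOpen U) (hg : DifferentiableOn ℂ g U)
    (hψ : ContDiff ℝ 1 ψ) {r : ℝ} {s : Set ℝ} (hs : s ∈ 𝓝 r) (hsc : IsCompact s)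
    (hrU : ∀ u ∈ Icc a b, ∀ r ∈ s, γ u + (r : ℂ) * c ∈ U) (ha : ψ (γ a + r * c) = 0)
    (hb : ψ (γ b + r * c) = 0) :
    HasDerivAt (fun r : ℝ => ∫ u in a..b, γ' u * (g (γ u + r * c) * ψ (γ u + r * c)))
      (-(2 * I) * ∫ u in a..b, (((starRingEnd ℂ) (γ' u) * c).im : ℂ) *
        (g (γ u + r * c) * dbar ψ (γ u + r * c))) r := by
  set h : ℂ → ℂ := fun z => g z * ψ z with hh
  have hγc : ContinuousOn γ (Icc a b) := fun u hu => (hγ u hu).continuousAt.continuousWithinAt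
  have hψd : ∀ z, DifferentiableAt ℝ ψ z := hψ.differentiable (by norm_num)
  have hgd : ∀ z ∈ U, DifferentiableAt ℂ g z := fun z hz =>
    hg.differentiableAt (hU.mem_nhds hz)
  have hdiff : ∀ z ∈ U, DifferentiableAt ℝ h z := fun z hz =>
    ((hgd z hz).restrictScalars ℝ).mul (hψd z)
  have hgC : ContDiffOn ℝ 1 g U := (hg.contDiffOn hU).restrict_scalars ℝ
  have hhC : ContDiffOn ℝ 1 h U := hgC.mul hψ.contDiffOn
  have hfc : ContinuousOn (fderiv ℝ h) U := hhC.continuousOn_fderiv_of_isOpen hU (by norm_num)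
  have hrs : r ∈ s := mem_of_mem_nhds hs
  have hcont : ContinuousOn (fun q : ℝ × ℝ => γ q.1 + (q.2 : ℂ) * c) (Icc a b ×ˢ s) := by
    refine ContinuousOn.add (hγc.comp continuousOn_fst fun q hq => hq.1) ?_
    fun_prop
  have hmaps : MapsTo (fun q : ℝ × ℝ => γ q.1 + (q.2 : ℂ) * c) (Icc a b ×ˢ s) U :=
    fun q hq => hrU q.1 hq.1 q.2 hq.2
  have hγ2 : ContinuousOn (fun q : ℝ × ℝ => γ' q.1) (Icc a b ×ˢ s) :=
    hγ'.comp continuousOn_fst fun q hq => hq.1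
  have hF'c : ContinuousOn (fun q : ℝ × ℝ => γ' q.1 * fderiv ℝ h (γ q.1 + (q.2 : ℂ) * c) c)
      (Icc a b ×ˢ s) :=
    hγ2.mul ((hfc.comp hcont hmaps).clm_apply continuousOn_const)
  have hFc : ContinuousOn (fun q : ℝ × ℝ => γ' q.1 * h (γ q.1 + (q.2 : ℂ) * c))
      (Icc a b ×ˢ s) := hγ2.mul (hhC.continuousOn.comp hcont hmaps)
  obtain ⟨D, hD⟩ := (isCompact_Icc.prod hsc).exists_bound_of_continuousOn hF'c
  have hI : uIoc a b ⊆ Icc a b := by rw [uIoc_of_le hab.le]; exact Ioc_subset_Icc_self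
  have hslice : ∀ r' ∈ s, ContinuousOn (fun u : ℝ => (u, r')) (Icc a b) := fun r' _ => by fun_prop
  have hslm : ∀ r' ∈ s, MapsTo (fun u : ℝ => (u, r')) (Icc a b) (Icc a b ×ˢ s) :=
    fun r' hr' u hu => ⟨hu, hr'⟩
  have hFs : ∀ r' ∈ s, ContinuousOn (fun u : ℝ => γ' u * h (γ u + (r' : ℂ) * c)) (Icc a b) :=
    fun r' hr' => hFc.comp (hslice r' hr') (hslm r' hr')
  have hF's : ∀ r' ∈ s,
      ContinuousOn (fun u : ℝ => γ' u * fderiv ℝ h (γ u + (r' : ℂ) * c) c) (Icc a b) :=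
    fun r' hr' => hF'c.comp (hslice r' hr') (hslm r' hr')
  have hmain := intervalIntegral.hasDerivAt_integral_of_dominated_loc_of_deriv_le (μ := volume)
    (F := fun (r' : ℝ) u => γ' u * h (γ u + (r' : ℂ) * c))
    (F' := fun (r' : ℝ) u => γ' u * fderiv ℝ h (γ u + (r' : ℂ) * c) c) (a := a) (b := b)
    (bound := fun _ => D) (x₀ := r) hs
    (Filter.mem_of_superset hs fun r' hr' => ((hFs r' hr').mono hI).aestronglyMeasurable
      measurableSet_uIoc)
    ((hFs r hrs).mono (by rw [uIcc_of_le hab.le])).intervalIntegrable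
    (((hF's r hrs).mono hI).aestronglyMeasurable measurableSet_uIoc)
    (Eventually.of_forall fun u hu r' hr' => hD (u, r') ⟨hI hu, hr'⟩)
    intervalIntegrable_const
    (Eventually.of_forall fun u hu r' hr' => by
      have h1 : HasDerivAt (fun r' : ℝ => γ u + (r' : ℂ) * c) c r' := by
        simpa using ((Complex.ofRealCLM.hasDerivAt (x := r')).mul_const c).const_add (γ u)
      exact ((hdiff _ (hrU u (hI hu) r' hr')).hasFDerivAt.comp_hasDerivAt r' h1).const_mul _)
  refine hmain.2.congr_deriv ?_
  -- the derivative along the curve integrates to zero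
  have hpar : ∀ u ∈ Icc a b, HasDerivAt (fun u => h (γ u + (r : ℂ) * c))
      (fderiv ℝ h (γ u + (r : ℂ) * c) (γ' u)) u := fun u hu =>
    HasFDerivAt.comp_hasDerivAt (f := fun u => γ u + (r : ℂ) * c) u
      (hdiff _ (hrU u hu r hrs)).hasFDerivAt ((hγ u hu).add_const _)
  have hparc : ContinuousOn (fun u : ℝ => fderiv ℝ h (γ u + (r : ℂ) * c) (γ' u)) (Icc a b) :=
    ((hfc.comp hcont hmaps).comp (hslice r hrs) (hslm r hrs)).clm_apply hγ'
  have hzero : ∫ u in a..b, fderiv ℝ h (γ u + (r : ℂ) * c) (γ' u) = 0 := by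
    rw [intervalIntegral.integral_eq_sub_of_hasDerivAt (f := fun u => h (γ u + (r : ℂ) * c))]
    · simp [hh, ha, hb]
    · intro u hu; rw [uIcc_of_le hab.le] at hu; exact hpar u hu
    · exact ContinuousOn.intervalIntegrable (by rwa [uIcc_of_le hab.le])
  have hsub : ∫ u in a..b, γ' u * fderiv ℝ h (γ u + (r : ℂ) * c) c =
      ∫ u in a..b, (γ' u * fderiv ℝ h (γ u + (r : ℂ) * c) c -
        c * fderiv ℝ h (γ u + (r : ℂ) * c) (γ' u)) := by
    rw [intervalIntegral.integral_sub, intervalIntegral.integral_const_mul, hzero, mul_zero,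
      sub_zero]
    · exact ((hF's r hrs).mono (by rw [uIcc_of_le hab.le])).intervalIntegrable
    · exact (ContinuousOn.intervalIntegrable (by rwa [uIcc_of_le hab.le])).const_mul c
  rw [hsub, ← intervalIntegral.integral_const_mul]
  refine intervalIntegral.integral_congr fun u hu => ?_
  rw [uIcc_of_le hab.le] at hu
  have hz := hrU u hu r hrs
  have h1 := dbar_holomorphic_mul (hgd _ hz) (hψd _)
  rw [chart_dbar_identity, ← h1]
  rfl

/-- **Green's formula across a `C¹` curve.** For a function `g` which is holomorphic on both sides
of the curve `γ`, the distribution `∂̄ g` is the line integral of the jump of `g`. -/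
theorem integral_mul_dbar_chart (hab : a < b) (hδ : 0 < δ)
    (hγ : ∀ u ∈ Icc a b, HasDerivAt γ (γ' u) u) (hγ' : ContinuousOn γ' (Icc a b))
    (hdet : ∀ u ∈ Icc a b, 0 < ((starRingEnd ℂ) (γ' u) * c).im)
    (hinj : InjOn (chart γ c) (Icc a b ×ℂ Icc (-δ) δ))
    (hgm : Measurable g) (hgK : ∀ w, ‖g w‖ ≤ K) (hU : IsOpen U) (hg : DifferentiableOn ℂ g U)
    (hgU : ∀ u ∈ Icc a b, ∀ r ∈ Icc (-δ) δ, r ≠ 0 → γ u + (r : ℂ) * c ∈ U)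
    {jp jm : ℝ → ℂ}
    (hgp : ∀ u ∈ Ioo a b, Tendsto (fun r : ℝ => g (γ u + r * c)) (𝓝[>] 0) (𝓝 (jp u)))
    (hgm' : ∀ u ∈ Ioo a b, Tendsto (fun r : ℝ => g (γ u + r * c)) (𝓝[<] 0) (𝓝 (jm u)))
    (hψ : ContDiff ℝ 1 ψ) (hc : HasCompactSupport ψ)
    (hsupp : tsupport ψ ⊆ chart γ c '' (Ioo a b ×ℂ Ioo (-δ) δ)) :
    ∫ w, g w * dbar ψ w = -(I / 2) *
      ((∫ u in a..b, γ' u * (jp u * ψ (γ u))) - ∫ u in a..b, γ' u * (jm u * ψ (γ u))) := by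
  set q : ℝ → ℝ → ℂ := fun u r => (((starRingEnd ℂ) (γ' u) * c).im : ℂ) *
        (g (γ u + r * c) * dbar ψ (γ u + r * c)) with hq
  set k : ℝ → ℂ := fun r => ∫ u in a..b, q u r with hk
  set J : ℝ → ℂ := fun r => ∫ u in a..b, γ' u * (g (γ u + r * c) * ψ (γ u + r * c)) with hJ
  have hsub : Ioo a b ×ℂ Ioo (-δ) δ ⊆ Icc a b ×ℂ Icc (-δ) δ := fun z hz =>
    ⟨Ioo_subset_Icc_self hz.1, Ioo_subset_Icc_self hz.2⟩
  -- `ψ` vanishes on the boundary of the box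
  have hvanish : ∀ u ∈ Icc a b, ∀ r ∈ Icc (-δ) δ, (u ∉ Ioo a b ∨ r ∉ Ioo (-δ) δ) →
      ψ (γ u + r * c) = 0 := by
    intro u hu r hr h
    by_contra hne
    obtain ⟨ζ, hζ, he⟩ := hsupp (subset_tsupport _ (Function.mem_support.2 hne))
    have h0 : chart γ c ⟨u, r⟩ = γ u + r * c := rfl
    have := hinj (hsub hζ) (show (⟨u, r⟩ : ℂ) ∈ _ from ⟨hu, hr⟩) (he.trans h0.symm)
    subst this
    rcases h with h | h
    · exact h hζ.1
    · exact h hζ.2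
  have hint := integrable_mul_dbar hgm hgK hψ hc
  -- change of variables and Fubini
  have hmeas : MeasurableSet (Ioo a b ×ℂ Ioo (-δ) δ) :=
    (isOpen_Ioo.reProdIm isOpen_Ioo).measurableSet
  have hderiv : ∀ ζ ∈ Ioo a b ×ℂ Ioo (-δ) δ,
      HasFDerivWithinAt (chart γ c) (chartDeriv (γ' ζ.re) c) (Ioo a b ×ℂ Ioo (-δ) δ) ζ :=
    fun ζ hζ => (hasFDerivAt_chart (hγ _ (Ioo_subset_Icc_self hζ.1))).hasFDerivWithinAt
  have hcv := integral_image_eq_integral_abs_det_fderiv_smul volume hmeas hderiv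
    (hinj.mono hsub) (fun w => g w * dbar ψ w)
  have hcvi := (integrableOn_image_iff_integrableOn_abs_det_fderiv_smul volume hmeas hderiv
    (hinj.mono hsub) (fun w => g w * dbar ψ w)).1 hint.integrableOn
  have hpt : EqOn (fun ζ : ℂ => |(chartDeriv (γ' ζ.re) c).det| •
      (g (chart γ c ζ) * dbar ψ (chart γ c ζ))) (fun ζ => q ζ.re ζ.im)
      (Ioo a b ×ℂ Ioo (-δ) δ) := by
    intro ζ hζ
    simp only [hq]
    rw [det_chartDeriv, abs_of_pos (hdet _ (Ioo_subset_Icc_self hζ.1)), Complex.real_smul]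
    rfl
  have hpre : measurableEquivRealProd ⁻¹' (Ioo a b ×ˢ Ioo (-δ) δ) = Ioo a b ×ℂ Ioo (-δ) δ := rfl
  have hqi : IntegrableOn (fun p : ℝ × ℝ => q p.1 p.2) (Ioo a b ×ˢ Ioo (-δ) δ)
      (volume.prod volume) := by
    have := (integrableOn_congr_fun hpt hmeas).1 hcvi
    rw [← hpre] at this
    exact (volume_preserving_equiv_real_prod.integrableOn_comp_preimage
      measurableEquivRealProd.measurableEmbedding).1 this
  have hfub : ∫ w, g w * dbar ψ w = ∫ r in Ioo (-δ) δ, ∫ u in Ioo a b, q u r := by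
    rw [← setIntegral_eq_integral_of_forall_compl_eq_zero (s := chart γ c '' (Ioo a b ×ℂ Ioo (-δ) δ))
      (fun w hw => by rw [dbar_eq_zero_of_notMem_tsupport fun h => hw (hsupp h), mul_zero]),
      hcv, setIntegral_congr_fun hmeas hpt, ← hpre]
    have := volume_preserving_equiv_real_prod.setIntegral_preimage_emb
      measurableEquivRealProd.measurableEmbedding (fun p : ℝ × ℝ => q p.1 p.2)
      (Ioo a b ×ˢ Ioo (-δ) δ)
    refine Eq.trans this ?_
    rw [Measure.volume_eq_prod, ← setIntegral_prod_swap, setIntegral_prod]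
    · rfl
    · exact hqi.swap
  have hkeq : ∀ r, ∫ u in Ioo a b, q u r = k r := fun r => by
    simp only [hk]
    rw [intervalIntegral.integral_of_le hab.le, integral_Ioc_eq_integral_Ioo]
  have hki : IntervalIntegrable k volume (-δ) δ := by
    rw [intervalIntegrable_iff_integrableOn_Ioo_of_le (by linarith)]
    have h1 := hqi
    rw [IntegrableOn, ← Measure.prod_restrict] at h1
    have := h1.integral_prod_right
    simp only [hkeq] at this
    exact this
  have hfub' : ∫ w, g w * dbar ψ w = (∫ r in (-δ)..0, k r) + ∫ r in 0..δ, k r := by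
    rw [intervalIntegral.integral_add_adjacent_intervals, hfub,
      intervalIntegral.integral_of_le (by linarith), integral_Ioc_eq_integral_Ioo]
    · simp only [hkeq]
    · exact hki.mono_set (by
        rw [uIcc_of_le (by linarith), uIcc_of_le (by linarith)]; exact Icc_subset_Icc_right hδ.le)
    · exact hki.mono_set (by
        rw [uIcc_of_le (by linarith), uIcc_of_le (by linarith)]
        exact Icc_subset_Icc_left (by linarith))
  -- the derivative of the slice integrals
  have hJd : ∀ r ∈ Ioo (-δ) δ, r ≠ 0 → HasDerivAt J (-(2 * I) * k r) r := by
    intro r hr hr0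
    obtain ⟨ε, hε, hball⟩ : ∃ ε > 0, Metric.closedBall r ε ⊆ Ioo (-δ) δ ∩ {0}ᶜ :=
      Metric.nhds_basis_closedBall.mem_iff.1
        ((isOpen_Ioo.inter isOpen_compl_singleton).mem_nhds ⟨hr, hr0⟩)
    have hrI := Ioo_subset_Icc_self hr
    exact hasDerivAt_slice hab hγ hγ' hU hg hψ (Metric.closedBall_mem_nhds r hε)
      (isCompact_closedBall r ε)
      (fun u hu r' hr' => hgU u hu r' (Ioo_subset_Icc_self (hball hr').1) (hball hr').2)
      (hvanish a (left_mem_Icc.2 hab.le) r hrI (Or.inl (by simp)))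
      (hvanish b (right_mem_Icc.2 hab.le) r hrI (Or.inl (by simp)))
  -- dominated convergence for the slice integrals
  have hγc : ContinuousOn γ (Icc a b) := fun u hu => (hγ u hu).continuousAt.continuousWithinAt
  obtain ⟨D, hD⟩ := isCompact_Icc.exists_bound_of_continuousOn hγ'
  obtain ⟨E, hE⟩ := hψ.continuous.bounded_above_of_compact_support hc
  have hI : uIoc a b =ᵐ[volume] Ioo a b := by rw [uIoc_of_le hab.le]; exact Ioo_ae_eq_Ioc.symm
  have hlim : ∀ (l : Filter ℝ) (L : ℝ → ℂ), l.IsCountablyGenerated →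
      (∀ᶠ r in l, r ∈ Ioo (-δ) δ ∧ r ≠ 0) →
      (∀ u ∈ Ioo a b, Tendsto (fun r : ℝ => γ' u * (g (γ u + r * c) * ψ (γ u + r * c))) l
        (𝓝 (L u))) → Tendsto J l (𝓝 (∫ u in a..b, L u)) := by
    intro l L hl hev hL
    refine intervalIntegral.tendsto_integral_filter_of_dominated_convergence (fun _ => D * (K * E))
      ?_ ?_ intervalIntegrable_const ?_
    · filter_upwards [hev] with r hr
      have hmaps : MapsTo (fun u : ℝ => γ u + (r : ℂ) * c) (Icc a b) U := fun u hu =>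
        hgU u hu r (Ioo_subset_Icc_self hr.1) hr.2
      have h1 : ContinuousOn (fun u : ℝ => γ u + (r : ℂ) * c) (Icc a b) :=
        hγc.add continuousOn_const
      refine ContinuousOn.aestronglyMeasurable (ContinuousOn.mono (s := Icc a b) ?_ ?_)
        measurableSet_uIoc
      · exact hγ'.mul ((hg.continuousOn.comp h1 hmaps).mul (hψ.continuous.comp_continuousOn h1))
      · rw [uIoc_of_le hab.le]; exact Ioc_subset_Icc_self
    · refine Eventually.of_forall fun r => Eventually.of_forall fun u hu => ?_
      rw [uIoc_of_le hab.le] at hu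
      have h1 := hD u (Ioc_subset_Icc_self hu)
      have h2 := hgK (γ u + r * c)
      have h3 := hE (γ u + r * c)
      rw [norm_mul, norm_mul]
      have hK : 0 ≤ K := (norm_nonneg _).trans h2
      have hD0 : 0 ≤ D := (norm_nonneg _).trans h1
      gcongr
    · have := hI.mem_iff
      filter_upwards [this] with u hu hu'
      exact hL u (hu.1 hu')
  have hψt : ∀ (u r₀ : ℝ), Tendsto (fun r : ℝ => ψ (γ u + r * c)) (𝓝 r₀)
      (𝓝 (ψ (γ u + r₀ * c))) := fun u r₀ =>
    (hψ.continuous.comp (by fun_prop : Continuous fun r : ℝ => γ u + (r : ℂ) * c)).tendsto r₀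
  have hψ0 : ∀ (u : ℝ) (l : Filter ℝ), l ≤ 𝓝 0 → Tendsto (fun r : ℝ => ψ (γ u + r * c)) l
      (𝓝 (ψ (γ u))) := fun u l hl => by simpa using (hψt u 0).mono_left hl
  have hend : ∀ (r₀ : ℝ) (l : Filter ℝ), l.IsCountablyGenerated → l ≤ 𝓝 r₀ →
      (∀ᶠ r in l, r ∈ Ioo (-δ) δ ∧ r ≠ 0) → r₀ ∈ Icc (-δ) δ → r₀ ∉ Ioo (-δ) δ →
      Tendsto J l (𝓝 0) := by
    intro r₀ l hl hle hev hr₀ hr₀'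
    have := hlim l (fun _ => 0) hl hev fun u hu => by
      have h1 := (hψt u r₀).mono_left hle
      rw [hvanish u (Ioo_subset_Icc_self hu) r₀ hr₀ (Or.inr hr₀')] at h1
      have h2 : Tendsto (fun r : ℝ => g (γ u + r * c) * ψ (γ u + r * c)) l (𝓝 0) :=
        h1.zero_mul_isBoundedUnder_le ⟨K, by simpa using .of_forall fun r => hgK _⟩ |>.congr
          fun r => mul_comm _ _
      simpa using h2.const_mul (γ' u)
    simpa using this
  have e1 : ∀ᶠ r in 𝓝[>] (0 : ℝ), r ∈ Ioo (-δ) δ ∧ r ≠ 0 := by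
    filter_upwards [Ioo_mem_nhdsGT hδ] with r hr
    exact ⟨⟨by linarith [hr.1], hr.2⟩, hr.1.ne'⟩
  have e2 : ∀ᶠ r in 𝓝[<] (0 : ℝ), r ∈ Ioo (-δ) δ ∧ r ≠ 0 := by
    filter_upwards [Ioo_mem_nhdsLT (neg_lt_zero.2 hδ)] with r hr
    exact ⟨⟨hr.1, by linarith [hr.2]⟩, hr.2.ne⟩
  have e3 : ∀ᶠ r in 𝓝[<] δ, r ∈ Ioo (-δ) δ ∧ r ≠ 0 := by
    filter_upwards [Ioo_mem_nhdsLT hδ] with r hr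
    exact ⟨⟨by linarith [hr.1], hr.2⟩, hr.1.ne'⟩
  have e4 : ∀ᶠ r in 𝓝[>] (-δ), r ∈ Ioo (-δ) δ ∧ r ≠ 0 := by
    filter_upwards [Ioo_mem_nhdsGT (neg_lt_zero.2 hδ)] with r hr
    exact ⟨⟨hr.1, by linarith [hr.2]⟩, hr.2.ne⟩
  have hup := intervalIntegral.integral_eq_sub_of_hasDerivAt_of_tendsto hδ
    (f := J) (f' := fun r => -(2 * I) * k r)
    (fun r hr => hJd r ⟨by linarith [hr.1], hr.2⟩ hr.1.ne')
    ((hki.mono_set (by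
        rw [uIcc_of_le (by linarith), uIcc_of_le (by linarith)]
        exact Icc_subset_Icc_left (by linarith))).const_mul _)
    (hlim _ (fun u => γ' u * (jp u * ψ (γ u))) inferInstance e1 fun u hu =>
      ((hgp u hu).mul (hψ0 u _ nhdsWithin_le_nhds)).const_mul _)
    (hend δ _ inferInstance nhdsWithin_le_nhds e3 (by simp [hδ.le]) (by simp))
  have hdn := intervalIntegral.integral_eq_sub_of_hasDerivAt_of_tendsto (neg_lt_zero.2 hδ)
    (f := J) (f' := fun r => -(2 * I) * k r)
    (fun r hr => hJd r ⟨hr.1, by linarith [hr.2]⟩ hr.2.ne)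
    ((hki.mono_set (by
        rw [uIcc_of_le (by linarith), uIcc_of_le (by linarith)]
        exact Icc_subset_Icc_right (by linarith))).const_mul _)
    (hend (-δ) _ inferInstance nhdsWithin_le_nhds e4 (by simp [hδ.le]) (by simp))
    (hlim _ (fun u => γ' u * (jm u * ψ (γ u))) inferInstance e2 fun u hu =>
      ((hgm' u hu).mul (hψ0 u _ nhdsWithin_le_nhds)).const_mul _)
  rw [intervalIntegral.integral_const_mul] at hup hdn
  rw [hfub']
  linear_combination (I / 2) * hup + (I / 2) * hdn +
    ((∫ r in (-δ)..0, k r) + ∫ r in 0..δ, k r) * I_sq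

end Green


/-! ### The two sides of a contour -/

/-- Multiplication by a nonzero complex number, as a real-linear equivalence. -/
noncomputable def mulEquiv (p : ℂ) (hp : p ≠ 0) : ℂ ≃L[ℝ] ℂ :=
  ContinuousLinearEquiv.equivOfInverse (ContinuousLinearMap.mul ℝ ℂ p)
    (ContinuousLinearMap.mul ℝ ℂ p⁻¹) (fun x => by simp [hp]) (fun x => by simp [hp])

lemma mulEquiv_apply (p : ℂ) (hp : p ≠ 0) (x : ℂ) : mulEquiv p hp x = p * x := rfl

/-- With the transversal direction `i γ'(s)`, the coordinates next to `γ` are conformal at `γ s`. -/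
lemma hasStrictFDerivAt_chart {γ : ℝ → ℂ} {p : ℂ} {s : ℝ} (h : HasStrictDerivAt γ p s)
    (hp : p ≠ 0) :
    HasStrictFDerivAt (chart γ (I * p)) (mulEquiv p hp : ℂ →L[ℝ] ℂ) (s : ℂ) := by
  have h0 : HasStrictFDerivAt γ (ContinuousLinearMap.toSpanSingleton ℝ p) (reCLM (s : ℂ)) := by
    simpa using h.hasStrictFDerivAt
  have h1 := h0.comp (s : ℂ) reCLM.hasStrictFDerivAt
  have h2 := (imCLM.smulRight (I * p)).hasStrictFDerivAt (x := (s : ℂ))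
  have h3 := h1.add h2
  have h4 : HasStrictFDerivAt (chart γ (I * p)) _ (s : ℂ) :=
    h3.congr_of_eventuallyEq (Eventually.of_forall fun x => by simp [chart])
  refine h4.congr_fderiv ?_
  ext v
  rw [ContinuousLinearEquiv.coe_coe, mulEquiv_apply]
  simp only [_root_.add_apply, ContinuousLinearMap.comp_apply, reCLM_apply,
    ContinuousLinearMap.toSpanSingleton_apply, ContinuousLinearMap.smulRight_apply, imCLM_apply,
    Complex.real_smul]
  conv_rhs => rw [← Complex.re_add_im v]
  ring

/-- Leaving a point of `γ` along any direction that points to the left, one stays on the left side,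
although the approach filters of the points of `γ` are defined by means of different transversal
directions. -/
lemma tendsto_leftOf_rightOf {γ : ℝ → ℂ} {c : ℂ} {u : ℝ} (h : HasStrictDerivAt γ (deriv γ u) u)
    (hc : 0 < ((starRingEnd ℂ) (deriv γ u) * c).im) :
    Tendsto (fun r : ℝ => γ u + r * c) (𝓝[>] 0) (leftOf γ u) ∧
      Tendsto (fun r : ℝ => γ u + r * c) (𝓝[<] 0) (rightOf γ u) := by
  set p := deriv γ u with hpdef
  have hp : p ≠ 0 := by rintro h0; simp [h0] at hc
  have hS := hasStrictFDerivAt_chart h hp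
  set e := hS.localInverse (chart γ (I * p)) (mulEquiv p hp) (u : ℂ) with he
  have hu : chart γ (I * p) (u : ℂ) = γ u := by simp [chart]
  have hinv := hS.to_localInverse
  rw [hu] at hinv
  have heu : e (γ u) = (u : ℂ) := by
    have := hS.localInverse_apply_image
    rwa [hu] at this
  have hlin : HasDerivAt (fun r : ℝ => γ u + (r : ℂ) * c) c 0 := by
    simpa using ((Complex.ofRealCLM.hasDerivAt (x := 0)).mul_const c).const_add (γ u)
  have hz : γ u + ((0 : ℝ) : ℂ) * c = γ u := by simp
  have hq : HasDerivAt (fun r : ℝ => e (γ u + (r : ℂ) * c)) (p⁻¹ * c) 0 := by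
    have h1 := hinv.hasFDerivAt
    rw [← hz] at h1
    have := h1.comp_hasDerivAt (0 : ℝ) hlin
    exact this
  have hq0 : e (γ u + ((0 : ℝ) : ℂ) * c) = (u : ℂ) := by rw [hz, heu]
  have hcontr : Tendsto (fun r : ℝ => (e (γ u + (r : ℂ) * c)).re) (𝓝 0) (𝓝 u) := by
    have := (Complex.continuous_re.tendsto _).comp hq.continuousAt.tendsto
    rw [hq0] at this
    exact this
  have hcontl : Tendsto (fun r : ℝ => γ u + (r : ℂ) * c) (𝓝 0) (𝓝 (γ u)) := by
    simpa using hlin.continuousAt.tendsto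
  have hright : ∀ᶠ r : ℝ in 𝓝 0, γ (e (γ u + (r : ℂ) * c)).re +
      ((e (γ u + (r : ℂ) * c)).im : ℂ) * (I * p) = γ u + (r : ℂ) * c := by
    have h1 := hS.eventually_right_inverse
    rw [hu] at h1
    filter_upwards [hcontl.eventually h1] with r hr
    exact hr
  have him : HasDerivAt (fun r : ℝ => (e (γ u + (r : ℂ) * c)).im) ((p⁻¹ * c).im) 0 :=
    imCLM.hasFDerivAt.comp_hasDerivAt (0 : ℝ) hq
  have hpos : 0 < (p⁻¹ * c).im := by
    have hn : 0 < Complex.normSq p := Complex.normSq_pos.2 hp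
    have : p⁻¹ * c = (((Complex.normSq p)⁻¹ : ℝ) : ℂ) * ((starRingEnd ℂ) p * c) := by
      rw [Complex.inv_def]; ring
    rw [this, Complex.im_ofReal_mul]
    positivity
  have hcim : Tendsto (fun r : ℝ => (e (γ u + (r : ℂ) * c)).im) (𝓝 0) (𝓝 0) := by
    have := him.continuousAt.tendsto
    simpa [heu] using this
  have hslope := hasDerivAt_iff_tendsto_slope.1 him
  have hev : ∀ᶠ r : ℝ in 𝓝[≠] (0 : ℝ), 0 < r⁻¹ * (e (γ u + (r : ℂ) * c)).im := by
    filter_upwards [hslope.eventually (lt_mem_nhds hpos)] with r hr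
    simpa [slope, heu] using hr
  constructor
  · have h1 : Tendsto (fun r : ℝ => ((e (γ u + (r : ℂ) * c)).re, (e (γ u + (r : ℂ) * c)).im))
        (𝓝[>] 0) (𝓝 u ×ˢ 𝓝[>] 0) := by
      refine (hcontr.mono_left nhdsWithin_le_nhds).prodMk
        (tendsto_nhdsWithin_iff.2 ⟨hcim.mono_left nhdsWithin_le_nhds, ?_⟩)
      filter_upwards [nhdsGT_le_nhdsNE 0 hev, self_mem_nhdsWithin] with r hr hr0
      exact (pos_iff_pos_of_mul_pos hr).1 (inv_pos.2 hr0)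
    refine (tendsto_map.comp h1).congr' ?_
    filter_upwards [nhdsWithin_le_nhds hright] with r hr
    exact hr
  · have h1 : Tendsto (fun r : ℝ => ((e (γ u + (r : ℂ) * c)).re, (e (γ u + (r : ℂ) * c)).im))
        (𝓝[<] 0) (𝓝 u ×ˢ 𝓝[<] 0) := by
      refine (hcontr.mono_left nhdsWithin_le_nhds).prodMk
        (tendsto_nhdsWithin_iff.2 ⟨hcim.mono_left nhdsWithin_le_nhds, ?_⟩)
      filter_upwards [nhdsLT_le_nhdsNE 0 hev, self_mem_nhdsWithin] with r hr hr0
      exact (neg_iff_neg_of_mul_pos hr).1 (inv_lt_zero.2 hr0)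
    refine (tendsto_map.comp h1).congr' ?_
    filter_upwards [nhdsWithin_le_nhds hright] with r hr
    exact hr

lemma tendsto_above_below (u : ℝ) :
    Tendsto (fun r : ℝ => (u : ℂ) + r * I) (𝓝[>] 0) (above u) ∧
      Tendsto (fun r : ℝ => (u : ℂ) + r * I) (𝓝[<] 0) (below u) := by
  have h : Tendsto (fun r : ℝ => (u : ℂ) + r * I) (𝓝 0) (𝓝 (u : ℂ)) := by
    have : Continuous fun r : ℝ => (u : ℂ) + r * I := by fun_prop
    simpa using this.tendsto 0
  constructor
  · refine tendsto_nhdsWithin_iff.2 ⟨h.mono_left nhdsWithin_le_nhds, ?_⟩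
    filter_upwards [self_mem_nhdsWithin] with r hr
    simpa using hr
  · refine tendsto_nhdsWithin_iff.2 ⟨h.mono_left nhdsWithin_le_nhds, ?_⟩
    filter_upwards [self_mem_nhdsWithin] with r hr
    simpa using hr

instance above_neBot (l : ℝ) : (above l).NeBot := (tendsto_above_below l).1.neBot

instance below_neBot (l : ℝ) : (below l).NeBot := (tendsto_above_below l).2.neBot

instance leftOf_neBot (γ : ℝ → ℂ) (s : ℝ) : (leftOf γ s).NeBot := by
  unfold leftOf; infer_instance

instance rightOf_neBot (γ : ℝ → ℂ) (s : ℝ) : (rightOf γ s).NeBot := by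
  unfold rightOf; infer_instance

namespace Contour

variable (C : Contour)

lemma isCompact_arc (k : Fin C.p) : IsCompact (C.arc k '' Icc 0 1) :=
  isCompact_Icc.image_of_continuousOn (C.contDiffOn_arc k).continuousOn

lemma isClosed_carrier : IsClosed C.carrier :=
  (isClosed_eq Complex.continuous_im continuous_const).union
    (isClosed_iUnion_of_finite fun k => (C.isCompact_arc k).isClosed)

lemma isOpen_compl_carrier : IsOpen C.carrierᶜ := C.isClosed_carrier.isOpen_compl

lemma ofReal_mem_carrier (l : ℝ) : (l : ℂ) ∈ C.carrier := Or.inl (Complex.ofReal_im l)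

lemma arc_mem_carrier (k : Fin C.p) {s : ℝ} (hs : s ∈ Icc (0 : ℝ) 1) : C.arc k s ∈ C.carrier :=
  Or.inr (mem_iUnion.2 ⟨k, s, hs, rfl⟩)

lemma im_ne_zero_of_notMem {z : ℂ} (hz : z ∉ C.carrier) : z.im ≠ 0 := fun h => hz (Or.inl h)

/-- Far away from the origin the contour consists of the real line only. -/
lemma exists_arc_bound : ∃ R : ℝ, 0 < R ∧ ∀ k, ∀ s ∈ Icc (0 : ℝ) 1, ‖C.arc k s‖ ≤ R := by
  have : IsCompact (⋃ k, C.arc k '' Icc 0 1) := isCompact_iUnion fun k => C.isCompact_arc k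
  obtain ⟨R, hR⟩ := this.isBounded.exists_norm_le
  refine ⟨max R 1, by positivity, fun k s hs => (hR _ (mem_iUnion.2 ⟨k, s, hs, rfl⟩)).trans
    (le_max_left _ _)⟩

lemma contDiffAt_arc (k : Fin C.p) {s : ℝ} (hs : s ∈ Ioo (0 : ℝ) 1) :
    ContDiffAt ℝ 1 (C.arc k) s :=
  (C.contDiffOn_arc k).contDiffAt (Icc_mem_nhds hs.1 hs.2)

lemma hasStrictDerivAt_arc (k : Fin C.p) {s : ℝ} (hs : s ∈ Ioo (0 : ℝ) 1) :
    HasStrictDerivAt (C.arc k) (deriv (C.arc k) s) s :=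
  (C.contDiffAt_arc k hs).hasStrictDerivAt (by norm_num)

lemma continuousOn_deriv_arc (k : Fin C.p) : ContinuousOn (deriv (C.arc k)) (Ioo 0 1) :=
  ((C.contDiffOn_arc k).mono Ioo_subset_Icc_self).continuousOn_deriv_of_isOpen isOpen_Ioo
    (by norm_num)

lemma exists_deriv_arc_bound (k : Fin C.p) :
    ∃ D : ℝ, ∀ s ∈ Ioo (0 : ℝ) 1, ‖deriv (C.arc k) s‖ ≤ D := by
  have h := (C.contDiffOn_arc k).continuousOn_derivWithin (uniqueDiffOn_Icc zero_lt_one)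
    (by norm_num)
  obtain ⟨D, hD⟩ := isCompact_Icc.exists_bound_of_continuousOn h
  refine ⟨D, fun s hs => ?_⟩
  rw [← derivWithin_of_mem_nhds (Icc_mem_nhds hs.1 hs.2)]
  exact hD s (Ioo_subset_Icc_self hs)

lemma finite_arc_preimage_nodes (k : Fin C.p) :
    {s ∈ Ioo (0 : ℝ) 1 | C.arc k s ∈ C.nodes}.Finite := by
  refine Set.Finite.of_finite_image (C.nodes.finite_toSet.subset ?_)
    ((C.injOn_arc k).mono fun _ h => h.1)
  rintro _ ⟨s, hs, rfl⟩
  exact hs.2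

lemma exists_box_of_eventually {s : ℝ} {p : ℂ → Prop} (h : ∀ᶠ ζ in 𝓝 (s : ℂ), p ζ) :
    ∃ δ₀ : ℝ, 0 < δ₀ ∧ ∀ δ ≤ δ₀, ∀ ζ ∈ Icc (s - δ) (s + δ) ×ℂ Icc (-δ) δ, p ζ := by
  obtain ⟨ε, hε, hb⟩ := Metric.eventually_nhds_iff_ball.1 h
  refine ⟨ε / 3, by positivity, fun δ hδ ζ hζ => hb ζ ?_⟩
  have h1 : |ζ.re - s| ≤ δ := abs_sub_le_iff.2 ⟨by linarith [hζ.1.2], by linarith [hζ.1.1]⟩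
  have h2 : |ζ.im| ≤ δ := abs_le.2 hζ.2
  have h3 := Complex.norm_le_abs_re_add_abs_im (ζ - s)
  simp only [Complex.sub_re, Complex.ofReal_re, Complex.sub_im, Complex.ofReal_im, sub_zero] at h3
  rw [mem_ball_iff_norm]
  linarith

/-- Near a point of an arc other than a node, the arc is the axis `r = 0` of a chart, and there is
nothing else of the contour in the chart. -/
lemma exists_arc_chart (k : Fin C.p) {s : ℝ} (hs : s ∈ Ioo (0 : ℝ) 1)
    (hn : C.arc k s ∉ C.nodes) :
    ∃ δ : ℝ, 0 < δ ∧ Icc (s - δ) (s + δ) ⊆ Ioo (0 : ℝ) 1 ∧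
      InjOn (chart (C.arc k) (I * deriv (C.arc k) s)) (Icc (s - δ) (s + δ) ×ℂ Icc (-δ) δ) ∧
      IsOpen (chart (C.arc k) (I * deriv (C.arc k) s) '' (Ioo (s - δ) (s + δ) ×ℂ Ioo (-δ) δ)) ∧
      (∀ u ∈ Icc (s - δ) (s + δ),
        0 < ((starRingEnd ℂ) (deriv (C.arc k) u) * (I * deriv (C.arc k) s)).im) ∧
      ∀ ζ ∈ Icc (s - δ) (s + δ) ×ℂ Icc (-δ) δ,
        chart (C.arc k) (I * deriv (C.arc k) s) ζ ∉ C.nodes ∧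
        (chart (C.arc k) (I * deriv (C.arc k) s) ζ).im ≠ 0 ∧
        ∀ l, ∀ u ∈ Icc (0 : ℝ) 1,
          C.arc l u = chart (C.arc k) (I * deriv (C.arc k) s) ζ → l = k ∧ ζ = u := by
  set γ := C.arc k with hγ
  set p := deriv γ s with hp
  have hp0 : p ≠ 0 := C.deriv_arc_ne_zero k s hs
  have hS := hasStrictFDerivAt_chart (C.hasStrictDerivAt_arc k hs) hp0
  set e := hS.toOpenPartialHomeomorph (chart γ (I * p)) with he
  have hes : (s : ℂ) ∈ e.source := hS.mem_toOpenPartialHomeomorph_source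
  have hcs : chart γ (I * p) (s : ℂ) = γ s := by simp [chart]
  have hsc := Ioo_subset_Icc_self hs
  have hre : Tendsto Complex.re (𝓝 (s : ℂ)) (𝓝 s) := by
    simpa using Complex.continuous_re.tendsto (s : ℂ)
  -- first choice: the chart is injective and contained in `(0, 1)`
  have h01 : ∀ᶠ ζ : ℂ in 𝓝 (s : ℂ), ζ.re ∈ Ioo (0 : ℝ) 1 := hre (Ioo_mem_nhds hs.1 hs.2)
  have hsrc : ∀ᶠ ζ : ℂ in 𝓝 (s : ℂ), ζ ∈ e.source := e.open_source.mem_nhds hes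
  obtain ⟨δ₁, hδ₁, hb₁⟩ := exists_box_of_eventually (hsrc.and h01)
  -- second choice: away from the remaining part of the contour
  have hcont : Tendsto (chart γ (I * p)) (𝓝 (s : ℂ)) (𝓝 (γ s)) := by
    have := hS.continuousAt.tendsto
    rwa [hcs] at this
  have hnode : ∀ᶠ ζ in 𝓝 (s : ℂ), chart γ (I * p) ζ ∉ C.nodes :=
    hcont (C.nodes.finite_toSet.isClosed.isOpen_compl.mem_nhds hn)
  have him : ∀ᶠ ζ in 𝓝 (s : ℂ), (chart γ (I * p) ζ).im ≠ 0 :=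
    hcont ((isClosed_eq Complex.continuous_im continuous_const).isOpen_compl.mem_nhds
      fun h => hn (C.meet_real_mem k s hsc h))
  have hother : ∀ᶠ ζ in 𝓝 (s : ℂ), ∀ l, l ≠ k → chart γ (I * p) ζ ∉ C.arc l '' Icc 0 1 := by
    refine eventually_all.2 fun l => ?_
    by_cases hl : l = k
    · exact Eventually.of_forall fun ζ h => (h hl).elim
    · have : (C.arc l '' Icc 0 1)ᶜ ∈ 𝓝 (γ s) :=
        (C.isCompact_arc l).isClosed.isOpen_compl.mem_nhds fun ⟨u, hu, h⟩ =>
          hn (C.meet_mem k l (Ne.symm hl) s hsc u hu h.symm)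
      filter_upwards [hcont this] with ζ hζ _ using hζ
  have hfar : ∀ᶠ ζ in 𝓝 (s : ℂ),
      chart γ (I * p) ζ ∉ γ '' (Icc 0 1 \ Ioo (s - δ₁) (s + δ₁)) := by
    have hcomp : IsCompact (γ '' (Icc 0 1 \ Ioo (s - δ₁) (s + δ₁))) :=
      (isCompact_Icc.diff isOpen_Ioo).image_of_continuousOn
        ((C.contDiffOn_arc k).continuousOn.mono sdiff_subset)
    refine hcont (hcomp.isClosed.isOpen_compl.mem_nhds ?_)
    rintro ⟨u, ⟨hu, hus⟩, h⟩
    rcases eq_or_lt_of_le hu.1 with h0 | h0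
    · exact hn (by rw [← h, ← h0]; exact C.arc_zero_mem k)
    rcases eq_or_lt_of_le hu.2 with h1 | h1
    · exact hn (by rw [← h, h1]; exact C.arc_one_mem k)
    have := C.injOn_arc k ⟨h0, h1⟩ hs h
    exact hus (by rw [this]; constructor <;> linarith)
  have hdet : ∀ᶠ ζ : ℂ in 𝓝 (s : ℂ),
      0 < ((starRingEnd ℂ) (deriv γ ζ.re) * (I * p)).im := by
    have hc : ContinuousAt (deriv γ) s :=
      (C.continuousOn_deriv_arc k).continuousAt (Ioo_mem_nhds hs.1 hs.2)
    have h1 : Tendsto (fun ζ : ℂ => ((starRingEnd ℂ) (deriv γ ζ.re) * (I * p)).im) (𝓝 (s : ℂ))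
        (𝓝 ((starRingEnd ℂ) p * (I * p)).im) :=
      (Complex.continuous_im.tendsto _).comp
        (((Complex.continuous_conj.tendsto _).comp (hc.tendsto.comp hre)).mul_const _)
    refine h1.eventually (lt_mem_nhds ?_)
    have : (starRingEnd ℂ) p * (I * p) = I * (Complex.normSq p : ℂ) := by
      rw [← Complex.mul_conj]; ring
    rw [this]
    simpa using hp0
  obtain ⟨δ₂, hδ₂, hb₂⟩ := exists_box_of_eventually
    ((hnode.and him).and ((hother.and hfar).and hdet))
  set δ := min δ₁ δ₂ with hδ
  have hδ0 : 0 < δ := lt_min hδ₁ hδ₂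
  have hB₁ := hb₁ δ (min_le_left _ _)
  have hB₂ := hb₂ δ (min_le_right _ _)
  have hreal : ∀ u ∈ Icc (s - δ) (s + δ), (u : ℂ) ∈ Icc (s - δ) (s + δ) ×ℂ Icc (-δ) δ :=
    fun u hu => ⟨by simpa using hu, by simpa using hδ0.le⟩
  have hinj : InjOn (chart γ (I * p)) (Icc (s - δ) (s + δ) ×ℂ Icc (-δ) δ) :=
    e.injOn.mono fun ζ hζ => (hB₁ ζ hζ).1
  refine ⟨δ, hδ0, fun u hu => ?_, hinj, ?_, fun u hu => ?_, fun ζ hζ => ?_⟩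
  · simpa using (hB₁ u (hreal u hu)).2
  · exact e.isOpen_image_of_subset_source (isOpen_Ioo.reProdIm isOpen_Ioo)
      fun ζ hζ => (hB₁ ζ ⟨Ioo_subset_Icc_self hζ.1, Ioo_subset_Icc_self hζ.2⟩).1
  · simpa using (hB₂ u (hreal u hu)).2.2
  · obtain ⟨⟨h1, h2⟩, ⟨h3, h4⟩, -⟩ := hB₂ ζ hζ
    refine ⟨h1, h2, fun l u hu h => ?_⟩
    have hl : l = k := by
      by_contra hl
      exact h3 l hl ⟨u, hu, h⟩
    subst hl
    refine ⟨rfl, ?_⟩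
    have hus : u ∈ Ioo (s - δ₁) (s + δ₁) := by
      by_contra hus
      exact h4 ⟨u, ⟨hu, hus⟩, h⟩
    have hu₁ : (u : ℂ) ∈ e.source := (hb₁ δ₁ le_rfl u
      ⟨by simpa using Ioo_subset_Icc_self hus, by simpa using hδ₁.le⟩).1
    refine (e.injOn hu₁ (hB₁ ζ hζ).1 ?_).symm
    change chart γ (I * p) u = chart γ (I * p) ζ
    rw [← h]; simp [chart, hγ]

/-- Near a point of the real line other than a node there is nothing else of the contour. -/
lemma exists_real_chart {l : ℝ} (hn : (l : ℂ) ∉ C.nodes) :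
    ∃ δ : ℝ, 0 < δ ∧ ∀ ζ ∈ Icc (l - δ) (l + δ) ×ℂ Icc (-δ) δ,
      ζ ∉ C.nodes ∧ ∀ k, ∀ u ∈ Icc (0 : ℝ) 1, C.arc k u ≠ ζ := by
  have hnode : ∀ᶠ ζ in 𝓝 (l : ℂ), ζ ∉ C.nodes :=
    C.nodes.finite_toSet.isClosed.isOpen_compl.mem_nhds hn
  have harc : ∀ᶠ ζ in 𝓝 (l : ℂ), ∀ k, ζ ∉ C.arc k '' Icc 0 1 := by
    refine eventually_all.2 fun k => (C.isCompact_arc k).isClosed.isOpen_compl.mem_nhds ?_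
    rintro ⟨u, hu, h⟩
    exact hn (h ▸ C.meet_real_mem k u hu (by simp [h]))
  obtain ⟨δ, hδ, hb⟩ := exists_box_of_eventually (hnode.and harc)
  exact ⟨δ, hδ, fun ζ hζ => ⟨(hb δ le_rfl ζ hζ).1,
    fun k u hu h => (hb δ le_rfl ζ hζ).2 k ⟨u, hu, h⟩⟩⟩

lemma tendsto_arc_transversal (k : Fin C.p) {s : ℝ} (hs : s ∈ Ioo (0 : ℝ) 1) :
    Tendsto (fun q : ℝ × ℝ => C.arc k q.1 + (q.2 : ℂ) * (I * deriv (C.arc k) s))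
      (𝓝 s ×ˢ 𝓝 (0 : ℝ)) (𝓝 (C.arc k s)) := by
  have h1 : Tendsto (fun q : ℝ × ℝ => C.arc k q.1) (𝓝 s ×ˢ 𝓝 (0 : ℝ)) (𝓝 (C.arc k s)) :=
    ((C.contDiffAt_arc k hs).continuousAt.tendsto).comp tendsto_fst
  have h2 : Tendsto (fun q : ℝ × ℝ => (q.2 : ℂ) * (I * deriv (C.arc k) s))
      (𝓝 s ×ˢ 𝓝 (0 : ℝ)) (𝓝 0) := by
    have : Tendsto (fun q : ℝ × ℝ => (q.2 : ℂ)) (𝓝 s ×ˢ 𝓝 (0 : ℝ)) (𝓝 ((0 : ℝ) : ℂ)) :=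
      (Complex.continuous_ofReal.tendsto 0).comp tendsto_snd
    simpa using this.mul_const (I * deriv (C.arc k) s)
  simpa using h1.add h2

lemma eventually_transversal_notMem (k : Fin C.p) {s : ℝ} (hs : s ∈ Ioo (0 : ℝ) 1)
    (hn : C.arc k s ∉ C.nodes) :
    ∀ᶠ q : ℝ × ℝ in 𝓝 s ×ˢ 𝓝 (0 : ℝ), q.2 ≠ 0 →
      C.arc k q.1 + (q.2 : ℂ) * (I * deriv (C.arc k) s) ∉ C.carrier := by
  obtain ⟨δ, hδ, -, -, -, -, hb⟩ := C.exists_arc_chart k hs hn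
  have : Ioo (s - δ) (s + δ) ×ˢ Ioo (-δ) δ ∈ 𝓝 s ×ˢ 𝓝 (0 : ℝ) :=
    prod_mem_prod (Ioo_mem_nhds (by linarith) (by linarith))
      (Ioo_mem_nhds (by linarith) (by linarith))
  filter_upwards [this] with q hq hq0 hmem
  obtain ⟨-, him, harc⟩ := hb ⟨q.1, q.2⟩ ⟨Ioo_subset_Icc_self hq.1, Ioo_subset_Icc_self hq.2⟩
  rcases hmem with h | h
  · exact him h
  · obtain ⟨l, u, hu, h⟩ := mem_iUnion.1 h
    have := congrArg Complex.im (harc l u hu h).2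
    exact hq0 (by simpa using this)

variable {C} {z : ℂ} {P N P' N' : Filter ℂ}

namespace HasSides

lemma neBot_left (h : C.HasSides z P N) : P.NeBot := by
  cases h <;> infer_instance

lemma neBot_right (h : C.HasSides z P N) : N.NeBot := by
  cases h <;> infer_instance

lemma le_nhds_left (h : C.HasSides z P N) : P ≤ 𝓝 z := by
  cases h with
  | real l hl => exact nhdsWithin_le_nhds
  | arc k s hs hn =>
    exact (C.tendsto_arc_transversal k hs).mono_left (prod_mono le_rfl nhdsWithin_le_nhds)

lemma le_nhds_right (h : C.HasSides z P N) : N ≤ 𝓝 z := by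
  cases h with
  | real l hl => exact nhdsWithin_le_nhds
  | arc k s hs hn =>
    exact (C.tendsto_arc_transversal k hs).mono_left (prod_mono le_rfl nhdsWithin_le_nhds)

lemma eventually_notMem (h : C.HasSides z P N) :
    (∀ᶠ w in P, w ∉ C.carrier) ∧ ∀ᶠ w in N, w ∉ C.carrier := by
  cases h with
  | real l hl =>
    obtain ⟨δ, hδ, hb⟩ := C.exists_real_chart hl
    have hev : ∀ᶠ w : ℂ in 𝓝 (l : ℂ), w.im ≠ 0 → w ∉ C.carrier := by
      have h1 : Ioo (l - δ) (l + δ) ×ℂ Ioo (-δ) δ ∈ 𝓝 (l : ℂ) :=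
        (isOpen_Ioo.reProdIm isOpen_Ioo).mem_nhds
          ⟨by constructor <;> simp [hδ], by simpa using hδ⟩
      filter_upwards [h1] with w hw hw0 hmem
      rcases hmem with h | h
      · exact hw0 h
      · obtain ⟨k, u, hu, h⟩ := mem_iUnion.1 h
        exact (hb w ⟨Ioo_subset_Icc_self hw.1, Ioo_subset_Icc_self hw.2⟩).2 k u hu h
    constructor
    · filter_upwards [nhdsWithin_le_nhds hev, self_mem_nhdsWithin] with w hw hw0
      exact hw (ne_of_gt hw0)
    · filter_upwards [nhdsWithin_le_nhds hev, self_mem_nhdsWithin] with w hw hw0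
      exact hw (ne_of_lt hw0)
  | arc k s hs hn =>
    have h := C.eventually_transversal_notMem k hs hn
    constructor
    · refine eventually_map.2 ?_
      filter_upwards [prod_mono le_rfl nhdsWithin_le_nhds h,
        tendsto_snd.eventually (eventually_mem_nhdsWithin (s := Ioi (0 : ℝ)))] with q hq hq0
      exact hq (ne_of_gt hq0)
    · refine eventually_map.2 ?_
      filter_upwards [prod_mono le_rfl nhdsWithin_le_nhds h,
        tendsto_snd.eventually (eventually_mem_nhdsWithin (s := Iio (0 : ℝ)))] with q hq hq0
      exact hq (ne_of_lt hq0)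

lemma notMem_nodes (h : C.HasSides z P N) : z ∉ C.nodes := by
  cases h <;> assumption

lemma mem_carrier (h : C.HasSides z P N) : z ∈ C.carrier := by
  cases h with
  | real l hl => exact C.ofReal_mem_carrier l
  | arc k s hs hn => exact C.arc_mem_carrier k (Ioo_subset_Icc_self hs)

/-- The two sides of the contour at a point are determined by the point. -/
lemma unique (h : C.HasSides z P N) (h' : C.HasSides z P' N') : P = P' ∧ N = N' := by
  cases h with
  | real l hl =>
    generalize hz : (l : ℂ) = z' at h'
    cases h' with
    | real l' hl' =>
      have := Complex.ofReal_injective hz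
      subst this
      exact ⟨rfl, rfl⟩
    | arc k s hs hn =>
      exact (hn (C.meet_real_mem k s (Ioo_subset_Icc_self hs) (by rw [← hz]; simp))).elim
  | arc k s hs hn =>
    generalize hz : C.arc k s = z' at h'
    cases h' with
    | real l hl =>
      exact (hn (C.meet_real_mem k s (Ioo_subset_Icc_self hs) (by rw [hz]; simp))).elim
    | arc k' s' hs' hn' =>
      by_cases hk : k = k'
      · subst hk
        have := C.injOn_arc k hs hs' hz
        subst this
        exact ⟨rfl, rfl⟩
      · exact (hn (C.meet_mem k k' hk s (Ioo_subset_Icc_self hs) s' (Ioo_subset_Icc_self hs')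
          hz)).elim

end HasSides

end Contour

/-! ### Integration along a contour -/

namespace Contour

variable (C : Contour)

/-- The contour integral of a scalar function. -/
noncomputable def cint (φ : ℂ → ℂ) : ℂ :=
  (∫ l : ℝ, φ l) + ∑ k, ∫ s in (0 : ℝ)..1, deriv (C.arc k) s * φ (C.arc k s)

/-- Absolute integrability of a scalar function along the contour. -/
def CIntegrable (φ : ℂ → ℂ) : Prop :=
  Integrable (fun l : ℝ => φ l) ∧
    ∀ k, IntervalIntegrable (fun s : ℝ => deriv (C.arc k) s * φ (C.arc k s)) volume 0 1

/-- Measurability of a scalar function along the contour. -/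
def CMeas (φ : ℂ → ℂ) : Prop :=
  AEStronglyMeasurable (fun l : ℝ => φ l) volume ∧
    ∀ k, AEStronglyMeasurable (fun s : ℝ => φ (C.arc k s)) (volume.restrict (Ioc 0 1))

/-- Equality of two functions at the points of the contour other than nodes. -/
def EqOffNodes {α : Type*} (φ χ : ℂ → α) : Prop :=
  ∀ z P N, C.HasSides z P N → φ z = χ z

lemma ae_real : ∀ᵐ l : ℝ, (l : ℂ) ∉ C.nodes := by
  have : {l : ℝ | (l : ℂ) ∈ C.nodes}.Finite :=
    Set.Finite.preimage (Complex.ofReal_injective.injOn) C.nodes.finite_toSet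
  exact (this.countable.ae_notMem volume)

lemma ae_arc (k : Fin C.p) : ∀ᵐ s ∂(volume.restrict (Ioc (0 : ℝ) 1)),
    s ∈ Ioo (0 : ℝ) 1 ∧ C.arc k s ∉ C.nodes := by
  have h1 := (C.finite_arc_preimage_nodes k).countable.ae_notMem (volume.restrict (Ioc (0 : ℝ) 1))
  have h2 : ∀ᵐ s ∂(volume.restrict (Ioc (0 : ℝ) 1)), s ∈ Ioo (0 : ℝ) 1 := by
    rw [← restrict_Ioo_eq_restrict_Ioc]
    exact ae_restrict_mem measurableSet_Ioo
  filter_upwards [h1, h2] with s hs hs'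
  exact ⟨hs', fun h => hs ⟨hs', h⟩⟩

variable {C} {φ χ : ℂ → ℂ}

lemma EqOffNodes.ae_real {α : Type*} {φ χ : ℂ → α} (h : C.EqOffNodes φ χ) :
    (fun l : ℝ => φ l) =ᵐ[volume] fun l : ℝ => χ l := by
  filter_upwards [C.ae_real] with l hl
  exact h _ _ _ (.real l hl)

lemma EqOffNodes.ae_arc {α : Type*} {φ χ : ℂ → α} (h : C.EqOffNodes φ χ) (k : Fin C.p) :
    (fun s : ℝ => φ (C.arc k s)) =ᵐ[volume.restrict (Ioc 0 1)] fun s => χ (C.arc k s) := by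
  filter_upwards [C.ae_arc k] with s hs
  exact h _ _ _ (.arc k s hs.1 hs.2)

lemma cint_congr (h : C.EqOffNodes φ χ) : C.cint φ = C.cint χ := by
  unfold cint
  congr 1
  · exact integral_congr_ae h.ae_real
  · refine Finset.sum_congr rfl fun k _ => ?_
    rw [intervalIntegral.integral_of_le zero_le_one, intervalIntegral.integral_of_le zero_le_one]
    refine integral_congr_ae ?_
    filter_upwards [h.ae_arc k] with s hs
    rw [hs]

lemma CMeas.congr (h : C.CMeas φ) (he : C.EqOffNodes φ χ) : C.CMeas χ :=
  ⟨h.1.congr he.ae_real, fun k => (h.2 k).congr (he.ae_arc k)⟩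

lemma CMeas.mul (h : C.CMeas φ) (h' : C.CMeas χ) : C.CMeas fun z => φ z * χ z :=
  ⟨h.1.mul h'.1, fun k => (h.2 k).mul (h'.2 k)⟩

lemma CMeas.sub (h : C.CMeas φ) (h' : C.CMeas χ) : C.CMeas fun z => φ z - χ z :=
  ⟨h.1.sub h'.1, fun k => (h.2 k).sub (h'.2 k)⟩

lemma aemeasurable_arc (k : Fin C.p) :
    AEMeasurable (C.arc k) (volume.restrict (Ioc (0 : ℝ) 1)) :=
  ((C.contDiffOn_arc k).continuousOn.mono Ioc_subset_Icc_self).aemeasurable measurableSet_Ioc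

lemma cmeas_of_measurable (h : Measurable φ) : C.CMeas φ :=
  ⟨(h.comp Complex.measurable_ofReal).aestronglyMeasurable,
    fun k => (h.comp_aemeasurable (aemeasurable_arc k)).aestronglyMeasurable⟩

/-- A function which is bounded on the arcs and dominated on the real line is integrable. -/
lemma CMeas.cintegrable (h : C.CMeas φ) {β : ℝ → ℝ} {D : ℝ} (hβ : Integrable β)
    (hr : ∀ l : ℝ, (l : ℂ) ∉ C.nodes → ‖φ l‖ ≤ β l)
    (ha : ∀ k, ∀ s ∈ Ioo (0 : ℝ) 1, C.arc k s ∉ C.nodes → ‖φ (C.arc k s)‖ ≤ D) :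
    C.CIntegrable φ := by
  refine ⟨hβ.mono' h.1 ?_, fun k => ?_⟩
  · filter_upwards [C.ae_real] with l hl using hr l hl
  · rw [intervalIntegrable_iff_integrableOn_Ioc_of_le zero_le_one]
    obtain ⟨D', hD'⟩ := C.exists_deriv_arc_bound k
    refine Integrable.mono' (g := fun _ => D' * D) (integrable_const _)
      ((measurable_deriv _).aestronglyMeasurable.mul (h.2 k)) ?_
    filter_upwards [C.ae_arc k] with s hs
    rw [norm_mul]
    have h1 := hD' s hs.1
    exact mul_le_mul h1 (ha k s hs.1 hs.2) (norm_nonneg _) ((norm_nonneg _).trans h1)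

lemma cint_const_mul (c : ℂ) : C.cint (fun z => c * φ z) = c * C.cint φ := by
  unfold cint
  rw [integral_const_mul, mul_add, Finset.mul_sum]
  congr 1
  refine Finset.sum_congr rfl fun k _ => ?_
  rw [← intervalIntegral.integral_const_mul]
  refine intervalIntegral.integral_congr fun s _ => ?_
  simp only; ring

lemma cint_sum {ι : Type*} (t : Finset ι) {φ : ι → ℂ → ℂ} (h : ∀ i ∈ t, C.CIntegrable (φ i)) :
    C.cint (fun z => ∑ i ∈ t, φ i z) = ∑ i ∈ t, C.cint (φ i) := by
  unfold cint
  rw [integral_finsetSum _ fun i hi => (h i hi).1, Finset.sum_add_distrib]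
  congr 1
  rw [Finset.sum_comm]
  refine Finset.sum_congr rfl fun k _ => ?_
  rw [← intervalIntegral.integral_finsetSum fun i hi => (h i hi).2 k]
  simp only [Finset.mul_sum]

end Contour

/-! ### Sectionally holomorphic functions -/

/-- `f` is holomorphic and bounded off the contour, has boundary values from both sides at the points
of the contour other than nodes, and `φ = f₊ - f₋` is its jump. -/
structure HasJump (C : Contour) (f φ : ℂ → ℂ) : Prop where
  diff : DifferentiableOn ℂ f C.carrierᶜ
  bdd : ∃ K : ℝ, ∀ z ∉ C.carrier, ‖f z‖ ≤ K
  jump : ∀ z P N, C.HasSides z P N →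
    ∃ a b, Tendsto f P (𝓝 a) ∧ Tendsto f N (𝓝 b) ∧ φ z = a - b

/-- `f = O(1/z)` off the contour. -/
def Decays (C : Contour) (f : ℂ → ℂ) : Prop :=
  ∃ K : ℝ, ∀ z ∉ C.carrier, ‖f z‖ ≤ K / (1 + ‖z‖)

variable {C : Contour} {f g φ χ : ℂ → ℂ}

/-- Extension by zero to the contour, which makes a function holomorphic off the contour
measurable. -/
noncomputable abbrev offContour (C : Contour) (f : ℂ → ℂ) : ℂ → ℂ := C.carrierᶜ.indicator f

lemma measurable_offContour (hf : DifferentiableOn ℂ f C.carrierᶜ) :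
    Measurable (offContour C f) := by
  classical
  have := ContinuousOn.measurable_piecewise hf.continuousOn
    (continuousOn_const (c := (0 : ℂ)) (s := C.carrierᶜᶜ)) C.isOpen_compl_carrier.measurableSet
  convert this using 1
  ext z
  by_cases hz : z ∈ C.carrierᶜ
  · simp [hz]
  · simp [hz]

lemma offContour_differentiableOn (hf : DifferentiableOn ℂ f C.carrierᶜ) :
    DifferentiableOn ℂ (offContour C f) C.carrierᶜ :=
  hf.congr fun _ hz => indicator_of_mem hz f

lemma offContour_tendsto_left {z a : ℂ} {P N : Filter ℂ} (h : C.HasSides z P N)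
    (hf : Tendsto f P (𝓝 a)) : Tendsto (offContour C f) P (𝓝 a) :=
  hf.congr' (h.eventually_notMem.1.mono fun _ hw => (indicator_of_mem hw f).symm)

lemma offContour_tendsto_right {z a : ℂ} {P N : Filter ℂ} (h : C.HasSides z P N)
    (hf : Tendsto f N (𝓝 a)) : Tendsto (offContour C f) N (𝓝 a) :=
  hf.congr' (h.eventually_notMem.2.mono fun _ hw => (indicator_of_mem hw f).symm)

/-- A function on the contour which is a pointwise limit of `g` along one sequence of normal
displacements is measurable. -/
lemma cmeas_of_tendsto_seq {F : ℂ → ℂ} (hg : Measurable g) (r : ℕ → ℝ)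
    (hr : ∀ l : ℝ, (l : ℂ) ∉ C.nodes →
      Tendsto (fun n => g ((l : ℂ) + r n * I)) atTop (𝓝 (F l)))
    (ha : ∀ k, ∀ s ∈ Ioo (0 : ℝ) 1, C.arc k s ∉ C.nodes →
      Tendsto (fun n => g (C.arc k s + r n * (I * deriv (C.arc k) s))) atTop
        (𝓝 (F (C.arc k s)))) : C.CMeas F := by
  refine ⟨aestronglyMeasurable_of_tendsto_ae atTop
    (f := fun n (l : ℝ) => g ((l : ℂ) + r n * I)) (fun n => ?_) ?_, fun k =>
    aestronglyMeasurable_of_tendsto_ae atTop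
      (f := fun n (s : ℝ) => g (C.arc k s + r n * (I * deriv (C.arc k) s))) (fun n => ?_) ?_⟩
  · exact (hg.comp (by fun_prop)).aestronglyMeasurable
  · filter_upwards [C.ae_real] with l hl using hr l hl
  · have h1 : AEMeasurable (fun s => (r n : ℂ) * (I * deriv (C.arc k) s))
        (volume.restrict (Ioc (0 : ℝ) 1)) :=
      (((measurable_deriv (C.arc k)).const_mul I).const_mul _).aemeasurable
    exact (hg.comp_aemeasurable ((Contour.aemeasurable_arc k).add h1)).aestronglyMeasurable
  · filter_upwards [C.ae_arc k] with s hs using ha k s hs.1 hs.2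

lemma im_conj_mul_I_mul_pos {p : ℂ} (hp : p ≠ 0) : 0 < ((starRingEnd ℂ) p * (I * p)).im := by
  have : (starRingEnd ℂ) p * (I * p) = I * (Complex.normSq p : ℂ) := by
    rw [← Complex.mul_conj]; ring
  rw [this]
  simpa using hp

/-- Boundary values are measurable along the contour, being limits along a sequence of displaced
contours. -/
lemma cmeas_left {F : ℂ → ℂ} (hf : DifferentiableOn ℂ f C.carrierᶜ)
    (hF : ∀ z P N, C.HasSides z P N → Tendsto f P (𝓝 (F z))) : C.CMeas F := by
  have hseq : Tendsto (fun n : ℕ => 1 / ((n : ℝ) + 1)) atTop (𝓝[>] 0) :=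
    tendsto_nhdsWithin_iff.2 ⟨tendsto_one_div_add_atTop_nhds_zero_nat,
      Eventually.of_forall fun n => by simp only [mem_Ioi]; positivity⟩
  refine cmeas_of_tendsto_seq (measurable_offContour hf) (fun n : ℕ => 1 / ((n : ℝ) + 1))
    (fun l hl => ?_) (fun k s hs hn => ?_)
  · have h := Contour.HasSides.real l hl
    exact (offContour_tendsto_left h (hF _ _ _ h)).comp ((tendsto_above_below l).1.comp hseq)
  · have h := Contour.HasSides.arc k s hs hn
    exact (offContour_tendsto_left h (hF _ _ _ h)).comp
      ((tendsto_leftOf_rightOf (C.hasStrictDerivAt_arc k hs)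
        (im_conj_mul_I_mul_pos (C.deriv_arc_ne_zero k s hs))).1.comp hseq)

lemma cmeas_right {F : ℂ → ℂ} (hf : DifferentiableOn ℂ f C.carrierᶜ)
    (hF : ∀ z P N, C.HasSides z P N → Tendsto f N (𝓝 (F z))) : C.CMeas F := by
  have hseq : Tendsto (fun n : ℕ => -(1 / ((n : ℝ) + 1))) atTop (𝓝[<] 0) :=
    tendsto_nhdsWithin_iff.2 ⟨by simpa using (tendsto_one_div_add_atTop_nhds_zero_nat (𝕜 := ℝ)).neg,
      Eventually.of_forall fun n => by
        simp only [mem_Iio, neg_lt_zero]; positivity⟩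
  refine cmeas_of_tendsto_seq (measurable_offContour hf) (fun n : ℕ => -(1 / ((n : ℝ) + 1)))
    (fun l hl => ?_) (fun k s hs hn => ?_)
  · have h := Contour.HasSides.real l hl
    exact (offContour_tendsto_right h (hF _ _ _ h)).comp ((tendsto_above_below l).2.comp hseq)
  · have h := Contour.HasSides.arc k s hs hn
    exact (offContour_tendsto_right h (hF _ _ _ h)).comp
      ((tendsto_leftOf_rightOf (C.hasStrictDerivAt_arc k hs)
        (im_conj_mul_I_mul_pos (C.deriv_arc_ne_zero k s hs))).2.comp hseq)

namespace HasJump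

lemma exists_boundary (h : HasJump C f φ) : ∃ fp fm : ℂ → ℂ,
    (∀ z P N, C.HasSides z P N → Tendsto f P (𝓝 (fp z))) ∧
    (∀ z P N, C.HasSides z P N → Tendsto f N (𝓝 (fm z))) ∧
    C.EqOffNodes φ (fun z => fp z - fm z) := by
  classical
  have : ∀ z, ∃ a b : ℂ, ∀ P N, C.HasSides z P N →
      Tendsto f P (𝓝 a) ∧ Tendsto f N (𝓝 b) ∧ φ z = a - b := by
    intro z
    by_cases hz : ∃ P N, C.HasSides z P N
    · obtain ⟨P, N, hs⟩ := hz
      obtain ⟨a, b, h1⟩ := h.jump z P N hs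
      refine ⟨a, b, fun P' N' hs' => ?_⟩
      obtain ⟨rfl, rfl⟩ := hs.unique hs'
      exact h1
    · exact ⟨0, 0, fun P N hs => (hz ⟨P, N, hs⟩).elim⟩
  choose fp fm hb using this
  exact ⟨fp, fm, fun z P N hs => (hb z P N hs).1, fun z P N hs => (hb z P N hs).2.1,
    fun z P N hs => (hb z P N hs).2.2⟩

lemma cmeas (h : HasJump C f φ) : C.CMeas φ := by
  obtain ⟨fp, fm, hp, hm, he⟩ := h.exists_boundary
  exact ((cmeas_left h.diff hp).sub (cmeas_right h.diff hm)).congr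
    fun z P N hs => (he z P N hs).symm

/-- A bound for `f` off the contour is inherited by the boundary values, hence by the jump. -/
lemma norm_jump_le (h : HasJump C f φ) {β : ℂ → ℝ} (hβ : Continuous β)
    (hb : ∀ z ∉ C.carrier, ‖f z‖ ≤ β z) {z : ℂ} {P N : Filter ℂ} (hs : C.HasSides z P N) :
    ‖φ z‖ ≤ 2 * β z := by
  obtain ⟨a, b, ha, hb', he⟩ := h.jump z P N hs
  have := hs.neBot_left
  have := hs.neBot_right
  have h1 : ‖a‖ ≤ β z := le_of_tendsto_of_tendsto ha.norm
    ((hβ.tendsto z).mono_left hs.le_nhds_left) (hs.eventually_notMem.1.mono hb)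
  have h2 : ‖b‖ ≤ β z := le_of_tendsto_of_tendsto hb'.norm
    ((hβ.tendsto z).mono_left hs.le_nhds_right) (hs.eventually_notMem.2.mono hb)
  rw [he]
  calc ‖a - b‖ ≤ ‖a‖ + ‖b‖ := norm_sub_le _ _
    _ ≤ 2 * β z := by linarith

lemma congr_jump (h : HasJump C f φ) (he : C.EqOffNodes φ χ) : HasJump C f χ :=
  ⟨h.diff, h.bdd, fun z P N hs => by rw [← he z P N hs]; exact h.jump z P N hs⟩

end HasJump

lemma integrable_test {ψ : ℂ → ℂ} (h : HasJump C f φ) (hψ : Continuous ψ)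
    (hc : HasCompactSupport ψ) : C.CIntegrable (fun z => φ z * ψ z) := by
  obtain ⟨K, hK⟩ := h.bdd
  obtain ⟨E, hE⟩ := hψ.bounded_above_of_compact_support hc
  have hb : ∀ z P N, C.HasSides z P N → ‖φ z‖ ≤ 2 * K := fun z P N hs =>
    h.norm_jump_le (β := fun _ => K) continuous_const hK hs
  have hint : Integrable (fun l : ℝ => ψ l) := by
    have hc' : HasCompactSupport (fun l : ℝ => ψ l) :=
      hc.comp_isClosedEmbedding Complex.isometry_ofReal.isClosedEmbedding
    exact (hψ.comp Complex.continuous_ofReal).integrable_of_hasCompactSupport hc'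
  refine (h.cmeas.mul (Contour.cmeas_of_measurable hψ.measurable)).cintegrable
    (β := fun l => 2 * K * ‖ψ l‖) (D := 2 * K * E) (hint.norm.const_mul _) (fun l hl => ?_)
    (fun k s hs hn => ?_)
  · rw [norm_mul]
    exact mul_le_mul_of_nonneg_right (hb _ _ _ (.real l hl)) (norm_nonneg _)
  · rw [norm_mul]
    have h1 := hb _ _ _ (.arc k s hs hn)
    exact mul_le_mul h1 (hE _) (norm_nonneg _) ((norm_nonneg _).trans h1)

/-- The distributional identity `∂̄ f = jump of f` for test functions supported in `U`. -/
def WeakJumpOn (C : Contour) (f φ : ℂ → ℂ) (U : Set ℂ) : Prop :=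
  ∀ ψ : ℂ → ℂ, ContDiff ℝ 1 ψ → HasCompactSupport ψ → tsupport ψ ⊆ U →
    ∫ w, offContour C f w * dbar ψ w = -(I / 2) * C.cint (fun z => φ z * ψ z)

lemma weakJumpOn_compl (h : HasJump C f φ) : WeakJumpOn C f φ C.carrierᶜ := by
  intro ψ hψ hc hs
  rw [integral_mul_dbar_eq_zero C.isOpen_compl_carrier (offContour_differentiableOn h.diff) hψ hc hs]
  have h0 : ∀ z ∈ C.carrier, ψ z = 0 := fun z hz =>
    image_eq_zero_of_notMem_tsupport fun h => hs h hz
  have : C.EqOffNodes (fun z => φ z * ψ z) (fun _ => 0) := fun z P N hz => by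
    simp [h0 z hz.mem_carrier]
  rw [Contour.cint_congr this]
  simp [Contour.cint]

lemma norm_offContour_le {K : ℝ} (hK : ∀ z ∉ C.carrier, ‖f z‖ ≤ K) (w : ℂ) :
    ‖offContour C f w‖ ≤ max K 0 := by
  by_cases hw : w ∈ C.carrierᶜ
  · rw [offContour, indicator_of_mem hw]; exact (hK w hw).trans (le_max_left _ _)
  · rw [offContour, indicator_of_notMem hw]; simp

/-- Green's formula in the chart next to an inner point of an arc. -/
lemma exists_weakJumpOn_arc (h : HasJump C f φ) (k : Fin C.p) {s : ℝ} (hs : s ∈ Ioo (0 : ℝ) 1)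
    (hn : C.arc k s ∉ C.nodes) :
    ∃ U, IsOpen U ∧ C.arc k s ∈ U ∧ WeakJumpOn C f φ U := by
  obtain ⟨δ, hδ, h01, hinj, hopen, hdet, hbox⟩ := C.exists_arc_chart k hs hn
  set c := I * deriv (C.arc k) s with hc
  obtain ⟨K, hK⟩ := h.bdd
  obtain ⟨fp, fm, hp, hm, he⟩ := h.exists_boundary
  have hsub : Ioo (s - δ) (s + δ) ×ℂ Ioo (-δ) δ ⊆ Icc (s - δ) (s + δ) ×ℂ Icc (-δ) δ :=
    fun z hz => ⟨Ioo_subset_Icc_self hz.1, Ioo_subset_Icc_self hz.2⟩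
  refine ⟨_, hopen, ⟨s, ⟨by simp [hδ], by simp [hδ]⟩, by simp [chart]⟩, fun ψ hψ hcψ hsupp => ?_⟩
  have hreal : ∀ u ∈ Icc (s - δ) (s + δ), (u : ℂ) ∈ Icc (s - δ) (s + δ) ×ℂ Icc (-δ) δ :=
    fun u hu => ⟨by simpa using hu, by simpa using hδ.le⟩
  have hnode : ∀ u ∈ Icc (s - δ) (s + δ), C.arc k u ∉ C.nodes := fun u hu => by
    simpa [chart] using (hbox u (hreal u hu)).1
  have hside : ∀ u ∈ Ioo (s - δ) (s + δ), C.HasSides (C.arc k u) _ _ := fun u hu =>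
    .arc k u (h01 (Ioo_subset_Icc_self hu)) (hnode u (Ioo_subset_Icc_self hu))
  have hoff : ∀ u ∈ Icc (s - δ) (s + δ), ∀ r ∈ Icc (-δ) δ, r ≠ 0 →
      C.arc k u + (r : ℂ) * c ∈ C.carrierᶜ := by
    intro u hu r hr hr0 hmem
    obtain ⟨-, him, harc⟩ := hbox ⟨u, r⟩ ⟨hu, hr⟩
    rcases hmem with h | h
    · exact him h
    · obtain ⟨l, v, hv, h⟩ := mem_iUnion.1 h
      exact hr0 (by simpa using congrArg Complex.im (harc l v hv h).2)
  have htilt : ∀ u ∈ Ioo (s - δ) (s + δ), _ := fun u hu =>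
    tendsto_leftOf_rightOf (C.hasStrictDerivAt_arc k (h01 (Ioo_subset_Icc_self hu)))
      (hdet u (Ioo_subset_Icc_self hu))
  have hgreen := integral_mul_dbar_chart (γ := C.arc k) (γ' := deriv (C.arc k))
    (a := s - δ) (b := s + δ) (δ := δ) (c := c) (by linarith) hδ
    (fun u hu => (C.hasStrictDerivAt_arc k (h01 hu)).hasDerivAt)
    ((C.continuousOn_deriv_arc k).mono h01) hdet hinj (measurable_offContour h.diff)
    (norm_offContour_le hK) C.isOpen_compl_carrier (offContour_differentiableOn h.diff) hoff
    (jp := fun u => fp (C.arc k u)) (jm := fun u => fm (C.arc k u))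
    (fun u hu => (offContour_tendsto_left (hside u hu) (hp _ _ _ (hside u hu))).comp (htilt u hu).1)
    (fun u hu => (offContour_tendsto_right (hside u hu) (hm _ _ _ (hside u hu))).comp
      (htilt u hu).2) hψ hcψ hsupp
  rw [hgreen]
  congr 1
  -- the test function does not meet the other parts of the contour
  have hψ0 : ∀ z, (∀ ζ ∈ Ioo (s - δ) (s + δ) ×ℂ Ioo (-δ) δ, chart (C.arc k) c ζ ≠ z) → ψ z = 0 := by
    intro z hz
    refine image_eq_zero_of_notMem_tsupport fun hmem => ?_
    obtain ⟨ζ, hζ, h⟩ := hsupp hmem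
    exact hz ζ hζ h
  have hψarc : ∀ l, ∀ u ∈ Icc (0 : ℝ) 1, (l = k → u ∉ Ioo (s - δ) (s + δ)) →
      ψ (C.arc l u) = 0 := by
    intro l u hu hlu
    refine hψ0 _ fun ζ hζ heq => ?_
    obtain ⟨hl, hz⟩ := (hbox ζ (hsub hζ)).2.2 l u hu heq.symm
    refine hlu hl ?_
    have := hζ.1
    rwa [hz] at this
  have hψreal : ∀ l : ℝ, ψ l = 0 := fun l => hψ0 _ fun ζ hζ heq =>
    (hbox ζ (hsub hζ)).2.1 (by rw [heq]; simp)
  have hbnd : ∀ F : ℂ → ℂ, C.CMeas F → (∀ z P N, C.HasSides z P N → ‖F z‖ ≤ K) →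
      IntervalIntegrable (fun u => deriv (C.arc k) u * (F (C.arc k u) * ψ (C.arc k u)))
        volume 0 1 := by
    intro F hF hFK
    obtain ⟨E, hE⟩ := hψ.continuous.bounded_above_of_compact_support hcψ
    refine ((hF.mul (Contour.cmeas_of_measurable hψ.continuous.measurable)).cintegrable
      (β := fun _ => 0) (D := K * E) (integrable_zero _ _ _) (fun l hl => by simp [hψreal])
      (fun k s hs hn => ?_)).2 k
    rw [norm_mul]
    have h1 := hFK _ _ _ (.arc k s hs hn)
    exact mul_le_mul h1 (hE _) (norm_nonneg _) ((norm_nonneg _).trans h1)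
  have hpi := hbnd fp (cmeas_left h.diff hp) fun z P N hs => by
    have := hs.neBot_left
    exact le_of_tendsto (hp z P N hs).norm (hs.eventually_notMem.1.mono hK)
  have hmi := hbnd fm (cmeas_right h.diff hm) fun z P N hs => by
    have := hs.neBot_right
    exact le_of_tendsto (hm z P N hs).norm (hs.eventually_notMem.2.mono hK)
  have hab : uIcc (s - δ) (s + δ) ⊆ uIcc (0 : ℝ) 1 := by
    rw [uIcc_of_le (by linarith), uIcc_of_le zero_le_one]
    exact h01.trans Ioo_subset_Icc_self
  rw [← intervalIntegral.integral_sub (hpi.mono_set hab) (hmi.mono_set hab)]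
  have hφ : C.EqOffNodes (fun z => φ z * ψ z) (fun z => (fp z - fm z) * ψ z) := fun z P N hs => by
    simp only [he z P N hs]
  rw [Contour.cint_congr hφ, Contour.cint]
  simp only [hψreal, mul_zero, integral_zero, zero_add]
  rw [Finset.sum_eq_single k]
  · rw [intervalIntegral.integral_of_le zero_le_one, intervalIntegral.integral_of_le (by linarith),
      integral_Ioc_eq_integral_Ioo, integral_Ioc_eq_integral_Ioo]
    have h1 := setIntegral_eq_of_subset_of_forall_sdiff_eq_zero (μ := volume)
      (f := fun u => deriv (C.arc k) u *
        ((fp (C.arc k u) - fm (C.arc k u)) * ψ (C.arc k u))) measurableSet_Ioo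
      (fun u hu => h01 (Ioo_subset_Icc_self hu))
      fun u hu => by simp [hψarc k u (Ioo_subset_Icc_self hu.1) fun _ => hu.2]
    rw [h1]
    exact setIntegral_congr_fun measurableSet_Ioo fun u _ => by ring
  · intro l _ hl
    rw [intervalIntegral.integral_congr (g := fun _ => 0)]
    · simp
    · intro u hu
      rw [uIcc_of_le zero_le_one] at hu
      simp [hψarc l u hu fun h => (hl h).elim]
  · simp

/-- Green's formula in the chart next to a point of the real line. -/
lemma exists_weakJumpOn_real (h : HasJump C f φ) {l : ℝ} (hn : (l : ℂ) ∉ C.nodes) :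
    ∃ U, IsOpen U ∧ (l : ℂ) ∈ U ∧ WeakJumpOn C f φ U := by
  obtain ⟨δ, hδ, hbox⟩ := C.exists_real_chart hn
  obtain ⟨K, hK⟩ := h.bdd
  obtain ⟨fp, fm, hp, hm, he⟩ := h.exists_boundary
  have hsub : Ioo (l - δ) (l + δ) ×ℂ Ioo (-δ) δ ⊆ Icc (l - δ) (l + δ) ×ℂ Icc (-δ) δ :=
    fun z hz => ⟨Ioo_subset_Icc_self hz.1, Ioo_subset_Icc_self hz.2⟩
  have hchart : chart (fun u : ℝ => (u : ℂ)) I = id := by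
    ext ζ; simp [chart, Complex.re_add_im]
  refine ⟨Ioo (l - δ) (l + δ) ×ℂ Ioo (-δ) δ, isOpen_Ioo.reProdIm isOpen_Ioo,
    ⟨by simp [hδ], by simp [hδ]⟩, fun ψ hψ hcψ hsupp => ?_⟩
  have hreal : ∀ u ∈ Icc (l - δ) (l + δ), (u : ℂ) ∈ Icc (l - δ) (l + δ) ×ℂ Icc (-δ) δ :=
    fun u hu => ⟨by simpa using hu, by simpa using hδ.le⟩
  have hside : ∀ u ∈ Ioo (l - δ) (l + δ), C.HasSides (u : ℂ) (above u) (below u) := fun u hu =>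
    .real u (hbox u (hreal u (Ioo_subset_Icc_self hu))).1
  have hoff : ∀ u ∈ Icc (l - δ) (l + δ), ∀ r ∈ Icc (-δ) δ, r ≠ 0 →
      (u : ℂ) + (r : ℂ) * I ∈ C.carrierᶜ := by
    intro u hu r hr hr0 hmem
    have hin : (u : ℂ) + (r : ℂ) * I ∈ Icc (l - δ) (l + δ) ×ℂ Icc (-δ) δ := by
      constructor
      · simpa using hu
      · simpa using hr
    rcases hmem with h | h
    · exact hr0 (by simpa using h)
    · obtain ⟨k, v, hv, h⟩ := mem_iUnion.1 h
      exact (hbox _ hin).2 k v hv h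
  have hgreen := integral_mul_dbar_chart (γ := fun u : ℝ => (u : ℂ)) (γ' := fun _ => 1)
    (a := l - δ) (b := l + δ) (δ := δ) (c := I) (sub_lt_self l hδ |>.trans (lt_add_of_pos_right l hδ)) hδ
    (fun u hu => Complex.ofRealCLM.hasDerivAt) continuousOn_const (by simp)
    (by rw [hchart]; exact injOn_id _) (measurable_offContour h.diff)
    (norm_offContour_le hK) C.isOpen_compl_carrier (offContour_differentiableOn h.diff) hoff
    (jp := fun u : ℝ => fp u) (jm := fun u => fm u)
    (fun u hu => (offContour_tendsto_left (hside u hu) (hp _ _ _ (hside u hu))).comp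
      (tendsto_above_below u).1)
    (fun u hu => (offContour_tendsto_right (hside u hu) (hm _ _ _ (hside u hu))).comp
      (tendsto_above_below u).2) hψ hcψ (by rw [hchart]; simpa using hsupp)
  rw [hgreen]
  congr 1
  have hψarc : ∀ k, ∀ u ∈ Icc (0 : ℝ) 1, ψ (C.arc k u) = 0 := fun k u hu =>
    image_eq_zero_of_notMem_tsupport fun hmem => (hbox _ (hsub (hsupp hmem))).2 k u hu rfl
  have hψreal : ∀ u : ℝ, u ∉ Ioo (l - δ) (l + δ) → ψ u = 0 := fun u hu =>
    image_eq_zero_of_notMem_tsupport fun hmem => hu (by simpa using (hsupp hmem).1)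
  have hbnd : ∀ F : ℂ → ℂ, C.CMeas F → (∀ z P N, C.HasSides z P N → ‖F z‖ ≤ K) →
      Integrable (fun u : ℝ => F u * ψ u) := by
    intro F hF hFK
    have hint : Integrable (fun l : ℝ => ψ l) :=
      (hψ.continuous.comp Complex.continuous_ofReal).integrable_of_hasCompactSupport
        (hcψ.comp_isClosedEmbedding Complex.isometry_ofReal.isClosedEmbedding)
    refine hint.bdd_mul (c := K) hF.1 ?_
    filter_upwards [C.ae_real] with u hu using hFK _ _ _ (.real u hu)
  have hpi := hbnd fp (cmeas_left h.diff hp) fun z P N hs => by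
    have := hs.neBot_left
    exact le_of_tendsto (hp z P N hs).norm (hs.eventually_notMem.1.mono hK)
  have hmi := hbnd fm (cmeas_right h.diff hm) fun z P N hs => by
    have := hs.neBot_right
    exact le_of_tendsto (hm z P N hs).norm (hs.eventually_notMem.2.mono hK)
  simp only [one_mul]
  rw [← intervalIntegral.integral_sub hpi.intervalIntegrable hmi.intervalIntegrable]
  have hφ : C.EqOffNodes (fun z => φ z * ψ z) (fun z => (fp z - fm z) * ψ z) := fun z P N hs => by
    simp only [he z P N hs]
  have hle : l - δ ≤ l + δ := by linarith
  have hloc : ∫ u : ℝ, (fp u - fm u) * ψ u = ∫ u in Ioo (l - δ) (l + δ), (fp u - fm u) * ψ u :=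
    (setIntegral_eq_integral_of_forall_compl_eq_zero fun u hu => by simp [hψreal u hu]).symm
  rw [Contour.cint_congr hφ, Contour.cint, Finset.sum_eq_zero, add_zero,
    intervalIntegral.integral_of_le hle, integral_Ioc_eq_integral_Ioo, hloc]
  · exact setIntegral_congr_fun measurableSet_Ioo fun u _ => by ring
  · intro k _
    rw [intervalIntegral.integral_congr (g := fun _ => 0)]
    · simp
    · intro u hu
      rw [uIcc_of_le zero_le_one] at hu
      simp [hψarc k u hu]

/-- The distribution `∂̄ f` is the contour integral against the jump of `f`, for test functions
supported away from the nodes. -/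
theorem weakJumpOn_compl_nodes (h : HasJump C f φ) : WeakJumpOn C f φ (C.nodes : Set ℂ)ᶜ := by
  intro ψ hψ hc hs
  -- the identity is local, and a partition of unity subordinate to the charts makes it global
  have hloc : ∀ z ∈ tsupport ψ, ∃ U, IsOpen U ∧ z ∈ U ∧ WeakJumpOn C f φ U := by
    intro z hz
    by_cases hzC : z ∈ C.carrier
    · have hzn : z ∉ C.nodes := hs hz
      rcases hzC with hr | hr
      · obtain ⟨l, rfl⟩ : ∃ l : ℝ, (l : ℂ) = z := ⟨z.re, Complex.ext rfl (by simpa using hr.symm)⟩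
        exact exists_weakJumpOn_real h hzn
      · obtain ⟨k, s, hs', rfl⟩ := mem_iUnion.1 hr
        refine exists_weakJumpOn_arc h k ⟨lt_of_le_of_ne hs'.1 ?_, lt_of_le_of_ne hs'.2 ?_⟩ hzn
        · rintro rfl; exact hzn (C.arc_zero_mem k)
        · rintro rfl; exact hzn (C.arc_one_mem k)
    · exact ⟨_, C.isOpen_compl_carrier, hzC, weakJumpOn_compl h⟩
  choose! U hUo hzU hW using hloc
  obtain ⟨t, ht, hcov⟩ := hc.elim_nhds_subcover U fun z hz => (hUo z hz).mem_nhds (hzU z hz)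
  obtain ⟨ρ, hρ⟩ := SmoothPartitionOfUnity.exists_isSubordinate (modelWithCornersSelf ℝ ℂ)
    (isClosed_tsupport ψ) (fun i : t => U i) (fun i => hUo i (ht i i.2)) (by
      intro z hz
      obtain ⟨i, hi, hz⟩ := mem_iUnion₂.1 (hcov hz)
      exact mem_iUnion.2 ⟨⟨i, hi⟩, hz⟩)
  set ψi : t → ℂ → ℂ := fun i z => (ρ i z : ℂ) * ψ z with hψi
  have hcd : ∀ i, ContDiff ℝ 1 (ψi i) := fun i => by
    have h1 : ContDiff ℝ ∞ (ρ i) := (ρ i).contMDiff.contDiff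
    exact (Complex.ofRealCLM.contDiff.comp (h1.of_le (by exact_mod_cast le_top))).mul hψ
  have hts : ∀ i, tsupport (ψi i) ⊆ tsupport ψ := fun i => tsupport_mul_subset_right
  have hcs : ∀ i, HasCompactSupport (ψi i) := fun i =>
    IsCompact.of_isClosed_subset hc (isClosed_tsupport _) (hts i)
  have hsU : ∀ i : t, tsupport (ψi i) ⊆ U i := fun i => by
    refine (tsupport_mul_subset_left).trans (Subset.trans ?_ (hρ i))
    exact closure_mono fun z hz => by
      simpa using hz
  have hsum : ψ = fun z => ∑ i, ψi i z := by
    ext z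
    simp only [hψi]
    rw [← Finset.sum_mul]
    by_cases hz : z ∈ tsupport ψ
    · have h1 := ρ.sum_eq_one hz
      rw [finsum_eq_sum_of_fintype] at h1
      rw [← Complex.ofReal_sum, h1, Complex.ofReal_one, one_mul]
    · rw [image_eq_zero_of_notMem_tsupport hz, mul_zero]
  obtain ⟨K, hK⟩ := h.bdd
  have hdsum : ∀ w, dbar ψ w = ∑ i, dbar (ψi i) w := by
    intro w
    conv_lhs => rw [hsum]
    simp only [dbar]
    rw [fderiv_fun_sum fun i _ => (hcd i).differentiable (by norm_num) w]
    simp only [_root_.sum_apply, Finset.mul_sum, mul_add, Finset.sum_add_distrib]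
  simp_rw [hdsum, Finset.mul_sum]
  rw [integral_finsetSum _ fun i _ => integrable_mul_dbar (measurable_offContour h.diff)
    (norm_offContour_le hK) (hcd i) (hcs i)]
  have : (fun z => φ z * ψ z) = fun z => ∑ i, φ z * ψi i z := by
    ext z
    conv_lhs => rw [hsum]
    rw [Finset.mul_sum]
  rw [this, Contour.cint_sum _ fun i _ => integrable_test h (hcd i).continuous (hcs i),
    Finset.mul_sum]
  exact Finset.sum_congr rfl fun i _ => hW i (ht i i.2) _ (hcd i) (hcs i) (hsU i)


/-! ### A radial cutoff function -/

/-- A smooth radial cutoff function, equal to `1` on the unit disk and to `0` for `|w|² ≥ 2`. -/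
noncomputable def cutoff (w : ℂ) : ℂ := (Real.smoothTransition (2 - ‖w‖ ^ 2) : ℝ)

lemma contDiff_cutoff {n : ℕ∞} : ContDiff ℝ n cutoff :=
  Complex.ofRealCLM.contDiff.comp
    (Real.smoothTransition.contDiff.comp (contDiff_const.sub (contDiff_norm_sq ℝ)))

lemma cutoff_eq_one {w : ℂ} (hw : ‖w‖ ≤ 1) : cutoff w = 1 := by
  rw [cutoff, Real.smoothTransition.one_of_one_le, Complex.ofReal_one]
  nlinarith [norm_nonneg w]

lemma cutoff_eq_zero {w : ℂ} (hw : 2 ≤ ‖w‖) : cutoff w = 0 := by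
  rw [cutoff, Real.smoothTransition.zero_of_nonpos, Complex.ofReal_zero]
  nlinarith

lemma norm_cutoff_le (w : ℂ) : ‖cutoff w‖ ≤ 1 := by
  rw [cutoff, Complex.norm_real, Real.norm_of_nonneg (Real.smoothTransition.nonneg _)]
  exact Real.smoothTransition.le_one _

lemma hasCompactSupport_cutoff : HasCompactSupport cutoff := by
  refine HasCompactSupport.intro (isCompact_closedBall (0 : ℂ) 2) fun w hw => cutoff_eq_zero ?_
  rw [mem_closedBall_zero_iff, not_le] at hw
  exact hw.le

lemma dbar_cutoff (w : ℂ) :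
    dbar cutoff w = -((deriv Real.smoothTransition (2 - ‖w‖ ^ 2) : ℝ) : ℂ) * w := by
  have h1 : HasFDerivAt (fun w : ℂ => 2 - ‖w‖ ^ 2) (-(2 • (innerSL ℝ w))) w :=
    (hasStrictFDerivAt_norm_sq w).hasFDerivAt.const_sub 2
  have h2 : HasDerivAt Real.smoothTransition (deriv Real.smoothTransition (2 - ‖w‖ ^ 2))
      (2 - ‖w‖ ^ 2) :=
    ((Real.smoothTransition.contDiff (n := 1)).differentiable (by norm_num) _).hasDerivAt
  have h3 := (Complex.ofRealCLM.hasFDerivAt).comp w (h2.comp_hasFDerivAt w h1)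
  have h4 : HasFDerivAt cutoff _ w := h3
  simp only [dbar, h4.fderiv]
  simp only [ContinuousLinearMap.comp_apply, _root_.smul_apply, _root_.neg_apply,
    innerSL_apply_apply, Complex.inner, Complex.ofRealCLM_apply, smul_eq_mul]
  simp
  linear_combination (-((deriv Real.smoothTransition (2 - ‖w‖ ^ 2) : ℝ) : ℂ)) *
    Complex.re_add_im w

lemma dbar_cutoff_eq_zero {w : ℂ} (hw : ‖w‖ < 1) : dbar cutoff w = 0 := by
  have : cutoff =ᶠ[𝓝 w] fun _ => 1 := by
    filter_upwards [Metric.isOpen_ball.mem_nhds (mem_ball_zero_iff.2 hw)] with v hv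
    exact cutoff_eq_one (mem_ball_zero_iff.1 hv).le
  simp [dbar, this.fderiv_eq]

/-- The fundamental solution of the Cauchy-Riemann operator: `∂̄ (1/w) = π δ`. -/
lemma integral_dbar_cutoff_div : ∫ w, dbar cutoff w / w = -Real.pi := by
  set h : ℝ → ℝ := fun r => Real.smoothTransition (2 - r ^ 2) with hh
  have hd : ContDiff ℝ 1 h :=
    Real.smoothTransition.contDiff.comp (contDiff_const.sub (contDiff_id.pow 2))
  have hc : HasCompactSupport h := by
    refine HasCompactSupport.intro (isCompact_Icc (a := -2) (b := 2)) fun r hr => ?_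
    refine Real.smoothTransition.zero_of_nonpos ?_
    by_contra hcon
    push Not at hcon
    exact hr (abs_le.1 (abs_le_of_sq_le_sq (by nlinarith) (by norm_num)))
  have hder : ∀ r, deriv h r = -(2 * r * deriv Real.smoothTransition (2 - r ^ 2)) := by
    intro r
    have h1 : HasDerivAt (fun r : ℝ => 2 - r ^ 2) (-(2 * r)) r := by
      simpa using (hasDerivAt_pow 2 r).const_sub 2
    have h2 : HasDerivAt Real.smoothTransition (deriv Real.smoothTransition (2 - r ^ 2))
        (2 - r ^ 2) :=
      ((Real.smoothTransition.contDiff (n := 1)).differentiable (by norm_num) _).hasDerivAt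
    have h3 := h2.comp r h1
    have h4 : HasDerivAt h _ r := h3
    rw [h4.deriv]
    ring
  have hI := hc.integral_Ioi_deriv_eq hd 0
  have h0 : h 0 = 1 := Real.smoothTransition.one_of_one_le (by norm_num)
  rw [h0] at hI
  have key : ∫ w : ℂ, -deriv Real.smoothTransition (2 - ‖w‖ ^ 2) = -Real.pi := by
    rw [integral_fun_norm_addHaar volume (fun r => -deriv Real.smoothTransition (2 - r ^ 2))]
    have hv : volume.real (Metric.ball (0 : ℂ) 1) = Real.pi := by
      simp [Measure.real, Complex.volume_ball]
    rw [hv, Complex.finrank_real_complex]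
    have : ∫ y in Ioi (0 : ℝ), y ^ (2 - 1) • -deriv Real.smoothTransition (2 - y ^ 2) = -(1 / 2) := by
      have h2 : ∀ y : ℝ, y ^ (2 - 1) • -deriv Real.smoothTransition (2 - y ^ 2)
          = (1 / 2) * deriv h y := fun y => by
        rw [hder]; simp; ring
      simp_rw [h2]
      rw [integral_const_mul, hI]; norm_num
    rw [this]; simp; ring
  have hae : (fun w => dbar cutoff w / w) =ᵐ[volume]
      fun w => ((-deriv Real.smoothTransition (2 - ‖w‖ ^ 2) : ℝ) : ℂ) := by
    have : ∀ᵐ w : ℂ, w ≠ 0 := by simp [ae_iff]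
    filter_upwards [this] with w hw
    rw [dbar_cutoff]; push_cast; field_simp
  rw [integral_congr_ae hae, integral_complex_ofReal, key]
  push_cast; rfl

/-- The cutoff function, rescaled by `a` about the centre `ν`. -/
noncomputable def scaledCutoff (a : ℝ) (ν w : ℂ) : ℂ := cutoff (a • (w - ν))

lemma contDiff_scaledCutoff (a : ℝ) (ν : ℂ) {n : ℕ∞} : ContDiff ℝ n (scaledCutoff a ν) :=
  contDiff_cutoff.comp ((contDiff_id.sub contDiff_const).const_smul a)

lemma hasCompactSupport_scaledCutoff {a : ℝ} (ha : 0 < a) (ν : ℂ) :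
    HasCompactSupport (scaledCutoff a ν) := by
  refine HasCompactSupport.intro (isCompact_closedBall ν (2 / a)) fun w hw => cutoff_eq_zero ?_
  rw [mem_closedBall_iff_norm, not_le, div_lt_iff₀ ha] at hw
  rw [norm_smul, Real.norm_of_nonneg ha.le, mul_comm]
  exact hw.le

lemma dbar_scaledCutoff (a : ℝ) (ν w : ℂ) :
    dbar (scaledCutoff a ν) w = a * dbar cutoff (a • (w - ν)) := by
  have h1 : HasFDerivAt (fun w : ℂ => a • (w - ν)) (a • ContinuousLinearMap.id ℝ ℂ) w :=
    ((hasFDerivAt_id w).sub_const ν).const_smul a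
  have h2 : HasFDerivAt cutoff (fderiv ℝ cutoff (a • (w - ν))) (a • (w - ν)) :=
    ((contDiff_cutoff (n := 1)).differentiable (by norm_num) _).hasFDerivAt
  have h3 : HasFDerivAt (scaledCutoff a ν) _ w := h2.comp w h1
  simp only [dbar, h3.fderiv]
  simp
  ring

lemma integral_norm_dbar_scaledCutoff {a : ℝ} (ha : 0 < a) (ν : ℂ) :
    ∫ w, ‖dbar (scaledCutoff a ν) w‖ = a⁻¹ * ∫ w, ‖dbar cutoff w‖ := by
  simp_rw [dbar_scaledCutoff, norm_mul]
  rw [integral_const_mul, integral_sub_right_eq_self (fun w => ‖dbar cutoff (a • w)‖) ν,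
    Measure.integral_comp_smul volume (fun w => ‖dbar cutoff w‖) a, Complex.finrank_real_complex,
    Complex.norm_real, Real.norm_of_nonneg ha.le, abs_of_pos (by positivity), smul_eq_mul]
  field_simp

lemma ae_im_ne_zero : ∀ᵐ w : ℂ, w.im ≠ 0 := by
  have h := Measure.addHaar_submodule (volume : Measure ℂ) (LinearMap.ker Complex.imLm) (by
    intro h
    have : I ∈ LinearMap.ker Complex.imLm := h ▸ Submodule.mem_top
    simp at this)
  rw [ae_iff]
  convert h using 2
  ext w; simp

/-! ### The Cauchy integral formula for a contour -/

variable {C : Contour} {f φ : ℂ → ℂ}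

lemma one_add_norm_pos (z : ℂ) : 0 < 1 + ‖z‖ := by positivity

lemma exists_norm_inv_sub_le {z : ℂ} (hz : z.im ≠ 0) :
    ∃ K : ℝ, 0 < K ∧ ∀ l : ℝ, ‖((l : ℂ) - z)⁻¹‖ ≤ K / (1 + |l|) := by
  have hz0 : 0 < |z.im| := abs_pos.2 hz
  refine ⟨(1 + ‖z‖) / |z.im| + 1, by positivity, fun l => ?_⟩
  have h1 : |z.im| ≤ ‖(l : ℂ) - z‖ := by
    have := Complex.abs_im_le_norm ((l : ℂ) - z)
    simpa using this
  have h2 : |l| ≤ ‖(l : ℂ) - z‖ + ‖z‖ := by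
    have := norm_add_le ((l : ℂ) - z) z
    rwa [sub_add_cancel, Complex.norm_real, Real.norm_eq_abs] at this
  have hpos : 0 < ‖(l : ℂ) - z‖ := hz0.trans_le h1
  rw [norm_inv, inv_le_comm₀ hpos (by positivity), inv_div, div_le_iff₀ (by positivity)]
  have h3 : (1 + ‖z‖) ≤ ‖(l : ℂ) - z‖ * ((1 + ‖z‖) / |z.im|) := by
    rw [mul_div_assoc', le_div_iff₀ hz0, mul_comm]
    gcongr
  nlinarith

lemma exists_arc_dist {z : ℂ} (hz : z ∉ C.carrier) :
    ∃ D : ℝ, ∀ k, ∀ s ∈ Icc (0 : ℝ) 1, ‖(C.arc k s - z)⁻¹‖ ≤ D := by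
  have hcomp : IsCompact (⋃ k, C.arc k '' Icc 0 1) := isCompact_iUnion fun k => C.isCompact_arc k
  have hcont : ContinuousOn (fun w : ℂ => (w - z)⁻¹) (⋃ k, C.arc k '' Icc 0 1) := by
    refine ContinuousOn.inv₀ (by fun_prop) fun w hw => sub_ne_zero.2 ?_
    rintro rfl
    exact hz (Or.inr hw)
  obtain ⟨D, hD⟩ := hcomp.exists_bound_of_continuousOn hcont
  exact ⟨D, fun k s hs => hD _ (mem_iUnion.2 ⟨k, s, hs, rfl⟩)⟩

lemma integrable_inv_one_add_abs_sq : Integrable fun l : ℝ => ((1 + |l|) ^ 2)⁻¹ := by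
  refine integrable_inv_one_add_sq.mono' (by fun_prop) (Eventually.of_forall fun l => ?_)
  rw [Real.norm_of_nonneg (by positivity)]
  refine inv_anti₀ (by positivity) ?_
  nlinarith [abs_nonneg l, sq_abs l]

lemma Decays.mono_nonneg (h : Decays C f) :
    ∃ K : ℝ, 0 ≤ K ∧ ∀ z ∉ C.carrier, ‖f z‖ ≤ K / (1 + ‖z‖) := by
  obtain ⟨K, hK⟩ := h
  refine ⟨max K 0, le_max_right _ _, fun z hz => (hK z hz).trans ?_⟩
  gcongr
  exact le_max_left _ _

lemma Decays.jump_le (hd : Decays C f) (h : HasJump C f φ) :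
    ∃ K : ℝ, 0 ≤ K ∧ ∀ z P N, C.HasSides z P N → ‖φ z‖ ≤ K / (1 + ‖z‖) := by
  obtain ⟨K, hK0, hK⟩ := hd.mono_nonneg
  refine ⟨2 * K, by positivity, fun z P N hs => ?_⟩
  rw [mul_div_assoc]
  refine h.norm_jump_le (β := fun z => K / (1 + ‖z‖)) ?_ hK hs
  exact continuous_const.div (by fun_prop) fun z => (one_add_norm_pos z).ne'

/-- The Cauchy integral of the jump of a decaying function converges absolutely. -/
lemma cintegrable_cauchy (h : HasJump C f φ) (hd : Decays C f) {z : ℂ} (hz : z ∉ C.carrier) :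
    C.CIntegrable fun s => (s - z)⁻¹ * φ s := by
  obtain ⟨K, hK0, hK⟩ := hd.jump_le h
  obtain ⟨K', hK'0, hK'⟩ := exists_norm_inv_sub_le (C.im_ne_zero_of_notMem hz)
  obtain ⟨D, hD⟩ := exists_arc_dist hz
  refine ((Contour.cmeas_of_measurable (by fun_prop)).mul h.cmeas).cintegrable
    (β := fun l => K' * K * ((1 + |l|) ^ 2)⁻¹) (D := D * K)
    (integrable_inv_one_add_abs_sq.const_mul _) (fun l hl => ?_) fun k s hs hn => ?_
  · have h1 := hK _ _ _ (.real l hl)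
    rw [Complex.norm_real, Real.norm_eq_abs] at h1
    rw [norm_mul]
    calc _ ≤ (K' / (1 + |l|)) * (K / (1 + |l|)) := by gcongr; exact hK' l
      _ = _ := by field_simp
  · have h1 := hK _ _ _ (.arc k s hs hn)
    have h2 : ‖φ (C.arc k s)‖ ≤ K := h1.trans (div_le_self hK0 (by linarith [norm_nonneg (C.arc k s)]))
    have h3 := hD k s (Ioo_subset_Icc_self hs)
    rw [norm_mul]
    exact mul_le_mul h3 h2 (norm_nonneg _) ((norm_nonneg _).trans h3)

/-- Dominated convergence for contour integrals. -/
lemma cint_tendsto {ι : Type*} {L : Filter ι} [L.IsCountablyGenerated] {F : ι → ℂ → ℂ}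
    {G Φ : ℂ → ℂ} {E : ℝ} (hm : ∀ n, C.CMeas (F n)) (hΦ : C.CIntegrable Φ)
    (hb : ∀ᶠ n in L, ∀ z P N, C.HasSides z P N → ‖F n z‖ ≤ E * ‖Φ z‖)
    (hlim : ∀ z P N, C.HasSides z P N → Tendsto (fun n => F n z) L (𝓝 (G z))) :
    Tendsto (fun n => C.cint (F n)) L (𝓝 (C.cint G)) := by
  unfold Contour.cint
  refine Tendsto.add ?_ (tendsto_finsetSum _ fun k _ => ?_)
  · refine tendsto_integral_filter_of_dominated_convergence (fun l : ℝ => E * ‖Φ l‖)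
      (Eventually.of_forall fun n => (hm n).1) (hb.mono fun n hn => ?_) (hΦ.1.norm.const_mul E) ?_
    · filter_upwards [C.ae_real] with l hl using hn _ _ _ (.real l hl)
    · filter_upwards [C.ae_real] with l hl using hlim _ _ _ (.real l hl)
  · have hae := C.ae_arc k
    rw [ae_restrict_iff' measurableSet_Ioc] at hae
    refine intervalIntegral.tendsto_integral_filter_of_dominated_convergence
      (fun s => E * ‖deriv (C.arc k) s * Φ (C.arc k s)‖) (Eventually.of_forall fun n => ?_)
      (hb.mono fun n hn => ?_) ((hΦ.2 k).norm.const_mul E) ?_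
    · rw [uIoc_of_le zero_le_one]
      exact (measurable_deriv _).aestronglyMeasurable.mul ((hm n).2 k)
    · filter_upwards [hae] with s hs hs'
      rw [uIoc_of_le zero_le_one] at hs'
      obtain ⟨h1, h2⟩ := hs hs'
      rw [norm_mul, norm_mul, mul_left_comm]
      gcongr
      exact hn _ _ _ (.arc k s h1 h2)
    · filter_upwards [hae] with s hs hs'
      rw [uIoc_of_le zero_le_one] at hs'
      obtain ⟨h1, h2⟩ := hs hs'
      exact (hlim _ _ _ (.arc k s h1 h2)).const_mul _

/-- The difference quotient of a sectionally holomorphic function at a point `z` off the contour. -/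
lemma hasJump_dslope (h : HasJump C f φ) {z : ℂ} (hz : z ∉ C.carrier) :
    HasJump C (dslope f z) fun s => (s - z)⁻¹ * φ s := by
  have hnz : C.carrierᶜ ∈ 𝓝 z := C.isOpen_compl_carrier.mem_nhds hz
  have hd : DifferentiableOn ℂ (dslope f z) C.carrierᶜ :=
    (Complex.differentiableOn_dslope hnz).2 h.diff
  refine ⟨hd, ?_, fun s P N hs => ?_⟩
  · obtain ⟨K, hK⟩ := h.bdd
    have hcont : ContinuousAt (dslope f z) z := (hd.differentiableAt hnz).continuousAt
    obtain ⟨ε, hε, hb⟩ := Metric.continuousAt_iff.1 hcont 1 one_pos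
    refine ⟨max (‖dslope f z z‖ + 1) ((K + K) / ε), fun w hw => ?_⟩
    by_cases hwz : dist w z < ε
    · refine le_max_of_le_left ?_
      have := hb hwz
      rw [dist_eq_norm] at this
      linarith [norm_le_norm_add_norm_sub' (dslope f z w) (dslope f z z)]
    · push Not at hwz
      refine le_max_of_le_right ?_
      have hne : w ≠ z := by
        rintro rfl
        rw [dist_self] at hwz
        linarith
      rw [dist_eq_norm] at hwz
      rw [dslope_of_ne _ hne, slope_def_field, norm_div]
      have : ‖f w - f z‖ ≤ K + K := (norm_sub_le _ _).trans (add_le_add (hK w hw) (hK z hz))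
      exact div_le_div₀ ((norm_nonneg _).trans this) this hε hwz
  · obtain ⟨a, b, ha, hb, he⟩ := h.jump s P N hs
    have hsz : s ≠ z := fun h => hz (h ▸ hs.mem_carrier)
    have key : ∀ (L : Filter ℂ) (c : ℂ), L ≤ 𝓝 s → (∀ᶠ w in L, w ∉ C.carrier) →
        Tendsto f L (𝓝 c) → Tendsto (dslope f z) L (𝓝 ((c - f z) / (s - z))) := by
      intro L c hL _ hc
      have hne : ∀ᶠ w in L, w ≠ z := hL (isOpen_ne.mem_nhds hsz)
      have hid : Tendsto (fun w : ℂ => w) L (𝓝 s) := hL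
      refine ((hc.sub_const (f z)).div (hid.sub_const z) (sub_ne_zero.2 hsz)).congr' ?_
      filter_upwards [hne] with w hw
      rw [dslope_of_ne _ hw, slope_def_field]; rfl
    refine ⟨_, _, key P a hs.le_nhds_left hs.eventually_notMem.1 ha,
      key N b hs.le_nhds_right hs.eventually_notMem.2 hb, ?_⟩
    rw [he, div_sub_div_same]
    field_simp
    ring

/-- The part of the area integral near infinity: there the difference quotient is `-f(z)/w + O(1/|w|²)`,
since `f` decays, and the fundamental solution produces `π f(z)`. -/
lemma tendsto_integral_dslope (h : HasJump C f φ) (hd : Decays C f) {z : ℂ} (hz : z ∉ C.carrier) :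
    Tendsto (fun R : ℝ => ∫ w, offContour C (dslope f z) w * dbar (scaledCutoff R⁻¹ 0) w) atTop
      (𝓝 (Real.pi * f z)) := by
  set g := offContour C (dslope f z) with hg
  have hgj := hasJump_dslope h hz
  obtain ⟨K, hK0, hK⟩ := hd.mono_nonneg
  -- rescaling
  have hscale : ∀ᶠ R : ℝ in atTop, ∫ v, (R : ℂ) * g (R • v) * dbar cutoff v =
      ∫ w, g w * dbar (scaledCutoff R⁻¹ 0) w := by
    filter_upwards [eventually_gt_atTop 0] with R hR
    have h1 := Measure.integral_comp_smul volume
      (fun w => g w * dbar (scaledCutoff R⁻¹ 0) w) R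
    rw [Complex.finrank_real_complex, abs_of_pos (by positivity)] at h1
    have h2 : ∀ v : ℂ, g (R • v) * dbar (scaledCutoff R⁻¹ 0) (R • v)
        = ((R⁻¹ : ℝ) : ℂ) ^ 2 * ((R : ℂ) * g (R • v) * dbar cutoff v) := by
      intro v
      have hRC : (R : ℂ) ≠ 0 := by exact_mod_cast hR.ne'
      rw [dbar_scaledCutoff, sub_zero, smul_smul, inv_mul_cancel₀ hR.ne', one_smul]
      push_cast
      field_simp
    simp_rw [h2] at h1
    rw [integral_const_mul, Complex.real_smul] at h1
    have h3 : ((R⁻¹ : ℝ) : ℂ) ^ 2 ≠ 0 := by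
      have : (R⁻¹ : ℝ) ≠ 0 := by positivity
      exact pow_ne_zero 2 (by exact_mod_cast this)
    refine mul_left_cancel₀ h3 ?_
    rw [h1]
    push_cast
    rw [inv_pow]
  refine Tendsto.congr' hscale ?_
  obtain ⟨R₀, hR₀, harc⟩ := C.exists_arc_bound
  have hlimit : Real.pi * f z = ∫ v, -f z / v * dbar cutoff v := by
    have : ∀ v, -f z / v * dbar cutoff v = -f z * (dbar cutoff v / v) := fun v => by ring
    simp_rw [this]
    rw [integral_const_mul, integral_dbar_cutoff_div]
    ring
  rw [hlimit]
  have hdint : Integrable (dbar cutoff) :=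
    (continuous_dbar contDiff_cutoff).integrable_of_hasCompactSupport
      (hasCompactSupport_dbar hasCompactSupport_cutoff)
  refine tendsto_integral_filter_of_dominated_convergence
    (fun v => 2 * (K + K) * ‖dbar cutoff v‖) ?_ ?_ (hdint.norm.const_mul _) ?_
  · refine Eventually.of_forall fun R => ?_
    have hgm : Measurable g := measurable_offContour hgj.diff
    exact (((hgm.comp (measurable_const_smul R)).const_mul _).mul
      (continuous_dbar contDiff_cutoff).measurable).aestronglyMeasurable
  · filter_upwards [eventually_gt_atTop (2 * ‖z‖), eventually_gt_atTop 0] with R hR hR0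
    refine Eventually.of_forall fun v => ?_
    by_cases hv : ‖v‖ < 1
    · rw [dbar_cutoff_eq_zero hv]; simp
    push Not at hv
    rw [norm_mul]
    refine mul_le_mul_of_nonneg_right ?_ (norm_nonneg _)
    rw [norm_mul, Complex.norm_real, Real.norm_of_nonneg hR0.le]
    by_cases hmem : R • v ∈ C.carrierᶜ
    · have hnorm : ‖R • v‖ = R * ‖v‖ := by rw [norm_smul, Real.norm_of_nonneg hR0.le]
      have hRv : R ≤ ‖R • v‖ := by rw [hnorm]; nlinarith
      have hdist : R / 2 ≤ ‖R • v - z‖ := by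
        have := norm_sub_norm_le (R • v) z
        linarith
      have hne : R • v ≠ z := by
        intro he
        rw [he, sub_self, norm_zero] at hdist
        linarith
      rw [hg, offContour, indicator_of_mem hmem, dslope_of_ne _ hne, slope_def_field, norm_div]
      have hKb : ∀ w ∉ C.carrier, ‖f w‖ ≤ K := fun w hw =>
        (hK w hw).trans (div_le_self hK0 (by linarith [norm_nonneg w]))
      have h1 : ‖f (R • v) - f z‖ ≤ K + K :=
        (norm_sub_le _ _).trans (add_le_add (hKb _ hmem) (hKb z hz))
      calc R * (‖f (R • v) - f z‖ / ‖R • v - z‖) ≤ R * ((K + K) / (R / 2)) := by gcongr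
        _ = 2 * (K + K) := by field_simp
    · rw [hg, offContour, indicator_of_notMem hmem]
      simp only [norm_zero, mul_zero]; positivity
  · filter_upwards [ae_im_ne_zero] with v hv
    have hv0 : v ≠ 0 := by rintro rfl; simp at hv
    have hvn : 0 < ‖v‖ := norm_pos_iff.2 hv0
    have hnt : Tendsto (fun R : ℝ => R * ‖v‖) atTop atTop := tendsto_id.atTop_mul_const hvn
    have hinv : Tendsto (fun R : ℝ => (R : ℂ)⁻¹) atTop (𝓝 0) := by
      have := (Complex.continuous_ofReal.tendsto 0).comp tendsto_inv_atTop_zero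
      simpa [Function.comp_def] using this
    refine Tendsto.mul_const _ ?_
    have hoff : ∀ᶠ R : ℝ in atTop, R • v ∉ C.carrier := by
      filter_upwards [hnt.eventually_gt_atTop R₀, eventually_gt_atTop 0] with R hR hR0 hmem
      rcases hmem with h | h
      · have : R * v.im = 0 := by simpa using h
        rcases mul_eq_zero.1 this with h | h
        · exact hR0.ne' h
        · exact hv h
      · obtain ⟨k, s, hs, h⟩ := mem_iUnion.1 h
        have := harc k s hs
        rw [h, norm_smul, Real.norm_of_nonneg hR0.le] at this
        linarith
    have hf0 : Tendsto (fun R : ℝ => f (R • v)) atTop (𝓝 0) := by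
      rw [tendsto_zero_iff_norm_tendsto_zero]
      have h1 : Tendsto (fun R : ℝ => K / (1 + R * ‖v‖)) atTop (𝓝 0) :=
        tendsto_const_nhds.div_atTop (tendsto_atTop_add_const_left _ _ hnt)
      refine squeeze_zero' (Eventually.of_forall fun R => norm_nonneg _) ?_ h1
      filter_upwards [hoff, eventually_gt_atTop 0] with R hR hR0
      have := hK _ hR
      rwa [norm_smul, Real.norm_of_nonneg hR0.le] at this
    have h2 : Tendsto (fun R : ℝ => (f (R • v) - f z) / (v - (R : ℂ)⁻¹ * z)) atTop
        (𝓝 ((0 - f z) / (v - 0 * z))) :=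
      (hf0.sub_const _).div ((hinv.mul_const z).const_sub v) (by simpa using hv0)
    rw [zero_sub, zero_mul, sub_zero] at h2
    refine h2.congr' ?_
    filter_upwards [hoff, hnt.eventually_gt_atTop ‖z‖, eventually_gt_atTop 0] with R hR hRz hR0
    have hne : R • v ≠ z := by
      intro he
      rw [← he, norm_smul, Real.norm_of_nonneg hR0.le] at hRz
      exact lt_irrefl _ hRz
    have hRC : (R : ℂ) ≠ 0 := by exact_mod_cast hR0.ne'
    rw [hg, offContour, indicator_of_mem (show R • v ∈ C.carrierᶜ from hR), dslope_of_ne _ hne,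
      slope_def_field, Complex.real_smul]
    have h3 : (R : ℂ) * v - z ≠ 0 := by
      rw [← Complex.real_smul]; exact sub_ne_zero.2 hne
    have h4 : v - (R : ℂ)⁻¹ * z ≠ 0 := by
      intro h0
      apply h3
      have : (R : ℂ) * v - z = R * (v - (R : ℂ)⁻¹ * z) := by field_simp
      rw [this, h0, mul_zero]
    field_simp

/-- **Cauchy's integral formula**: a sectionally holomorphic function which decays at infinity is the
Cauchy integral of its jump. The weak identity `∂̄ g = jump` for the difference quotient
`g(s) = (f(s) - f(z))/(s - z)` is tested with functions which tend to `1`. -/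
theorem cauchy_formula (h : HasJump C f φ) (hd : Decays C f) {z : ℂ} (hz : z ∉ C.carrier) :
    f z = (2 * (Real.pi : ℂ) * I)⁻¹ * C.cint fun s => (s - z)⁻¹ * φ s := by
  have hgj := hasJump_dslope h hz
  obtain ⟨K, hK⟩ := hgj.bdd
  have hgm := measurable_offContour hgj.diff
  have hgK := norm_offContour_le hK
  set g := offContour C (dslope f z) with hg
  -- the test functions: cut off near infinity and near the nodes
  set ψ : ℝ → ℂ → ℂ := fun R w => scaledCutoff R⁻¹ 0 w - ∑ ν ∈ C.nodes, scaledCutoff R ν w with hψ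
  have hcd : ∀ R, ContDiff ℝ 1 (ψ R) := fun R =>
    (contDiff_scaledCutoff _ _).sub (ContDiff.sum fun ν _ => contDiff_scaledCutoff _ _)
  have hval : ∀ w : ℂ, w ∉ C.nodes → ∀ᶠ R : ℝ in atTop, ψ R w = 1 := by
    intro w hw
    have h1 : ∀ᶠ R : ℝ in atTop, ∀ ν ∈ C.nodes, scaledCutoff R ν w = 0 := by
      refine (Finset.eventually_all _).2 fun ν hν => ?_
      have hne : 0 < ‖w - ν‖ := norm_pos_iff.2 (sub_ne_zero.2 fun h => hw (h ▸ hν))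
      have ht : Tendsto (fun R : ℝ => R * ‖w - ν‖) atTop atTop := tendsto_id.atTop_mul_const hne
      filter_upwards [ht.eventually_ge_atTop 2, eventually_gt_atTop 0] with R hR hR0
      refine cutoff_eq_zero ?_
      rwa [norm_smul, Real.norm_of_nonneg hR0.le]
    filter_upwards [h1, eventually_ge_atTop ‖w‖, eventually_gt_atTop 0] with R hR hRw hR0
    rw [hψ]
    simp only
    rw [Finset.sum_eq_zero hR, sub_zero]
    refine cutoff_eq_one ?_
    rw [sub_zero, norm_smul, norm_inv, Real.norm_of_nonneg hR0.le]
    exact inv_mul_le_one_of_le₀ hRw hR0.le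
  have hcs : ∀ᶠ R : ℝ in atTop, HasCompactSupport (ψ R) := by
    filter_upwards [eventually_gt_atTop 0] with R hR
    have h1 := hasCompactSupport_scaledCutoff (inv_pos.2 hR) 0
    have h2 : ∀ t : Finset ℂ, HasCompactSupport fun w => ∑ ν ∈ t, scaledCutoff R ν w := by
      intro t
      induction t using Finset.induction_on with
      | empty => exact HasCompactSupport.zero
      | insert a t ha ih =>
        simp only [Finset.sum_insert ha]
        exact (hasCompactSupport_scaledCutoff hR a).add ih
    exact h1.sub (h2 _)
  have hts : ∀ᶠ R : ℝ in atTop, tsupport (ψ R) ⊆ (C.nodes : Set ℂ)ᶜ := by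
    have h1 : ∀ᶠ R : ℝ in atTop, ∀ ν ∈ C.nodes, ∀ ν' ∈ C.nodes, ν' ≠ ν → 2 < R * ‖ν - ν'‖ := by
      refine (Finset.eventually_all _).2 fun ν hν => (Finset.eventually_all _).2 fun ν' hν' => ?_
      by_cases hne : ν' = ν
      · exact Eventually.of_forall fun R h => (h hne).elim
      · have hpos : 0 < ‖ν - ν'‖ := norm_pos_iff.2 (sub_ne_zero.2 (Ne.symm hne))
        have ht : Tendsto (fun R : ℝ => R * ‖ν - ν'‖) atTop atTop := tendsto_id.atTop_mul_const hpos
        filter_upwards [ht.eventually_gt_atTop 2] with R hR _ using hR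
    have h2 : ∀ᶠ R : ℝ in atTop, ∀ ν ∈ C.nodes, ‖ν‖ < R :=
      (Finset.eventually_all _).2 fun ν _ => eventually_gt_atTop _
    filter_upwards [h1, h2, eventually_gt_atTop 0] with R hR1 hR2 hR0 w hw hwn
    have hwn' : w ∈ C.nodes := hwn
    refine notMem_tsupport_iff_eventuallyEq.2 ?_ hw
    have e1 : ∀ᶠ v in 𝓝 w, ‖v‖ < R := continuous_norm.tendsto w (Iio_mem_nhds (hR2 w hwn'))
    have e2 : ∀ᶠ v in 𝓝 w, R * ‖v - w‖ < 1 := by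
      have : Tendsto (fun v : ℂ => R * ‖v - w‖) (𝓝 w) (𝓝 (R * ‖w - w‖)) :=
        Continuous.tendsto (by fun_prop) w
      refine this (Iio_mem_nhds ?_)
      simp
    have e3 : ∀ᶠ v in 𝓝 w, ∀ ν' ∈ C.nodes, ν' ≠ w → 2 < R * ‖v - ν'‖ := by
      refine (Finset.eventually_all _).2 fun ν' hν' => ?_
      by_cases hne : ν' = w
      · exact Eventually.of_forall fun R h => (h hne).elim
      · have : Tendsto (fun v : ℂ => R * ‖v - ν'‖) (𝓝 w) (𝓝 (R * ‖w - ν'‖)) :=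
          Continuous.tendsto (by fun_prop) w
        filter_upwards [this (Ioi_mem_nhds (hR1 w hwn' ν' hν' hne))] with v hv _ using hv
    filter_upwards [e1, e2, e3] with v hv1 hv2 hv3
    rw [hψ]
    simp only [Pi.zero_apply]
    have hsingle : ∑ ν ∈ C.nodes, scaledCutoff R ν v = scaledCutoff R w v :=
      Finset.sum_eq_single_of_mem w hwn' fun ν' hν' hne => cutoff_eq_zero (by
        rw [norm_smul, Real.norm_of_nonneg hR0.le]; exact (hv3 ν' hν' hne).le)
    rw [hsingle]
    rw [scaledCutoff, scaledCutoff, cutoff_eq_one, cutoff_eq_one, sub_self]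
    · rw [norm_smul, Real.norm_of_nonneg hR0.le]; exact hv2.le
    · rw [sub_zero, norm_smul, norm_inv, Real.norm_of_nonneg hR0.le]
      exact inv_mul_le_one_of_le₀ hv1.le hR0.le
  -- the area integrals: the supports of the cutoffs at the nodes have area `O(1/R²)` while their
  -- gradients are `O(R)`, so that boundedness of `g` near the nodes suffices
  have hnodes : ∀ ν : ℂ, Tendsto (fun R : ℝ => ∫ w, g w * dbar (scaledCutoff R ν) w) atTop (𝓝 0) := by
    intro ν
    have h1 : Tendsto (fun R : ℝ => max K 0 * (R⁻¹ * ∫ w, ‖dbar cutoff w‖)) atTop (𝓝 0) := by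
      simpa using ((tendsto_inv_atTop_zero (𝕜 := ℝ)).mul_const
        (∫ w, ‖dbar cutoff w‖)).const_mul (max K 0)
    refine squeeze_zero_norm' ?_ h1
    filter_upwards [eventually_gt_atTop 0] with R hR
    rw [← integral_norm_dbar_scaledCutoff hR ν, ← integral_const_mul]
    refine norm_integral_le_of_norm_le ?_ (Eventually.of_forall fun w => ?_)
    · exact (((continuous_dbar (contDiff_scaledCutoff _ _)).integrable_of_hasCompactSupport
        (hasCompactSupport_dbar (hasCompactSupport_scaledCutoff hR ν))).norm).const_mul _
    · rw [norm_mul]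
      exact mul_le_mul_of_nonneg_right (hgK w) (norm_nonneg _)
  have harea : Tendsto (fun R : ℝ => ∫ w, g w * dbar (ψ R) w) atTop (𝓝 (Real.pi * f z)) := by
    have h1 := (tendsto_integral_dslope h hd hz).sub
      (tendsto_finsetSum C.nodes fun ν _ => hnodes ν)
    rw [Finset.sum_const_zero, sub_zero] at h1
    refine h1.congr' ?_
    filter_upwards [eventually_gt_atTop 0] with R hR
    have hi : ∀ a : ℝ, 0 < a → ∀ ν : ℂ, Integrable fun w => g w * dbar (scaledCutoff a ν) w :=
      fun a ha ν => integrable_mul_dbar hgm hgK (contDiff_scaledCutoff _ _)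
        (hasCompactSupport_scaledCutoff ha ν)
    have hdsum : ∀ w, dbar (ψ R) w =
        dbar (scaledCutoff R⁻¹ 0) w - ∑ ν ∈ C.nodes, dbar (scaledCutoff R ν) w := by
      intro w
      have hdf : ∀ a ν, DifferentiableAt ℝ (scaledCutoff a ν) w := fun a ν =>
        (contDiff_scaledCutoff a ν (n := 1)).differentiable (by norm_num) w
      simp only [dbar, hψ]
      rw [fderiv_fun_sub (hdf _ _) (DifferentiableAt.fun_sum fun ν _ => hdf _ _),
        fderiv_fun_sum fun ν _ => hdf _ _]
      simp only [_root_.sub_apply, _root_.sum_apply, Finset.mul_sum, Finset.sum_add_distrib,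
        mul_add, mul_sub]
      ring
    simp_rw [hdsum, mul_sub, Finset.mul_sum]
    rw [integral_sub (hi _ (inv_pos.2 hR) 0) (integrable_finsetSum _ fun ν _ => hi R hR ν),
      integral_finsetSum _ fun ν _ => hi R hR ν]
  -- the contour integrals
  have hbound : ∀ R w, ‖ψ R w‖ ≤ 1 + C.nodes.card := by
    intro R w
    refine (norm_sub_le _ _).trans (add_le_add (norm_cutoff_le _) ?_)
    refine (norm_sum_le _ _).trans ?_
    refine (Finset.sum_le_card_nsmul _ _ 1 fun ν _ => norm_cutoff_le _).trans ?_
    simp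
  have hline : Tendsto (fun R : ℝ => C.cint fun s => (s - z)⁻¹ * φ s * ψ R s) atTop
      (𝓝 (C.cint fun s => (s - z)⁻¹ * φ s)) := by
    refine cint_tendsto (E := 1 + C.nodes.card)
      (fun R => hgj.cmeas.mul (Contour.cmeas_of_measurable (hcd R).continuous.measurable))
      (cintegrable_cauchy h hd hz) (Eventually.of_forall fun R s P N hs => ?_) fun s P N hs => ?_
    · rw [norm_mul, mul_comm]
      exact mul_le_mul_of_nonneg_right (hbound R s) (norm_nonneg _)
    · refine tendsto_const_nhds.congr' ?_
      filter_upwards [hval s hs.notMem_nodes] with R hR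
      rw [hR, mul_one]
  have heq := tendsto_nhds_unique (harea.congr' (by
    filter_upwards [hcs, hts] with R h1 h2
    exact weakJumpOn_compl_nodes hgj (ψ R) (hcd R) h1 h2)) (hline.const_mul (-(I / 2)))
  have hpi : (Real.pi : ℂ) ≠ 0 := by exact_mod_cast Real.pi_ne_zero
  have hI : I ≠ 0 := I_ne_zero
  have h2 : (2 * (Real.pi : ℂ) * I) * f z = C.cint fun s => (s - z)⁻¹ * φ s := by
    linear_combination (2 * I) * heq - (C.cint fun s => (s - z)⁻¹ * φ s) * I_sq
  rw [← h2, inv_mul_cancel_left₀ (by simp [hpi])]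

/-- **Liouville's theorem** for a contour: a decaying function without jumps is zero. -/
theorem eq_zero_of_no_jump (h : HasJump C f 0) (hd : Decays C f) {z : ℂ} (hz : z ∉ C.carrier) :
    f z = 0 := by
  rw [cauchy_formula h hd hz]
  simp [Contour.cint]

/-- **Liouville's theorem** for a contour: a bounded function without jumps is constant. -/
theorem eq_of_no_jump (h : HasJump C f 0) {z w : ℂ} (hz : z ∉ C.carrier) (hw : w ∉ C.carrier) :
    f w = f z := by
  by_cases hne : w = z
  · rw [hne]
  have hg := hasJump_dslope h hz
  have hg' : HasJump C (dslope f z) 0 := hg.congr_jump fun s P N hs => by simp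
  obtain ⟨K, hK⟩ := h.bdd
  obtain ⟨K', hK'⟩ := hg.bdd
  -- the difference quotient has no jump either, and it decays
  have hd : Decays C (dslope f z) := by
    have hK0 : 0 ≤ K := (norm_nonneg _).trans (hK z hz)
    have hK'0 : 0 ≤ K' := (norm_nonneg _).trans (hK' z hz)
    refine ⟨K' * (1 + ‖z‖) + (K + K), fun v hv => ?_⟩
    rw [le_div_iff₀ (one_add_norm_pos v)]
    have h1 : ‖dslope f z v‖ * ‖v - z‖ ≤ K + K := by
      rw [← norm_mul, mul_comm]
      have := sub_smul_dslope f z v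
      rw [smul_eq_mul] at this
      rw [this]
      exact (norm_sub_le _ _).trans (add_le_add (hK v hv) (hK z hz))
    have h2 : ‖v‖ ≤ ‖v - z‖ + ‖z‖ := by
      have := norm_add_le (v - z) z
      rwa [sub_add_cancel] at this
    have h3 := hK' v hv
    have h4 := norm_nonneg (dslope f z v)
    calc ‖dslope f z v‖ * (1 + ‖v‖) ≤ ‖dslope f z v‖ * ((1 + ‖z‖) + ‖v - z‖) := by
          refine mul_le_mul_of_nonneg_left ?_ h4
          linarith
      _ = ‖dslope f z v‖ * (1 + ‖z‖) + ‖dslope f z v‖ * ‖v - z‖ := by ring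
      _ ≤ _ := by gcongr
  have h0 := eq_zero_of_no_jump hg' hd hw
  rw [dslope_of_ne _ hne, slope_def_field, div_eq_zero_iff] at h0
  rcases h0 with h0 | h0
  · exact sub_eq_zero.1 h0
  · exact (hne (sub_eq_zero.1 h0)).elim

/-- If the jump of a decaying function is absolutely integrable, its integral is the leading
coefficient at infinity. -/
theorem tendsto_moment (h : HasJump C f φ) (hd : Decays C f) (hφ : C.CIntegrable φ) :
    Tendsto (fun y : ℝ => (I * y) * f (I * y)) atTop
      (𝓝 (-((2 * (Real.pi : ℂ) * I)⁻¹ * C.cint φ))) := by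
  obtain ⟨R₀, hR₀, harc⟩ := C.exists_arc_bound
  have hoff : ∀ᶠ y : ℝ in atTop, I * (y : ℂ) ∉ C.carrier := by
    filter_upwards [eventually_gt_atTop R₀] with y hy hmem
    rcases hmem with h | h
    · have : y = 0 := by simpa using h
      linarith
    · obtain ⟨k, s, hs, h⟩ := mem_iUnion.1 h
      have := harc k s hs
      rw [h, norm_mul, Complex.norm_I, one_mul, Complex.norm_real, Real.norm_eq_abs] at this
      linarith [le_abs_self y]
  have hlim : Tendsto (fun y : ℝ => C.cint fun s => (I * y) * (s - I * y)⁻¹ * φ s) atTop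
      (𝓝 (C.cint fun s => -1 * φ s)) := by
    refine cint_tendsto (E := 2) (fun y => (Contour.cmeas_of_measurable (by fun_prop)).mul h.cmeas)
      hφ ?_ fun s P N hs => ?_
    · filter_upwards [eventually_gt_atTop (2 * R₀)] with y hy s P N hs
      have hy0 : 0 < y := by linarith
      rw [norm_mul]
      refine mul_le_mul_of_nonneg_right ?_ (norm_nonneg _)
      have hden : y / 2 ≤ ‖s - I * y‖ := by
        cases hs with
        | real l hl =>
          have h1 := Complex.abs_im_le_norm ((l : ℂ) - I * y)
          simp at h1
          linarith [le_abs_self y]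
        | arc k u hu hn =>
          have h1 := harc k u (Ioo_subset_Icc_self hu)
          have h2 := norm_sub_norm_le (I * (y : ℂ)) (C.arc k u)
          rw [norm_sub_rev, norm_mul, Complex.norm_I, one_mul, Complex.norm_real,
            Real.norm_of_nonneg hy0.le] at h2
          linarith
      rw [norm_mul, norm_inv, norm_mul, Complex.norm_I, one_mul, Complex.norm_real,
        Real.norm_of_nonneg hy0.le, ← div_eq_mul_inv, div_le_iff₀ (by linarith)]
      linarith
    · refine Tendsto.mul_const _ ?_
      have hinv : Tendsto (fun R : ℝ => (R : ℂ)⁻¹) atTop (𝓝 0) := by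
        have := (Complex.continuous_ofReal.tendsto 0).comp tendsto_inv_atTop_zero
        simpa [Function.comp_def] using this
      have h1 : Tendsto (fun y : ℝ => I * (s * (y : ℂ)⁻¹ - I)⁻¹) atTop (𝓝 (I * (s * 0 - I)⁻¹)) :=
        (((hinv.const_mul s).sub_const I).inv₀ (by simp)).const_mul I
      have h2 : I * (s * 0 - I)⁻¹ = -1 := by
        rw [mul_zero, zero_sub, inv_neg, mul_neg, mul_inv_cancel₀ I_ne_zero]
      rw [h2] at h1
      refine h1.congr' ?_
      filter_upwards [eventually_gt_atTop 0] with y hy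
      have hyC : (y : ℂ) ≠ 0 := by exact_mod_cast hy.ne'
      have : s * (y : ℂ)⁻¹ - I = (s - I * y) * (y : ℂ)⁻¹ := by field_simp
      rw [this, mul_inv, inv_inv]
      ring
  have h2 := hlim.const_mul (2 * (Real.pi : ℂ) * I)⁻¹
  rw [Contour.cint_const_mul] at h2
  rw [show -((2 * (Real.pi : ℂ) * I)⁻¹ * C.cint φ) = (2 * (Real.pi : ℂ) * I)⁻¹ * (-1 * C.cint φ) by
    ring]
  refine h2.congr' ?_
  filter_upwards [hoff] with y hy
  rw [cauchy_formula h hd hy]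
  simp_rw [mul_assoc (I * (y : ℂ))]
  rw [Contour.cint_const_mul]
  ring


/-! ### Boundary values of the Cauchy transform of a Schwartz function -/

/-- The Cauchy transform `∫ g(s)/(s - z) ds` of a Schwartz function `g` on the real line. -/
noncomputable def cauchyTransform (g : SchwartzMap ℝ ℝ) (z : ℂ) : ℂ := ∫ s : ℝ, (g s : ℂ) / ((s : ℂ) - z)

lemma abs_im_le_norm_sub (s : ℝ) (z : ℂ) : |z.im| ≤ ‖(s : ℂ) - z‖ := by
  have := Complex.abs_im_le_norm ((s : ℂ) - z)
  simpa using this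

lemma ofReal_sub_ne_zero {z : ℂ} (hz : z.im ≠ 0) (s : ℝ) : (s : ℂ) - z ≠ 0 := by
  intro h
  have := abs_im_le_norm_sub s z
  rw [h, norm_zero] at this
  exact hz (abs_nonpos_iff.1 this)

variable (g : SchwartzMap ℝ ℝ)

lemma integrable_ofReal_schwartz : Integrable fun s : ℝ => (g s : ℂ) := g.integrable.ofReal

lemma aestronglyMeasurable_cauchy_kernel (z : ℂ) (m : ℕ) :
    AEStronglyMeasurable (fun s : ℝ => (g s : ℂ) / ((s : ℂ) - z) ^ m) := by
  have h1 : Measurable fun s : ℝ => (g s : ℂ) :=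
    (Complex.continuous_ofReal.comp g.continuous).measurable
  have h2 : Measurable fun s : ℝ => ((s : ℂ) - z) ^ m :=
    (((Complex.continuous_ofReal).sub continuous_const).pow m).measurable
  exact (h1.div h2).aestronglyMeasurable

lemma norm_cauchy_kernel_le {z : ℂ} (hz : z.im ≠ 0) (s : ℝ) :
    ‖(g s : ℂ) / ((s : ℂ) - z)‖ ≤ ‖g s‖ / |z.im| := by
  rw [norm_div, Complex.norm_real]
  have := abs_pos.2 hz
  gcongr
  exact abs_im_le_norm_sub s z

lemma integrable_cauchy_kernel {z : ℂ} (hz : z.im ≠ 0) :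
    Integrable fun s : ℝ => (g s : ℂ) / ((s : ℂ) - z) := by
  refine (g.integrable.norm.div_const |z.im|).mono' ?_ (ae_of_all _ fun s =>
    norm_cauchy_kernel_le g hz s)
  simpa using aestronglyMeasurable_cauchy_kernel g z 1

lemma differentiableAt_cauchyTransform {z : ℂ} (hz : z.im ≠ 0) :
    DifferentiableAt ℂ (cauchyTransform g) z := by
  have hd : 0 < |z.im| / 2 := by have := abs_pos.2 hz; positivity
  have key : ∀ w ∈ Metric.ball z (|z.im| / 2), |z.im| / 2 ≤ |w.im| := by
    intro w hw
    have h1 : |w.im - z.im| ≤ ‖w - z‖ := by simpa using Complex.abs_im_le_norm (w - z)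
    have h2 : ‖w - z‖ < |z.im| / 2 := by simpa [dist_eq_norm] using hw
    have h3 := abs_sub_abs_le_abs_sub z.im w.im
    rw [abs_sub_comm] at h3
    linarith
  have hne : ∀ w ∈ Metric.ball z (|z.im| / 2), w.im ≠ 0 := fun w hw h => by
    have := key w hw
    rw [h, abs_zero] at this
    linarith
  refine (hasDerivAt_integral_of_dominated_loc_of_deriv_le (𝕜 := ℂ) (μ := volume)
    (F := fun w (s : ℝ) => (g s : ℂ) / ((s : ℂ) - w))
    (F' := fun w (s : ℝ) => (g s : ℂ) / ((s : ℂ) - w) ^ 2)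
    (bound := fun s => ‖g s‖ / (|z.im| / 2) ^ 2) (Metric.ball_mem_nhds z hd) ?_
    (integrable_cauchy_kernel g hz) (aestronglyMeasurable_cauchy_kernel g z 2) ?_ ?_ ?_).2.differentiableAt
  · exact Eventually.of_forall fun w => by simpa using aestronglyMeasurable_cauchy_kernel g w 1
  · refine ae_of_all _ fun s w hw => ?_
    rw [norm_div, Complex.norm_real, norm_pow]
    gcongr
    exact (key w hw).trans (abs_im_le_norm_sub s w)
  · exact g.integrable.norm.div_const _
  · refine ae_of_all _ fun s w hw => ?_
    have h0 := ofReal_sub_ne_zero (hne w hw) s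
    have h1 : HasDerivAt (fun w : ℂ => (s : ℂ) - w) (-1) w := by
      simpa using (hasDerivAt_id w).const_sub (s : ℂ)
    refine ((hasDerivAt_const w (g s : ℂ)).div h1 h0).congr_deriv ?_
    simp

lemma cauchyTransform_conj (z : ℂ) :
    cauchyTransform g ((starRingEnd ℂ) z) = (starRingEnd ℂ) (cauchyTransform g z) := by
  unfold cauchyTransform
  rw [← integral_conj]
  refine integral_congr_ae (ae_of_all _ fun s => ?_)
  simp

/-- The regularised kernel: the value of `g` at `Re z` is subtracted in the window of length `2`
around `Re z`. -/
noncomputable def regKernel (z : ℂ) (u : ℝ) : ℂ :=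
  ((g (z.re + u) : ℂ) - (Icc (-1 : ℝ) 1).indicator (fun _ => (g z.re : ℂ)) u) / ((u : ℂ) - z.im * I)

lemma im_sub_ne_zero {b : ℝ} (hb : b ≠ 0) (u : ℝ) : (u : ℂ) - b * I ≠ 0 := by
  have : (b * I : ℂ).im ≠ 0 := by simpa using hb
  exact ofReal_sub_ne_zero this u

lemma intervalIntegral_inv_sub {b : ℝ} (hb : b ≠ 0) :
    ∫ u in (-1 : ℝ)..1, ((u : ℂ) - b * I)⁻¹ = Complex.log (1 - b * I) - Complex.log (-1 - b * I) := by
  have hd : ∀ u : ℝ, HasDerivAt (fun u : ℝ => Complex.log ((u : ℂ) - b * I)) ((u : ℂ) - b * I)⁻¹ u := by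
    intro u
    have h1 : HasDerivAt (fun u : ℝ => (u : ℂ) - b * I) 1 u :=
      (Complex.ofRealCLM.hasDerivAt (x := u)).sub_const _
    have h2 : (u : ℂ) - b * I ∈ Complex.slitPlane := by
      right
      simpa using hb
    simpa using h1.clog_real h2
  rw [intervalIntegral.integral_eq_sub_of_hasDerivAt (fun u _ => hd u)]
  · norm_num
  · apply Continuous.intervalIntegrable
    exact (Complex.continuous_ofReal.sub continuous_const).inv₀ (im_sub_ne_zero hb)

lemma norm_intervalIntegral_inv_sub_le {b : ℝ} (hb : b ≠ 0) :
    ‖∫ u in (-1 : ℝ)..1, ((u : ℂ) - b * I)⁻¹‖ ≤ 2 * Real.pi := by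
  rw [intervalIntegral_inv_sub hb]
  have hn : ‖(1 - b * I : ℂ)‖ = ‖(-1 - b * I : ℂ)‖ := by
    rw [← Complex.norm_conj (-1 - b * I), ← norm_neg ((starRingEnd ℂ) _)]
    simp [sub_eq_add_neg, add_comm]
  rw [Complex.log, Complex.log, hn]
  have : (Real.log ‖(-1 - b * I : ℂ)‖ : ℂ) + (Complex.arg (1 - b * I) : ℂ) * I -
      ((Real.log ‖(-1 - b * I : ℂ)‖ : ℂ) + (Complex.arg (-1 - b * I) : ℂ) * I) =
      ((Complex.arg (1 - b * I) - Complex.arg (-1 - b * I) : ℝ) : ℂ) * I := by push_cast; ring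
  rw [this, norm_mul, Complex.norm_I, mul_one, Complex.norm_real, Real.norm_eq_abs]
  have h1 := Complex.abs_arg_le_pi (1 - b * I)
  have h2 := Complex.abs_arg_le_pi (-1 - b * I)
  have h3 := abs_sub (Complex.arg (1 - b * I)) (Complex.arg (-1 - b * I))
  linarith

lemma tendsto_intervalIntegral_inv_sub :
    ∃ a : ℂ, Tendsto (fun b : ℝ => ∫ u in (-1 : ℝ)..1, ((u : ℂ) - b * I)⁻¹) (𝓝[>] 0) (𝓝 a) := by
  have hb : Tendsto (fun b : ℝ => (-1 - b * I : ℂ)) (𝓝[>] 0) (𝓝[{z : ℂ | z.im < 0}] (-1)) := by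
    rw [tendsto_nhdsWithin_iff]
    constructor
    · have : Continuous fun b : ℝ => (-1 - b * I : ℂ) := by fun_prop
      simpa using (this.tendsto 0).mono_left (nhdsWithin_le_nhds (s := Ioi 0))
    · filter_upwards [self_mem_nhdsWithin] with b (hb : 0 < b)
      simpa using hb
  have h2 := (Complex.tendsto_log_nhdsWithin_im_neg_of_re_neg_of_im_zero (z := -1) (by simp) (by simp)).comp hb
  have h1 : Tendsto (fun b : ℝ => Complex.log (1 - b * I)) (𝓝[>] 0) (𝓝 (Complex.log (1 - (0 : ℝ) * I))) := by
    refine Tendsto.mono_left ?_ nhdsWithin_le_nhds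
    have hc : ContinuousAt (fun b : ℝ => (1 - b * I : ℂ)) 0 := by fun_prop
    exact (hc.clog (by simp)).tendsto
  refine ⟨_, (h1.sub h2).congr' ?_⟩
  filter_upwards [self_mem_nhdsWithin] with b (hb : 0 < b)
  exact (intervalIntegral_inv_sub hb.ne').symm

lemma re_add_sub (z : ℂ) (u : ℝ) : ((z.re + u : ℝ) : ℂ) - z = (u : ℂ) - z.im * I := by
  apply Complex.ext <;> simp

lemma integrable_shifted_kernel {z : ℂ} (hz : z.im ≠ 0) :
    Integrable fun u : ℝ => (g (z.re + u) : ℂ) / ((u : ℂ) - z.im * I) := by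
  have := (integrable_cauchy_kernel g hz).comp_add_left z.re
  refine this.congr (ae_of_all _ fun u => ?_)
  have : ((z.re + u : ℝ) : ℂ) - z = (u : ℂ) - z.im * I := re_add_sub z u
  simp only [this]

lemma integrable_window {z : ℂ} (hz : z.im ≠ 0) :
    Integrable fun u : ℝ => (Icc (-1 : ℝ) 1).indicator (fun _ => (g z.re : ℂ)) u / ((u : ℂ) - z.im * I) := by
  have hc : Continuous fun u : ℝ => (g z.re : ℂ) / ((u : ℂ) - z.im * I) :=
    continuous_const.div (Complex.continuous_ofReal.sub continuous_const) (im_sub_ne_zero hz)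
  have := (hc.continuousOn.integrableOn_compact (isCompact_Icc (a := (-1 : ℝ)) (b := 1))
    (μ := volume)).integrable_indicator measurableSet_Icc
  refine this.congr (ae_of_all _ fun u => ?_)
  by_cases hu : u ∈ Icc (-1 : ℝ) 1 <;> simp [indicator, hu]

lemma integrable_regKernel {z : ℂ} (hz : z.im ≠ 0) : Integrable (regKernel g z) := by
  refine ((integrable_shifted_kernel g hz).sub (integrable_window g hz)).congr (ae_of_all _ fun u => ?_)
  simp [regKernel, sub_div]

/-- Near the singularity `g` is replaced by `g - g(Re z)`, and the part with the constant `g(Re z)` is an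
explicit integral, a difference of two logarithms. -/
lemma cauchyTransform_eq {z : ℂ} (hz : z.im ≠ 0) :
    cauchyTransform g z = (∫ u, regKernel g z u) +
      g z.re * ∫ u in (-1 : ℝ)..1, ((u : ℂ) - z.im * I)⁻¹ := by
  have h1 : cauchyTransform g z = ∫ u : ℝ, (g (z.re + u) : ℂ) / ((u : ℂ) - z.im * I) := by
    rw [cauchyTransform, ← integral_add_left_eq_self _ z.re]
    refine integral_congr_ae (ae_of_all _ fun u => ?_)
    have : ((z.re + u : ℝ) : ℂ) - z = (u : ℂ) - z.im * I := re_add_sub z u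
    simp only [this]
  have h2 : ∫ u, regKernel g z u = (∫ u : ℝ, (g (z.re + u) : ℂ) / ((u : ℂ) - z.im * I)) -
      ∫ u : ℝ, (Icc (-1 : ℝ) 1).indicator (fun _ => (g z.re : ℂ)) u / ((u : ℂ) - z.im * I) := by
    rw [← integral_sub (integrable_shifted_kernel g hz) (integrable_window g hz)]
    refine integral_congr_ae (ae_of_all _ fun u => ?_)
    simp [regKernel, sub_div]
  have h3 : ∫ u : ℝ, (Icc (-1 : ℝ) 1).indicator (fun _ => (g z.re : ℂ)) u / ((u : ℂ) - z.im * I) =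
      g z.re * ∫ u in (-1 : ℝ)..1, ((u : ℂ) - z.im * I)⁻¹ := by
    rw [intervalIntegral.integral_of_le (by norm_num), ← integral_Icc_eq_integral_Ioc,
      ← integral_const_mul, ← integral_indicator measurableSet_Icc]
    refine integral_congr_ae (ae_of_all _ fun u => ?_)
    by_cases hu : u ∈ Icc (-1 : ℝ) 1 <;> simp [indicator, hu, div_eq_mul_inv]
  rw [h1, h2, h3]
  ring

lemma exists_lipschitz : ∃ L > 0, ∀ a b : ℝ, ‖g a - g b‖ ≤ L * ‖a - b‖ := by
  obtain ⟨L, hL⟩ := g.decay 0 1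
  refine ⟨L, hL.1, fun a b => ?_⟩
  refine Convex.norm_image_sub_le_of_norm_deriv_le (s := univ) (fun x _ => g.differentiableAt)
    (fun x _ => ?_) convex_univ (mem_univ b) (mem_univ a)
  have := hL.2 x
  rw [norm_iteratedFDeriv_eq_norm_iteratedDeriv, iteratedDeriv_one] at this
  simpa using this

lemma exists_schwartz_decay : ∃ K > 0, ∀ a : ℝ, ‖g a‖ ≤ K * (1 + a ^ 2)⁻¹ := by
  obtain ⟨K, hK⟩ := g.decay 0 0
  obtain ⟨L, hL⟩ := g.decay 2 0
  refine ⟨K + L, add_pos hK.1 hL.1, fun a => ?_⟩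
  have h1 := hK.2 a
  have h2 := hL.2 a
  simp only [norm_iteratedFDeriv_zero, pow_zero, one_mul, Real.norm_eq_abs, sq_abs] at h1 h2
  rw [← div_eq_mul_inv, le_div_iff₀ (by positivity), Real.norm_eq_abs]
  nlinarith

lemma norm_regKernel_le {L : ℝ} (hL : ∀ a b : ℝ, ‖g a - g b‖ ≤ L * ‖a - b‖) (hL0 : 0 < L) (z : ℂ) (u : ℝ) :
    ‖regKernel g z u‖ ≤ (Icc (-1 : ℝ) 1).indicator (fun _ => L) u + ‖g (z.re + u)‖ := by
  rw [regKernel, norm_div]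
  have h1 : |u| ≤ ‖(u : ℂ) - z.im * I‖ := by
    simpa using Complex.abs_re_le_norm ((u : ℂ) - z.im * I)
  by_cases hu : u ∈ Icc (-1 : ℝ) 1
  · simp only [indicator, hu, if_true]
    have h2 : ‖(g (z.re + u) : ℂ) - (g z.re : ℂ)‖ ≤ L * |u| := by
      rw [← Complex.ofReal_sub, Complex.norm_real]
      simpa using hL (z.re + u) z.re
    refine le_add_of_le_of_nonneg (div_le_of_le_mul₀ (norm_nonneg _) hL0.le (h2.trans ?_))
      (norm_nonneg _)
    gcongr
  · simp only [indicator, hu, if_false, sub_zero, zero_add, Complex.norm_real]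
    refine div_le_self (norm_nonneg _) (le_trans ?_ h1)
    by_contra hcon
    push Not at hcon
    exact hu ⟨(abs_lt.1 hcon).1.le, (abs_lt.1 hcon).2.le⟩

lemma integrable_window_const (L : ℝ) : Integrable ((Icc (-1 : ℝ) 1).indicator fun _ => L) :=
  (integrable_indicator_iff measurableSet_Icc).2 (integrableOn_const (by simp))

/-- The bound is uniform up to the real line: `|g(u) - g(Re z)| ≤ L |u - Re z|` cancels the
singularity, and the real parts of the two logarithms cancel. -/
lemma exists_norm_cauchyTransform_le : ∃ K : ℝ, ∀ z : ℂ, z.im ≠ 0 → ‖cauchyTransform g z‖ ≤ K := by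
  obtain ⟨L, hL0, hL⟩ := exists_lipschitz g
  obtain ⟨D, hD0, hD⟩ := exists_schwartz_decay g
  refine ⟨(∫ u, (Icc (-1 : ℝ) 1).indicator (fun _ => L) u) + (∫ u, ‖g u‖) + D * (2 * Real.pi),
    fun z hz => ?_⟩
  rw [cauchyTransform_eq g hz]
  refine (norm_add_le _ _).trans (add_le_add ?_ ?_)
  · have hi : Integrable fun u => ‖g (z.re + u)‖ := g.integrable.norm.comp_add_left z.re
    calc ‖∫ u, regKernel g z u‖ ≤ ∫ u, ((Icc (-1 : ℝ) 1).indicator (fun _ => L) u + ‖g (z.re + u)‖) :=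
          norm_integral_le_of_norm_le ((integrable_window_const L).add hi)
            (ae_of_all _ (norm_regKernel_le g hL hL0 z))
      _ = _ := by
          rw [integral_add (integrable_window_const L) hi, integral_add_left_eq_self (fun u => ‖g u‖) z.re]
  · rw [norm_mul, Complex.norm_real]
    gcongr
    · refine (hD z.re).trans (mul_le_of_le_one_right hD0.le (inv_le_one_of_one_le₀ ?_))
      nlinarith [sq_nonneg z.re]
    · exact norm_intervalIntegral_inv_sub_le hz

lemma tendsto_regKernel (l : ℝ) {u : ℝ} (hu : u ≠ 0) :
    Tendsto (fun z => regKernel g z u) (𝓝 (l : ℂ)) (𝓝 (regKernel g l u)) := by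
  have hre : Tendsto (fun z : ℂ => (g z.re : ℂ)) (𝓝 (l : ℂ)) (𝓝 (g (l : ℂ).re)) :=
    (Complex.continuous_ofReal.comp (g.continuous.comp Complex.continuous_re)).tendsto _
  have hre' : Tendsto (fun z : ℂ => (g (z.re + u) : ℂ)) (𝓝 (l : ℂ)) (𝓝 (g ((l : ℂ).re + u))) :=
    (Complex.continuous_ofReal.comp (g.continuous.comp (Complex.continuous_re.add continuous_const))).tendsto _
  have hden : Tendsto (fun z : ℂ => (u : ℂ) - z.im * I) (𝓝 (l : ℂ)) (𝓝 ((u : ℂ) - (l : ℂ).im * I)) :=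
    (continuous_const.sub ((Complex.continuous_ofReal.comp Complex.continuous_im).mul
      continuous_const)).tendsto _
  unfold regKernel
  refine Tendsto.div (hre'.sub ?_) hden (by simpa using hu)
  by_cases h : u ∈ Icc (-1 : ℝ) 1
  · simpa [indicator, h] using hre
  · simp [indicator, h]

/-- The Cauchy transform of a Schwartz function has boundary values on the real line: the regularised
kernel is dominated uniformly in `z`, and the logarithms converge. -/
lemma tendsto_cauchyTransform_above (l : ℝ) :
    ∃ a, Tendsto (cauchyTransform g) (above l) (𝓝 a) := by
  obtain ⟨L, hL0, hL⟩ := exists_lipschitz g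
  obtain ⟨D, hD0, hD⟩ := exists_schwartz_decay g
  obtain ⟨w, hw⟩ := tendsto_intervalIntegral_inv_sub
  have : (above l).IsCountablyGenerated := inferInstanceAs (𝓝[_] _).IsCountablyGenerated
  have him : ∀ᶠ z in above l, 0 < z.im := self_mem_nhdsWithin
  have hnear : ∀ᶠ z in above l, |z.re - l| ≤ 1 := by
    have : Metric.ball (l : ℂ) 1 ∈ above l := nhdsWithin_le_nhds (Metric.ball_mem_nhds _ one_pos)
    filter_upwards [this] with z hz
    have h1 := Complex.abs_re_le_norm (z - l)
    rw [Metric.mem_ball, dist_eq_norm] at hz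
    simp only [sub_re, ofReal_re] at h1
    linarith
  have hint : Tendsto (fun z => ∫ u, regKernel g z u) (above l) (𝓝 (∫ u, regKernel g l u)) := by
    refine tendsto_integral_filter_of_dominated_convergence
      (fun u => (Icc (-1 : ℝ) 1).indicator (fun _ => L) u + 3 * D * (1 + (l + u) ^ 2)⁻¹) ?_ ?_ ?_ ?_
    · filter_upwards [him] with z hz
      exact (integrable_regKernel g hz.ne').aestronglyMeasurable
    · filter_upwards [hnear] with z hz
      refine ae_of_all _ fun u => (norm_regKernel_le g hL hL0 z u).trans (add_le_add le_rfl ?_)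
      refine (hD _).trans ?_
      rw [mul_comm 3 D, mul_assoc]
      refine mul_le_mul_of_nonneg_left ?_ hD0.le
      rw [← div_eq_mul_inv, inv_eq_one_div, div_le_div_iff₀ (by positivity) (by positivity)]
      have h2 : (z.re - l) ^ 2 ≤ 1 := by rw [← sq_abs]; nlinarith [abs_nonneg (z.re - l)]
      nlinarith [sq_nonneg ((l + u) + 2 * (z.re - l)), sq_nonneg (z.re + u)]
    · exact (integrable_window_const L).add ((integrable_inv_one_add_sq.comp_add_left l).const_mul (3 * D))
    · have h0 : ∀ᵐ u : ℝ, u ≠ 0 := by simp [ae_iff]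
      filter_upwards [h0] with u hu
      exact (tendsto_regKernel g l hu).mono_left nhdsWithin_le_nhds
  have hW : Tendsto (fun z : ℂ => ∫ u in (-1 : ℝ)..1, ((u : ℂ) - z.im * I)⁻¹) (above l) (𝓝 w) := by
    have : Tendsto Complex.im (above l) (𝓝[>] 0) := by
      rw [tendsto_nhdsWithin_iff]
      refine ⟨?_, him⟩
      have h0 : Tendsto Complex.im (above l) (𝓝 (l : ℂ).im) :=
        Complex.continuous_im.continuousAt.mono_left nhdsWithin_le_nhds
      simpa using h0
    exact hw.comp this
  have hg : Tendsto (fun z : ℂ => (g z.re : ℂ)) (above l) (𝓝 (g (l : ℂ).re)) :=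
    ((Complex.continuous_ofReal.comp (g.continuous.comp Complex.continuous_re)).tendsto _).mono_left
      nhdsWithin_le_nhds
  refine ⟨_, (hint.add (hg.mul hW)).congr' ?_⟩
  filter_upwards [him] with z hz
  exact (cauchyTransform_eq g hz.ne').symm

/-- The product `s ↦ s g(s)` as a Schwartz function. -/
noncomputable def idMul : SchwartzMap ℝ ℝ := SchwartzMap.smulLeftCLM ℝ (id : ℝ → ℝ) g

lemma idMul_apply (s : ℝ) : idMul g s = s * g s := by
  rw [idMul, SchwartzMap.smulLeftCLM_apply_apply (by fun_prop)]
  rfl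

/-- Decay at infinity, from `z ∫ g(s)/(s - z) ds = ∫ s g(s)/(s - z) ds - ∫ g`. -/
lemma cauchyTransform_decay :
    ∃ K : ℝ, ∀ z : ℂ, z.im ≠ 0 → ‖cauchyTransform g z‖ ≤ K / (1 + ‖z‖) := by
  obtain ⟨K, hK⟩ := exists_norm_cauchyTransform_le g
  obtain ⟨K', hK'⟩ := exists_norm_cauchyTransform_le (idMul g)
  refine ⟨K + (K' + ‖∫ s : ℝ, (g s : ℂ)‖), fun z hz => ?_⟩
  have h : z * cauchyTransform g z = cauchyTransform (idMul g) z - ∫ s : ℝ, (g s : ℂ) := by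
    rw [cauchyTransform, cauchyTransform, ← integral_const_mul,
      ← integral_sub (integrable_cauchy_kernel _ hz) (integrable_ofReal_schwartz g)]
    refine integral_congr_ae (ae_of_all _ fun s => ?_)
    have := ofReal_sub_ne_zero hz s
    simp only [idMul_apply, ofReal_mul]
    field_simp
    ring
  rw [le_div_iff₀ (one_add_norm_pos z), mul_add, mul_one, mul_comm _ ‖z‖, ← norm_mul, h]
  exact add_le_add (hK z hz) ((norm_sub_le _ _).trans (add_le_add (hK' z hz) le_rfl))

/-! ### The function `η` -/

variable (n : SchwartzMap ℝ ℝ)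

lemma eta_eq (z : ℂ) : eta n z = z - (1 / 4) * cauchyTransform n z := rfl

lemma differentiableAt_eta {z : ℂ} (hz : z.im ≠ 0) : DifferentiableAt ℂ (eta n) z :=
  differentiableAt_id.sub ((differentiableAt_cauchyTransform n hz).const_mul _)

lemma eta_conj (z : ℂ) : eta n ((starRingEnd ℂ) z) = (starRingEnd ℂ) (eta n z) := by
  rw [eta_eq, eta_eq, cauchyTransform_conj, map_sub, map_mul]
  simp only [map_div₀, map_one, map_ofNat]

lemma eta_sub_decay : ∃ K : ℝ, ∀ z : ℂ, z.im ≠ 0 → ‖eta n z - z‖ ≤ K / (1 + ‖z‖) := by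
  obtain ⟨K, hK⟩ := cauchyTransform_decay n
  refine ⟨K, fun z hz => le_trans ?_ (hK z hz)⟩
  rw [eta_eq, sub_sub_cancel_left, norm_neg, norm_mul]
  have : ‖(1 / 4 : ℂ)‖ ≤ 1 := by norm_num
  exact mul_le_of_le_one_left (norm_nonneg _) this

lemma tendsto_eta_above (l : ℝ) : Tendsto (eta n) (above l) (𝓝 (etaPlus n l)) := by
  obtain ⟨a, ha⟩ := tendsto_cauchyTransform_above n l
  have h : Tendsto (eta n) (above l) (𝓝 ((l : ℂ) - (1 / 4) * a)) :=
    (tendsto_id.mono_left nhdsWithin_le_nhds).sub (ha.const_mul _)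
  rwa [etaPlus, h.limUnder_eq]

lemma tendsto_conj_below (l : ℝ) : Tendsto (starRingEnd ℂ) (below l) (above l) := by
  rw [above, tendsto_nhdsWithin_iff]
  constructor
  · have h : Tendsto (starRingEnd ℂ) (below l) (𝓝 ((starRingEnd ℂ) (l : ℂ))) :=
      Complex.continuous_conj.continuousAt.mono_left nhdsWithin_le_nhds
    rwa [Complex.conj_ofReal] at h
  · have : ∀ᶠ z in below l, z.im < 0 := self_mem_nhdsWithin
    filter_upwards [this] with z hz
    simpa using hz

lemma tendsto_conj_above (l : ℝ) : Tendsto (starRingEnd ℂ) (above l) (below l) := by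
  rw [below, tendsto_nhdsWithin_iff]
  constructor
  · have h : Tendsto (starRingEnd ℂ) (above l) (𝓝 ((starRingEnd ℂ) (l : ℂ))) :=
      Complex.continuous_conj.continuousAt.mono_left nhdsWithin_le_nhds
    rwa [Complex.conj_ofReal] at h
  · have : ∀ᶠ z in above l, 0 < z.im := self_mem_nhdsWithin
    filter_upwards [this] with z hz
    simpa using hz

lemma tendsto_eta_below_conj (l : ℝ) :
    Tendsto (eta n) (below l) (𝓝 ((starRingEnd ℂ) (etaPlus n l))) := by
  have h := (Complex.continuous_conj.tendsto _).comp ((tendsto_eta_above n l).comp (tendsto_conj_below l))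
  refine h.congr fun z => ?_
  simp [eta_conj]

lemma etaMinus_eq (l : ℝ) : etaMinus n l = (starRingEnd ℂ) (etaPlus n l) := by
  rw [etaMinus, (tendsto_eta_below_conj n l).limUnder_eq]

lemma tendsto_eta_below (l : ℝ) : Tendsto (eta n) (below l) (𝓝 (etaMinus n l)) := by
  rw [etaMinus_eq]
  exact tendsto_eta_below_conj n l


/-! ### Matrix calculus -/

lemma expSigma3_add (a b : ℂ) : expSigma3 (a + b) = expSigma3 a * expSigma3 b := by
  ext i j
  fin_cases i <;> fin_cases j <;>
    simp [expSigma3, Matrix.mul_apply, Fin.sum_univ_two, Complex.exp_add, mul_comm]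

lemma expSigma3_zero : expSigma3 0 = 1 := by
  ext i j
  fin_cases i <;> fin_cases j <;> simp [expSigma3]

lemma expSigma3_mul_neg (a : ℂ) : expSigma3 a * expSigma3 (-a) = 1 := by
  rw [← expSigma3_add, add_neg_cancel, expSigma3_zero]

lemma expSigma3_neg_mul (a : ℂ) : expSigma3 (-a) * expSigma3 a = 1 := by
  rw [← expSigma3_add, neg_add_cancel, expSigma3_zero]

lemma det_expSigma3 (a : ℂ) : (expSigma3 a).det = 1 := by
  simp [expSigma3, Matrix.det_fin_two, ← Complex.exp_add]

lemma conjTranspose_expSigma3 (a : ℂ) : (expSigma3 a)ᴴ = expSigma3 ((starRingEnd ℂ) a) := by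
  ext i j
  fin_cases i <;> fin_cases j <;>
    simp [expSigma3, Matrix.conjTranspose_apply, ← Complex.exp_conj]

lemma continuous_expSigma3 : Continuous expSigma3 := by
  refine continuous_matrix fun i j => ?_
  fin_cases i <;> fin_cases j <;> simp [expSigma3] <;> fun_prop

lemma tendsto_mat_iff {α : Type*} {f : α → Mat2} {P : Filter α} {A : Mat2} :
    Tendsto f P (𝓝 A) ↔ ∀ i j, Tendsto (fun z => f z i j) P (𝓝 (A i j)) := by
  constructor
  · intro h i j
    exact ((continuous_id.matrix_elem i j).tendsto A).comp h
  · intro h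
    exact tendsto_pi_nhds.2 fun i => tendsto_pi_nhds.2 fun j => h i j

lemma tendsto_adjugate {α : Type*} {f : α → Mat2} {P : Filter α} {A : Mat2}
    (h : Tendsto f P (𝓝 A)) : Tendsto (fun z => (f z).adjugate) P (𝓝 A.adjugate) :=
  ((Continuous.matrix_adjugate continuous_id).tendsto A).comp h

lemma tendsto_det {α : Type*} {f : α → Mat2} {P : Filter α} {A : Mat2}
    (h : Tendsto f P (𝓝 A)) : Tendsto (fun z => (f z).det) P (𝓝 A.det) :=
  ((Continuous.matrix_det continuous_id).tendsto A).comp h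

lemma mul_adjugate_of_det {A : Mat2} (h : A.det = 1) : A * A.adjugate = 1 := by
  rw [Matrix.mul_adjugate, h, one_smul]

lemma adjugate_mul_of_det {A : Mat2} (h : A.det = 1) : A.adjugate * A = 1 := by
  rw [Matrix.adjugate_mul, h, one_smul]

namespace HasMatDerivAt

variable {f g : ℝ → Mat2} {f' g' : Mat2} {t : ℝ}

lemma mul (hf : HasMatDerivAt f f' t) (hg : HasMatDerivAt g g' t) :
    HasMatDerivAt (fun τ => f τ * g τ) (f' * g t + f t * g') t := by
  intro i j
  have h := ((hf i 0).mul (hg 0 j)).add ((hf i 1).mul (hg 1 j))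
  refine (h.congr_deriv ?_).congr_of_eventuallyEq (Eventually.of_forall fun τ => ?_)
  · simp [Matrix.mul_apply, Fin.sum_univ_two]
    ring
  · simp [Matrix.mul_apply, Fin.sum_univ_two]

lemma mul_const (hf : HasMatDerivAt f f' t) (A : Mat2) : HasMatDerivAt (fun τ => f τ * A) (f' * A) t := by
  intro i j
  have h := ((hf i 0).mul_const (A 0 j)).add ((hf i 1).mul_const (A 1 j))
  refine (h.congr_deriv ?_).congr_of_eventuallyEq (Eventually.of_forall fun τ => ?_)
  · simp [Matrix.mul_apply, Fin.sum_univ_two]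
  · simp [Matrix.mul_apply, Fin.sum_univ_two]

lemma add (hf : HasMatDerivAt f f' t) (hg : HasMatDerivAt g g' t) :
    HasMatDerivAt (fun τ => f τ + g τ) (f' + g') t := fun i j => (hf i j).add (hg i j)

lemma sub (hf : HasMatDerivAt f f' t) (hg : HasMatDerivAt g g' t) :
    HasMatDerivAt (fun τ => f τ - g τ) (f' - g') t := fun i j => (hf i j).sub (hg i j)

lemma neg (hf : HasMatDerivAt f f' t) : HasMatDerivAt (fun τ => -f τ) (-f') t :=
  fun i j => (hf i j).neg

lemma const_smul (c : ℂ) (hf : HasMatDerivAt f f' t) : HasMatDerivAt (fun τ => c • f τ) (c • f') t :=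
  fun i j => (hf i j).const_mul c

lemma congr (hf : HasMatDerivAt f f' t) (h : g =ᶠ[𝓝 t] f) : HasMatDerivAt g f' t :=
  fun i j => (hf i j).congr_of_eventuallyEq (h.mono fun τ hτ => by simp only [hτ])

lemma unique (hf : HasMatDerivAt f f' t) (hf' : HasMatDerivAt f g' t) : f' = g' := by
  ext i j
  exact (hf i j).unique (hf' i j)

lemma matDeriv_eq (hf : HasMatDerivAt f f' t) : matDeriv f t = f' := by
  ext i j
  exact (hf i j).deriv

end HasMatDerivAt

lemma hasMatDerivAt_const (A : Mat2) (t : ℝ) : HasMatDerivAt (fun _ => A) 0 t :=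
  fun i j => hasDerivAt_const t (A i j)

lemma hasMatDerivAt_expSigma3 {f : ℝ → ℂ} {f' : ℂ} {t : ℝ} (hf : HasDerivAt f f' t) :
    HasMatDerivAt (fun τ => expSigma3 (f τ)) (f' • (sigma3 * expSigma3 (f t))) t := by
  intro i j
  fin_cases i <;> fin_cases j
  · simpa [expSigma3, sigma3, mul_comm] using hf.cexp
  · simpa [expSigma3, sigma3] using hasDerivAt_const t (0 : ℂ)
  · simpa [expSigma3, sigma3] using hasDerivAt_const t (0 : ℂ)
  · simpa [expSigma3, sigma3, mul_comm] using hf.neg.cexp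

/-! ### Boundary limits of bounded continuous functions off the contour -/

variable (C : Contour)

/-- The points off the contour. -/
abbrev OffPt (C : Contour) : Type := {z : ℂ // z ∉ C.carrier}

open Classical in
/-- The function `φ(w)/(1 + |w|)` off the contour, extended by `0`. -/
noncomputable def unweight (φ : OffPt C →ᵇ ℂ) (w : ℂ) : ℂ :=
  if h : w ∉ C.carrier then φ ⟨w, h⟩ / ((1 + ‖w‖ : ℝ) : ℂ) else 0

variable {C}

lemma unweight_of_notMem (φ : OffPt C →ᵇ ℂ) {w : ℂ} (hw : w ∉ C.carrier) :
    unweight C φ w = φ ⟨w, hw⟩ / ((1 + ‖w‖ : ℝ) : ℂ) := by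
  simp [unweight, hw]

lemma unweight_add (φ χ : OffPt C →ᵇ ℂ) (w : ℂ) :
    unweight C (φ + χ) w = unweight C φ w + unweight C χ w := by
  by_cases hw : w ∈ C.carrier <;> simp [unweight, hw, add_div]

lemma unweight_smul (r : ℝ) (φ : OffPt C →ᵇ ℂ) (w : ℂ) :
    unweight C (r • φ) w = r * unweight C φ w := by
  by_cases hw : w ∈ C.carrier <;> simp [unweight, hw, mul_div_assoc]

lemma unweight_sub (φ χ : OffPt C →ᵇ ℂ) (w : ℂ) :
    unweight C (φ - χ) w = unweight C φ w - unweight C χ w := by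
  by_cases hw : w ∈ C.carrier <;> simp [unweight, hw, sub_div]

lemma norm_unweight_le_div (φ : OffPt C →ᵇ ℂ) (w : ℂ) : ‖unweight C φ w‖ ≤ ‖φ‖ / (1 + ‖w‖) := by
  have h0 := one_add_norm_pos w
  by_cases hw : w ∈ C.carrier
  · simp only [unweight, hw, not_true_eq_false, dite_false, norm_zero]
    positivity
  · rw [unweight_of_notMem φ hw, norm_div, Complex.norm_real, Real.norm_of_nonneg h0.le]
    gcongr
    exact φ.norm_coe_le_norm _

lemma norm_unweight_le (φ : OffPt C →ᵇ ℂ) (w : ℂ) : ‖unweight C φ w‖ ≤ ‖φ‖ :=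
  (norm_unweight_le_div φ w).trans (div_le_self (norm_nonneg _) (by linarith [norm_nonneg w]))

lemma decays_unweight (φ : OffPt C →ᵇ ℂ) : Decays C (unweight C φ) :=
  ⟨‖φ‖, fun z _ => norm_unweight_le_div φ z⟩

/-- A limit along `P`, extended to a continuous functional on all bounded continuous functions by
means of an ultrafilter finer than `P`. -/
lemma exists_limit_functional (P : Filter ℂ) [P.NeBot] : ∃ Λ : (OffPt C →ᵇ ℂ) →L[ℝ] ℂ,
    (∀ φ, ‖Λ φ‖ ≤ ‖φ‖) ∧ ∀ φ c, Tendsto (unweight C φ) P (𝓝 c) → Λ φ = c := by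
  have hex : ∀ φ : OffPt C →ᵇ ℂ, ∃ c ∈ Metric.closedBall (0 : ℂ) ‖φ‖,
      Tendsto (unweight C φ) (Ultrafilter.of P : Ultrafilter ℂ) (𝓝 c) := by
    intro φ
    have := (isCompact_closedBall (0 : ℂ) ‖φ‖).ultrafilter_le_nhds'
      ((Ultrafilter.of P).map (unweight C φ)) (Ultrafilter.mem_map.2 (by
        filter_upwards with w
        simpa using norm_unweight_le φ w))
    exact this
  choose c hc hlim using hex
  let L : (OffPt C →ᵇ ℂ) →ₗ[ℝ] ℂ :=
    { toFun := c
      map_add' := fun φ χ => tendsto_nhds_unique (hlim (φ + χ)) (by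
        simpa only [funext (unweight_add φ χ)] using (hlim φ).add (hlim χ))
      map_smul' := fun r φ => tendsto_nhds_unique (hlim (r • φ)) (by
        simpa only [funext (unweight_smul r φ), RingHom.id_apply, real_smul] using
          (hlim φ).const_mul (r : ℂ)) }
  refine ⟨L.mkContinuous 1 fun φ => ?_, fun φ => ?_, fun φ a h => ?_⟩
  · simpa [L] using hc φ
  · simpa [L] using hc φ
  · exact tendsto_nhds_unique (hlim φ) (h.mono_left (Ultrafilter.of_le P))

variable (C) in
/-- The bounded continuous functions whose quotient by `1 + |w|` has a limit along `P`. -/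
def limitSpace (P : Filter ℂ) : Submodule ℝ (OffPt C →ᵇ ℂ) where
  carrier := {φ | ∃ c, Tendsto (unweight C φ) P (𝓝 c)}
  add_mem' := by
    rintro φ χ ⟨a, ha⟩ ⟨b, hb⟩
    exact ⟨a + b, by simpa only [funext (unweight_add φ χ)] using ha.add hb⟩
  zero_mem' := ⟨0, by
    have : unweight C 0 = fun _ => (0 : ℂ) := by
      ext w
      simp [unweight]
    rw [this]
    exact tendsto_const_nhds⟩
  smul_mem' := by
    rintro r φ ⟨a, ha⟩
    exact ⟨r * a, by simpa only [funext (unweight_smul r φ)] using ha.const_mul (r : ℂ)⟩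

/-- A uniform limit of functions with a limit along `P` has a limit along `P`. -/
lemma isClosed_limitSpace (P : Filter ℂ) : IsClosed (limitSpace C P : Set (OffPt C →ᵇ ℂ)) := by
  rcases P.eq_or_neBot with rfl | hP
  · have : (limitSpace C ⊥ : Set (OffPt C →ᵇ ℂ)) = univ := eq_univ_of_forall fun φ => ⟨0, tendsto_bot⟩
    rw [this]
    exact isClosed_univ
  obtain ⟨Λ, hΛ, hlim⟩ := exists_limit_functional (C := C) P
  refine isClosed_of_closure_subset fun φ hφ => ⟨Λ φ, Metric.tendsto_nhds.2 fun ε hε => ?_⟩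
  obtain ⟨χ, ⟨c, hc⟩, hχ⟩ := Metric.mem_closure_iff.1 hφ (ε / 3) (by positivity)
  have hcc := hlim χ c hc
  rw [dist_eq_norm] at hχ
  filter_upwards [Metric.tendsto_nhds.1 hc (ε / 3) (by positivity)] with w hw
  rw [dist_eq_norm] at hw ⊢
  have h1 : unweight C φ w - Λ φ =
      unweight C (φ - χ) w + (unweight C χ w - c) - Λ (φ - χ) := by
    rw [unweight_sub, map_sub, hcc]
    ring
  rw [h1]
  have h2 := norm_unweight_le (φ - χ) w
  have h3 := hΛ (φ - χ)
  have h4 := norm_sub_le (unweight C (φ - χ) w + (unweight C χ w - c)) (Λ (φ - χ))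
  have h5 := norm_add_le (unweight C (φ - χ) w) (unweight C χ w - c)
  linarith

variable (C) in
/-- The bounded continuous functions whose quotient by `1 + |w|` is holomorphic. -/
def holoSpace : Submodule ℝ (OffPt C →ᵇ ℂ) where
  carrier := {φ | DifferentiableOn ℂ (unweight C φ) C.carrierᶜ}
  add_mem' := by
    intro φ χ ha hb
    show DifferentiableOn ℂ (unweight C (φ + χ)) C.carrierᶜ
    rw [funext (unweight_add φ χ)]
    exact DifferentiableOn.add ha hb
  zero_mem' := by
    have : unweight C 0 = fun _ => (0 : ℂ) := by
      ext w
      simp [unweight]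
    show DifferentiableOn ℂ (unweight C 0) C.carrierᶜ
    rw [this]
    exact differentiableOn_const 0
  smul_mem' := by
    intro r φ ha
    show DifferentiableOn ℂ (unweight C (r • φ)) C.carrierᶜ
    rw [funext (unweight_smul r φ)]
    exact DifferentiableOn.const_mul ha (r : ℂ)

/-- Weierstrass: a uniform limit of holomorphic functions is holomorphic. -/
lemma isClosed_holoSpace : IsClosed (holoSpace C : Set (OffPt C →ᵇ ℂ)) := by
  refine isClosed_of_closure_subset fun φ hφ => ?_
  obtain ⟨u, hu, hlim⟩ := mem_closure_iff_seq_limit.1 hφ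
  have : TendstoUniformlyOn (fun k => unweight C (u k)) (unweight C φ) atTop C.carrierᶜ := by
    rw [Metric.tendstoUniformlyOn_iff]
    intro ε hε
    filter_upwards [Metric.tendsto_nhds.1 hlim ε hε] with k hk w _
    rw [dist_eq_norm, ← unweight_sub]
    rw [dist_comm, dist_eq_norm] at hk
    exact (norm_unweight_le _ w).trans_lt hk
  exact this.tendstoLocallyUniformlyOn.differentiableOn (Eventually.of_forall hu) C.isOpen_compl_carrier

/-- The derivative of a curve in a closed subspace lies in that subspace. -/
lemma hasDerivAt_mem_of_isClosed {E : Type*} [NormedAddCommGroup E] [NormedSpace ℝ E]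
    {V : Submodule ℝ E} (hV : IsClosed (V : Set E)) {b : ℝ → E} {b' : E} {t : ℝ}
    (hb : HasDerivAt b b' t) (hm : ∀ᶠ τ in 𝓝 t, b τ ∈ V) : b' ∈ V := by
  refine hV.mem_of_tendsto (hasDerivAt_iff_tendsto_slope.1 hb) ?_
  filter_upwards [nhdsWithin_le_nhds hm] with τ hτ
  exact V.smul_mem _ (V.sub_mem hτ hm.self_of_nhds)


/-! ### Matrix functions off the contour -/

variable {C : Contour}

/-- `f` is holomorphic off the contour. -/
def MatHolo (C : Contour) (f : ℂ → Mat2) : Prop :=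
  ∀ i j, DifferentiableOn ℂ (fun z => f z i j) C.carrierᶜ

/-- `f` is bounded off the contour. -/
def MatBdd (C : Contour) (f : ℂ → Mat2) : Prop :=
  ∀ i j, ∃ K : ℝ, ∀ z ∉ C.carrier, ‖f z i j‖ ≤ K

/-- `f(z) = O(1/(1 + |z|))` off the contour. -/
def MatDecays (C : Contour) (f : ℂ → Mat2) : Prop :=
  ∀ i j, Decays C fun z => f z i j

/-- `f` is holomorphic and bounded off the contour, with one-sided limits whose difference is `φ`. -/
def MatJump (C : Contour) (f φ : ℂ → Mat2) : Prop :=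
  ∀ i j, HasJump C (fun z => f z i j) (fun z => φ z i j)

lemma matHolo_const (A : Mat2) : MatHolo C fun _ => A := fun _ _ => differentiableOn_const _

lemma matBdd_const (A : Mat2) : MatBdd C fun _ => A := fun i j => ⟨‖A i j‖, fun _ _ => le_rfl⟩

lemma Decays.bdd {f : ℂ → ℂ} (h : Decays C f) : ∃ K : ℝ, ∀ z ∉ C.carrier, ‖f z‖ ≤ K := by
  obtain ⟨K, hK0, hK⟩ := h.mono_nonneg
  exact ⟨K, fun z hz => (hK z hz).trans (div_le_self hK0 (by linarith [norm_nonneg z]))⟩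

lemma Decays.add {f g : ℂ → ℂ} (hf : Decays C f) (hg : Decays C g) : Decays C fun z => f z + g z := by
  obtain ⟨K, hK⟩ := hf
  obtain ⟨L, hL⟩ := hg
  exact ⟨K + L, fun z hz => (norm_add_le _ _).trans (by
    rw [add_div]
    exact add_le_add (hK z hz) (hL z hz))⟩

lemma Decays.mul_bdd {f g : ℂ → ℂ} (hf : Decays C f) (hg : ∃ K : ℝ, ∀ z ∉ C.carrier, ‖g z‖ ≤ K) :
    Decays C fun z => f z * g z := by
  obtain ⟨K, hK0, hK⟩ := hf.mono_nonneg
  obtain ⟨L, hL⟩ := hg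
  refine ⟨K * L, fun z hz => ?_⟩
  rw [norm_mul, mul_div_right_comm]
  have := one_add_norm_pos z
  exact mul_le_mul (hK z hz) (hL z hz) (norm_nonneg _) (by positivity)

lemma Decays.neg {f : ℂ → ℂ} (hf : Decays C f) : Decays C fun z => -f z := by
  obtain ⟨K, hK⟩ := hf
  exact ⟨K, fun z hz => by simpa using hK z hz⟩

namespace MatHolo

variable {f g : ℂ → Mat2}

lemma mul (hf : MatHolo C f) (hg : MatHolo C g) : MatHolo C fun z => f z * g z := by
  intro i j
  simp only [Matrix.mul_apply, Fin.sum_univ_two]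
  exact ((hf i 0).mul (hg 0 j)).add ((hf i 1).mul (hg 1 j))

lemma add (hf : MatHolo C f) (hg : MatHolo C g) : MatHolo C fun z => f z + g z :=
  fun i j => (hf i j).add (hg i j)

lemma sub (hf : MatHolo C f) (hg : MatHolo C g) : MatHolo C fun z => f z - g z :=
  fun i j => (hf i j).sub (hg i j)

lemma smul {c : ℂ → ℂ} (hc : DifferentiableOn ℂ c C.carrierᶜ) (hf : MatHolo C f) :
    MatHolo C fun z => c z • f z := fun i j => hc.mul (hf i j)

lemma adjugate (hf : MatHolo C f) : MatHolo C fun z => (f z).adjugate := by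
  intro i j
  fin_cases i <;> fin_cases j <;> simp only [Matrix.adjugate_fin_two]
  · exact hf 1 1
  · exact (hf 0 1).neg
  · exact (hf 1 0).neg
  · exact hf 0 0

end MatHolo

namespace MatBdd

variable {f g : ℂ → Mat2}

lemma add (hf : MatBdd C f) (hg : MatBdd C g) : MatBdd C fun z => f z + g z := by
  intro i j
  obtain ⟨K, hK⟩ := hf i j
  obtain ⟨L, hL⟩ := hg i j
  exact ⟨K + L, fun z hz => (norm_add_le _ _).trans (add_le_add (hK z hz) (hL z hz))⟩

lemma mul (hf : MatBdd C f) (hg : MatBdd C g) : MatBdd C fun z => f z * g z := by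
  intro i j
  choose K hK using hf
  choose L hL using hg
  have hK0 : ∀ i j, ∀ z ∉ C.carrier, 0 ≤ K i j := fun i j z hz => (norm_nonneg _).trans (hK i j z hz)
  refine ⟨K i 0 * L 0 j + K i 1 * L 1 j, fun z hz => ?_⟩
  simp only [Matrix.mul_apply, Fin.sum_univ_two]
  refine (norm_add_le _ _).trans (add_le_add ?_ ?_) <;> rw [norm_mul]
  · exact mul_le_mul (hK _ _ z hz) (hL _ _ z hz) (norm_nonneg _) (hK0 _ _ z hz)
  · exact mul_le_mul (hK _ _ z hz) (hL _ _ z hz) (norm_nonneg _) (hK0 _ _ z hz)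

lemma adjugate (hf : MatBdd C f) : MatBdd C fun z => (f z).adjugate := by
  intro i j
  fin_cases i <;> fin_cases j <;> simp only [Matrix.adjugate_fin_two]
  · exact hf 1 1
  · simpa using hf 0 1
  · simpa using hf 1 0
  · exact hf 0 0

end MatBdd

namespace MatDecays

variable {f g : ℂ → Mat2}

lemma bdd (hf : MatDecays C f) : MatBdd C f := fun i j => (hf i j).bdd

lemma add (hf : MatDecays C f) (hg : MatDecays C g) : MatDecays C fun z => f z + g z :=
  fun i j => (hf i j).add (hg i j)

lemma neg (hf : MatDecays C f) : MatDecays C fun z => -f z := fun i j => (hf i j).neg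

lemma sub (hf : MatDecays C f) (hg : MatDecays C g) : MatDecays C fun z => f z - g z := by
  simpa only [sub_eq_add_neg] using hf.add hg.neg

lemma mul_bdd (hf : MatDecays C f) (hg : MatBdd C g) : MatDecays C fun z => f z * g z := by
  intro i j
  simp only [Matrix.mul_apply, Fin.sum_univ_two]
  exact ((hf i 0).mul_bdd (hg 0 j)).add ((hf i 1).mul_bdd (hg 1 j))

lemma bdd_mul (hf : MatBdd C f) (hg : MatDecays C g) : MatDecays C fun z => f z * g z := by
  intro i j
  simp only [Matrix.mul_apply, Fin.sum_univ_two, mul_comm (f _ _ _)]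
  exact ((hg 0 j).mul_bdd (hf i 0)).add ((hg 1 j).mul_bdd (hf i 1))

lemma smul {c : ℂ → ℂ} (hc : Decays C c) (hf : MatBdd C f) : MatDecays C fun z => c z • f z :=
  fun i j => hc.mul_bdd (hf i j)

lemma const_smul (c : ℂ) (hf : MatDecays C f) : MatDecays C fun z => c • f z := by
  intro i j
  have := (hf i j).mul_bdd (g := fun _ => c) ⟨‖c‖, fun _ _ => le_rfl⟩
  simpa only [Matrix.smul_apply, smul_eq_mul, mul_comm c] using this

end MatDecays

lemma matJump_of_tendsto {f φ : ℂ → Mat2} (hf : MatHolo C f) (hb : MatBdd C f)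
    (hj : ∀ z P N, C.HasSides z P N →
      ∃ A A' : Mat2, Tendsto f P (𝓝 A) ∧ Tendsto f N (𝓝 A') ∧ φ z = A - A') : MatJump C f φ := by
  intro i j
  refine ⟨hf i j, hb i j, fun z P N h => ?_⟩
  obtain ⟨A, A', h1, h2, h3⟩ := hj z P N h
  exact ⟨A i j, A' i j, tendsto_mat_iff.1 h1 i j, tendsto_mat_iff.1 h2 i j, by rw [h3]; rfl⟩

/-- A bounded matrix function without jumps is constant. -/
lemma mat_eq_of_no_jump {f : ℂ → Mat2} (hf : MatHolo C f) (hb : MatBdd C f)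
    (hj : ∀ z P N, C.HasSides z P N → ∃ A : Mat2, Tendsto f P (𝓝 A) ∧ Tendsto f N (𝓝 A))
    {z w : ℂ} (hz : z ∉ C.carrier) (hw : w ∉ C.carrier) : f w = f z := by
  have h : MatJump C f fun _ => 0 := matJump_of_tendsto hf hb fun z P N h => by
    obtain ⟨A, h1, h2⟩ := hj z P N h
    exact ⟨A, A, h1, h2, (sub_self A).symm⟩
  ext i j
  exact eq_of_no_jump (h i j) hz hw

/-! ### The family of solutions -/

/-- The standing hypotheses: `M t x` solves the Riemann-Hilbert problem for all `t ∈ T` and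
`x ∈ X`, and `B` represents `(1 + |z|) (M - I)` in the space of bounded continuous functions. -/
structure SolutionFamily (n : SchwartzMap ℝ ℝ) (C : Contour) (T X : Set ℝ) (Jarc : ℂ → Mat2)
    (Jreal : ℝ → ℝ → Mat2) (M : ℝ → ℝ → ℂ → Mat2)
    (B : Fin 2 → Fin 2 → ℝ × ℝ → (OffPt C →ᵇ ℂ)) : Prop where
  isOpen_T : IsOpen T
  isOpen_X : IsOpen X
  const_of_zero : ∀ l : ℝ, n l = 0 → ∀ x ∈ X, ∀ y ∈ X, Jreal x l = Jreal y l
  sol : ∀ t ∈ T, ∀ x ∈ X, IsRHSolution C (jumpMatrix n Jarc Jreal t x) (M t x)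
  weight : ∀ t ∈ T, ∀ x ∈ X, ∀ (z : OffPt C) (i j : Fin 2),
      B i j (t, x) z = ((1 + ‖(z : ℂ)‖ : ℝ) : ℂ) * (M t x z - 1) i j

/-- An approach to the point `z` through the complement of the contour, along which `η` tends to `e`
and all solutions have limits. Both the one-sided approaches to a point of the contour and the
principal filter of a point off the contour are of this kind. -/
structure Approach (n : SchwartzMap ℝ ℝ) (C : Contour) (T X : Set ℝ) (M : ℝ → ℝ → ℂ → Mat2)
    (z e : ℂ) (P : Filter ℂ) : Prop where
  neBot : P.NeBot
  le_nhds : P ≤ 𝓝 z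
  notMem : ∀ᶠ w in P, w ∉ C.carrier
  tendsto_eta : Tendsto (eta n) P (𝓝 e)
  exists_lim : ∀ t ∈ T, ∀ x ∈ X, ∃ A, Tendsto (M t x) P (𝓝 A)

/-- The limit of a matrix function along `P`. -/
noncomputable def bdry (P : Filter ℂ) (f : ℂ → Mat2) : Mat2 := limUnder P f

lemma bdry_eq {P : Filter ℂ} (hP : P.NeBot) {f : ℂ → Mat2} {A : Mat2} (h : Tendsto f P (𝓝 A)) :
    bdry P f = A := h.limUnder_eq

lemma tendsto_bdry {P : Filter ℂ} {f : ℂ → Mat2} (h : ∃ A, Tendsto f P (𝓝 A)) :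
    Tendsto f P (𝓝 (bdry P f)) := tendsto_nhds_limUnder h

lemma MatDecays.congr {f g : ℂ → Mat2} (hf : MatDecays C f) (h : ∀ z ∉ C.carrier, g z = f z) :
    MatDecays C g := by
  intro i j
  obtain ⟨K, hK⟩ := hf i j
  exact ⟨K, fun z hz => by simpa only [h z hz] using hK z hz⟩

lemma MatBdd.congr {f g : ℂ → Mat2} (hf : MatBdd C f) (h : ∀ z ∉ C.carrier, g z = f z) :
    MatBdd C g := by
  intro i j
  obtain ⟨K, hK⟩ := hf i j
  exact ⟨K, fun z hz => by simpa only [h z hz] using hK z hz⟩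

lemma MatHolo.congr {f g : ℂ → Mat2} (hf : MatHolo C f) (h : ∀ z ∉ C.carrier, g z = f z) :
    MatHolo C g := fun i j => (hf i j).congr fun z hz => by simp only [h z hz]

variable (C) in
/-- The matrix function with entries `b i j (w)/(1 + |w|)`. -/
noncomputable def unweightMat (b : Fin 2 → Fin 2 → (OffPt C →ᵇ ℂ)) (w : ℂ) : Mat2 :=
  Matrix.of fun i j => unweight C (b i j) w

lemma matDecays_unweightMat (b : Fin 2 → Fin 2 → (OffPt C →ᵇ ℂ)) : MatDecays C (unweightMat C b) :=
  fun i j => decays_unweight (b i j)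

/-- Differentiation of boundary values: if a curve of functions is differentiable in the weighted
sup-norm and its members are holomorphic with limits along `P`, then the same is true of its
derivative, and the limits may be differentiated. -/
lemma hasMatDerivAt_bdry {P : Filter ℂ} (hP : P.NeBot) (hn : ∀ᶠ w in P, w ∉ C.carrier)
    {c : ℝ → Fin 2 → Fin 2 → (OffPt C →ᵇ ℂ)} {c' : Fin 2 → Fin 2 → (OffPt C →ᵇ ℂ)} {t : ℝ}
    (hc : ∀ i j, HasDerivAt (fun τ => c τ i j) (c' i j) t) {f : ℝ → ℂ → Mat2} {A₀ : Mat2}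
    (hf : ∀ᶠ τ in 𝓝 t, ∀ w ∉ C.carrier, f τ w = A₀ + unweightMat C (c τ) w)
    (hl : ∀ᶠ τ in 𝓝 t, ∃ A, Tendsto (f τ) P (𝓝 A)) :
    Tendsto (unweightMat C c') P (𝓝 (bdry P (unweightMat C c'))) ∧
    HasMatDerivAt (fun τ => bdry P (f τ)) (bdry P (unweightMat C c')) t := by
  obtain ⟨Λ, -, hΛ⟩ := exists_limit_functional (C := C) P
  have hmem : ∀ᶠ τ in 𝓝 t, ∀ i j, Tendsto (unweight C (c τ i j)) P (𝓝 (bdry P (f τ) i j - A₀ i j)) := by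
    filter_upwards [hf, hl] with τ h1 h2 i j
    refine ((tendsto_mat_iff.1 (tendsto_bdry h2) i j).sub_const (A₀ i j)).congr' ?_
    filter_upwards [hn] with w hw
    rw [h1 w hw]
    simp [unweightMat]
  have hlim : ∀ i j, Tendsto (unweight C (c' i j)) P (𝓝 (Λ (c' i j))) := by
    intro i j
    obtain ⟨a, ha⟩ := hasDerivAt_mem_of_isClosed (isClosed_limitSpace (C := C) P) (hc i j)
      (hmem.mono fun τ h => ⟨_, h i j⟩)
    rwa [hΛ _ a ha]
  have hlim' : Tendsto (unweightMat C c') P (𝓝 (Matrix.of fun i j => Λ (c' i j))) :=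
    tendsto_mat_iff.2 hlim
  rw [bdry_eq hP hlim']
  refine ⟨hlim', fun i j => ?_⟩
  have h1 : HasDerivAt (fun τ => Λ (c τ i j) + A₀ i j) (Λ (c' i j)) t :=
    (Λ.hasFDerivAt.comp_hasDerivAt t (hc i j)).add_const _
  refine h1.congr_of_eventuallyEq ?_
  filter_upwards [hmem] with τ h
  rw [hΛ _ _ (h i j)]
  ring

lemma matHolo_deriv {c : ℝ → Fin 2 → Fin 2 → (OffPt C →ᵇ ℂ)} {c' : Fin 2 → Fin 2 → (OffPt C →ᵇ ℂ)}
    {t : ℝ} (hc : ∀ i j, HasDerivAt (fun τ => c τ i j) (c' i j) t)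
    (hf : ∀ᶠ τ in 𝓝 t, MatHolo C (unweightMat C (c τ))) : MatHolo C (unweightMat C c') :=
  fun i j => hasDerivAt_mem_of_isClosed isClosed_holoSpace (hc i j) (hf.mono fun _ h => h i j)

/-- Logarithmic derivative of `m e^{θσ₃}`, for `det m = 1`. -/
noncomputable def waveLogDeriv (m m' : Mat2) (θ' : ℂ) : Mat2 := (m' + θ' • (m * sigma3)) * m.adjugate

/-- `waveLogDeriv` is the logarithmic derivative: `(m e^{θσ₃})' = W m e^{θσ₃}`. -/
lemma hasMatDerivAt_wave {m : ℝ → Mat2} {m' : Mat2} {θ : ℝ → ℂ} {θ' : ℂ} {t : ℝ}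
    (hm : HasMatDerivAt m m' t) (hθ : HasDerivAt θ θ' t) (hdet : (m t).det = 1) :
    HasMatDerivAt (fun τ => m τ * expSigma3 (θ τ))
      (waveLogDeriv (m t) m' θ' * (m t * expSigma3 (θ t))) t := by
  have h := hm.mul (hasMatDerivAt_expSigma3 hθ)
  have he : waveLogDeriv (m t) m' θ' * (m t * expSigma3 (θ t)) =
      m' * expSigma3 (θ t) + m t * (θ' • (sigma3 * expSigma3 (θ t))) := by
    rw [waveLogDeriv, ← mul_assoc, mul_assoc _ (m t).adjugate, adjugate_mul_of_det hdet, mul_one, add_mul,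
      Matrix.mul_smul, Matrix.smul_mul, mul_assoc (m t)]
  rwa [he]

/-- If `m₂ e^{θ₂σ₃} = m₁ e^{θ₁σ₃} K` with constant `K`, the logarithmic derivatives agree. -/
lemma waveLogDeriv_eq_of_jump {m₁ m₂ : ℝ → Mat2} {m₁' m₂' K : Mat2} {θ₁ θ₂ : ℝ → ℂ} {θ₁' θ₂' : ℂ} {t : ℝ}
    (h₁ : HasMatDerivAt m₁ m₁' t) (h₂ : HasMatDerivAt m₂ m₂' t)
    (hθ₁ : HasDerivAt θ₁ θ₁' t) (hθ₂ : HasDerivAt θ₂ θ₂' t)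
    (hd₁ : (m₁ t).det = 1) (hd₂ : (m₂ t).det = 1)
    (hj : ∀ᶠ τ in 𝓝 t, m₂ τ * expSigma3 (θ₂ τ) = m₁ τ * expSigma3 (θ₁ τ) * K) :
    waveLogDeriv (m₂ t) m₂' θ₂' = waveLogDeriv (m₁ t) m₁' θ₁' := by
  have e₁ := (hasMatDerivAt_wave h₁ hθ₁ hd₁).mul_const K
  have e₂ := hasMatDerivAt_wave h₂ hθ₂ hd₂
  have h := e₂.unique (e₁.congr hj)
  rw [mul_assoc, ← hj.self_of_nhds] at h
  have hdet : (m₂ t * expSigma3 (θ₂ t)).det = 1 := by rw [Matrix.det_mul, hd₂, det_expSigma3, one_mul]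
  generalize m₂ t * expSigma3 (θ₂ t) = Y at h hdet
  have h' := congrArg (· * Y.adjugate) h
  simpa only [mul_assoc, mul_adjugate_of_det hdet, mul_one] using h'


variable {n : SchwartzMap ℝ ℝ} {C : Contour} {T X : Set ℝ} {Jarc : ℂ → Mat2}
  {Jreal : ℝ → ℝ → Mat2} {M : ℝ → ℝ → ℂ → Mat2} {B : Fin 2 → Fin 2 → ℝ × ℝ → (OffPt C →ᵇ ℂ)}

lemma differentiableOn_eta : DifferentiableOn ℂ (eta n) C.carrierᶜ := fun _ hz =>
  (differentiableAt_eta n (C.im_ne_zero_of_notMem hz)).differentiableWithinAt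

lemma decays_eta_sub : Decays C fun z => eta n z - z := by
  obtain ⟨K, hK⟩ := eta_sub_decay n
  exact ⟨K, fun z hz => hK z (C.im_ne_zero_of_notMem hz)⟩

lemma MatDecays.matBdd_smul {f : ℂ → Mat2} (hf : MatDecays C f) : MatBdd C fun z => z • f z := by
  intro i j
  obtain ⟨K, hK0, hK⟩ := (hf i j).mono_nonneg
  refine ⟨K, fun z hz => ?_⟩
  simp only [Matrix.smul_apply, norm_smul]
  have h := hK z hz
  rw [le_div_iff₀ (one_add_norm_pos z)] at h
  nlinarith [norm_nonneg (f z i j)]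

/-- The exponent in `Φ = M e^{θσ₃}`, with the value `e` in place of `η(z)`. -/
noncomputable def phase (z e : ℂ) (t x : ℝ) : ℂ := -(I * (z * t - x * e))

lemma hasDerivAt_phase_t (z e : ℂ) (t x : ℝ) : HasDerivAt (fun τ => phase z e τ x) (-(I * z)) t := by
  have h : HasDerivAt (fun τ : ℝ => (τ : ℂ)) 1 t := Complex.ofRealCLM.hasDerivAt
  refine (((h.const_mul z).sub_const (x * e)).const_mul I).neg.congr_deriv ?_
  ring

lemma hasDerivAt_phase_x (z e : ℂ) (t x : ℝ) : HasDerivAt (fun ξ => phase z e t ξ) (I * e) x := by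
  have h : HasDerivAt (fun τ : ℝ => (τ : ℂ)) 1 x := Complex.ofRealCLM.hasDerivAt
  refine (((h.mul_const e).const_sub (z * t)).const_mul I).neg.congr_deriv ?_
  ring

lemma bdry_pure (z : ℂ) (f : ℂ → Mat2) : bdry (pure z) f = f z :=
  bdry_eq inferInstance (tendsto_pure_nhds f z)

lemma approach_pure {z : ℂ} (hz : z ∉ C.carrier) : Approach n C T X M z (eta n z) (pure z) where
  neBot := inferInstance
  le_nhds := pure_le_nhds z
  notMem := by simpa using hz
  tendsto_eta := tendsto_pure_nhds _ z
  exists_lim := fun t _ x _ => ⟨M t x z, tendsto_pure_nhds _ z⟩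

/-- The derivative of the weighted solution in `t`. -/
noncomputable def dT (B : Fin 2 → Fin 2 → ℝ × ℝ → (OffPt C →ᵇ ℂ)) (t x : ℝ) (i j : Fin 2) :
    OffPt C →ᵇ ℂ := deriv (fun τ => B i j (τ, x)) t

/-- The derivative of the weighted solution in `x`. -/
noncomputable def dX (B : Fin 2 → Fin 2 → ℝ × ℝ → (OffPt C →ᵇ ℂ)) (t x : ℝ) (i j : Fin 2) :
    OffPt C →ᵇ ℂ := deriv (fun ξ => B i j (t, ξ)) x

/-- `W_t = Φ_t Φ⁻¹`. -/
noncomputable def waveT (M : ℝ → ℝ → ℂ → Mat2) (B : Fin 2 → Fin 2 → ℝ × ℝ → (OffPt C →ᵇ ℂ))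
    (t x : ℝ) (w : ℂ) : Mat2 := waveLogDeriv (M t x w) (unweightMat C (dT B t x) w) (-(I * w))

/-- `W_x = Φ_x Φ⁻¹`. -/
noncomputable def waveX (n : SchwartzMap ℝ ℝ) (M : ℝ → ℝ → ℂ → Mat2)
    (B : Fin 2 → Fin 2 → ℝ × ℝ → (OffPt C →ᵇ ℂ)) (t x : ℝ) (w : ℂ) : Mat2 :=
  waveLogDeriv (M t x w) (unweightMat C (dX B t x) w) (I * eta n w)

/-- The potential `H`, read off from `Φ_t Φ⁻¹ = -(i z σ₃ + H)` at a base point `z₀`. -/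
noncomputable def potential (M : ℝ → ℝ → ℂ → Mat2) (B : Fin 2 → Fin 2 → ℝ × ℝ → (OffPt C →ᵇ ℂ))
    (z₀ : ℂ) (t x : ℝ) : Mat2 := -(waveT M B t x z₀ + (I * z₀) • sigma3)

/-- `R = Φ_x Φ⁻¹ - i z σ₃ - H`. -/
noncomputable def remainder (n : SchwartzMap ℝ ℝ) (M : ℝ → ℝ → ℂ → Mat2)
    (B : Fin 2 → Fin 2 → ℝ × ℝ → (OffPt C →ᵇ ℂ)) (z₀ : ℂ) (t x : ℝ) (w : ℂ) : Mat2 :=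
  waveX n M B t x w - (I * w) • sigma3 - potential M B z₀ t x

lemma tendsto_waveLogDeriv {P : Filter ℂ} {f g : ℂ → Mat2} {c : ℂ → ℂ} {A A' : Mat2} {a : ℂ}
    (hf : Tendsto f P (𝓝 A)) (hg : Tendsto g P (𝓝 A')) (hc : Tendsto c P (𝓝 a)) :
    Tendsto (fun w => waveLogDeriv (f w) (g w) (c w)) P (𝓝 (waveLogDeriv A A' a)) :=
  (hg.add (hc.smul (hf.mul_const sigma3))).mul (tendsto_adjugate hf)

lemma Approach.tendsto_M {t x : ℝ} {z e : ℂ} {P : Filter ℂ} (hP : Approach n C T X M z e P)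
    (ht : t ∈ T) (hx : x ∈ X) : Tendsto (M t x) P (𝓝 (bdry P (M t x))) :=
  tendsto_bdry (hP.exists_lim t ht x hx)

namespace SolutionFamily

variable (S : SolutionFamily n C T X Jarc Jreal M B) {t x : ℝ} {z e w : ℂ} {P N : Filter ℂ}
include S

lemma eq_unweight (ht : t ∈ T) (hx : x ∈ X) (hw : w ∉ C.carrier) :
    M t x w = 1 + unweightMat C (fun i j => B i j (t, x)) w := by
  ext i j
  have h0 : ((1 + ‖w‖ : ℝ) : ℂ) ≠ 0 := by exact_mod_cast (one_add_norm_pos w).ne'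
  have h := S.weight t ht x hx ⟨w, hw⟩ i j
  simp only [unweightMat, Matrix.add_apply, Matrix.of_apply, unweight_of_notMem _ hw, h]
  rw [mul_div_cancel_left₀ _ h0, Matrix.sub_apply]
  ring

lemma matHolo_M (ht : t ∈ T) (hx : x ∈ X) : MatHolo C (M t x) := (S.sol t ht x hx).analytic

lemma matDecays_M (ht : t ∈ T) (hx : x ∈ X) : MatDecays C fun w => M t x w - 1 :=
  (matDecays_unweightMat fun i j => B i j (t, x)).congr fun w hw => by
    rw [S.eq_unweight ht hx hw, add_sub_cancel_left]

lemma matBdd_M (ht : t ∈ T) (hx : x ∈ X) : MatBdd C (M t x) :=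
  ((matBdd_const 1).add (S.matDecays_M ht hx).bdd).congr fun w _ => by abel

lemma matHolo_unweight (ht : t ∈ T) (hx : x ∈ X) : MatHolo C (unweightMat C fun i j => B i j (t, x)) :=
  ((S.matHolo_M ht hx).sub (matHolo_const 1)).congr fun w hw => by
    rw [S.eq_unweight ht hx hw, add_sub_cancel_left]

/-- At a point of the contour the two one-sided approaches are admissible, and the boundary values
of `Φ` differ by a right factor that depends on `x` only where `z` is real and `n(z) ≠ 0`. -/
lemma exists_approach (h : C.HasSides z P N) : ∃ (eP eN : ℂ) (K : ℝ → Mat2),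
    Approach n C T X M z eP P ∧ Approach n C T X M z eN N ∧
    (z.im ≠ 0 ∨ n z.re = 0 → ∀ x ∈ X, ∀ y ∈ X, K x = K y) ∧
    (∀ x, z.im = 0 → K x = Jreal x z.re) ∧
    (∀ t ∈ T, ∀ x ∈ X, (jumpMatrix n Jarc Jreal t x z).det = 1) ∧
    (∀ t ∈ T, ∀ x ∈ X, bdry N (M t x) = bdry P (M t x) * jumpMatrix n Jarc Jreal t x z) ∧
    ∀ t ∈ T, ∀ x ∈ X, bdry N (M t x) * expSigma3 (phase z eN t x) =
      bdry P (M t x) * expSigma3 (phase z eP t x) * K x := by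
  have hP := h.neBot_left
  have hN := h.neBot_right
  have hlP : ∀ t ∈ T, ∀ x ∈ X, ∃ A, Tendsto (M t x) P (𝓝 A) := fun t ht x hx => by
    obtain ⟨A, h1, -⟩ := (S.sol t ht x hx).jump z P N h
    exact ⟨A, h1⟩
  have hlN : ∀ t ∈ T, ∀ x ∈ X, ∃ A, Tendsto (M t x) N (𝓝 A) := fun t ht x hx => by
    obtain ⟨A, -, h1⟩ := (S.sol t ht x hx).jump z P N h
    exact ⟨_, h1⟩
  have hb : ∀ t ∈ T, ∀ x ∈ X, bdry N (M t x) = bdry P (M t x) * jumpMatrix n Jarc Jreal t x z :=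
    fun t ht x hx => by
      obtain ⟨A, h1, h2⟩ := (S.sol t ht x hx).jump z P N h
      rw [bdry_eq hP h1, bdry_eq hN h2]
  have hdet : ∀ t ∈ T, ∀ x ∈ X, (jumpMatrix n Jarc Jreal t x z).det = 1 := fun t ht x hx =>
    (S.sol t ht x hx).det_jump z h.mem_carrier h.notMem_nodes
  have key : ∀ eP eN, ∀ A K Y : Mat2, ∀ t x : ℝ, Y = expSigma3 (phase z eP t x) * K *
      expSigma3 (-phase z eN t x) → A * Y * expSigma3 (phase z eN t x) =
        A * expSigma3 (phase z eP t x) * K := by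
    intro eP eN A K Y t x hY
    rw [hY]
    simp only [mul_assoc]
    rw [expSigma3_neg_mul, mul_one]
  have hnm := h.eventually_notMem
  have hleP := h.le_nhds_left
  have hleN := h.le_nhds_right
  cases h with
  | real l hl =>
    refine ⟨etaPlus n l, etaMinus n l, fun x => Jreal x l,
      ⟨hP, hleP, hnm.1, tendsto_eta_above n l, hlP⟩, ⟨hN, hleN, hnm.2, tendsto_eta_below n l, hlN⟩,
      ?_, fun x _ => by simp, hdet, hb, fun t ht x hx => ?_⟩
    · rintro (h | h)
      · simp at h
      · exact S.const_of_zero l (by simpa using h)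
    · rw [hb t ht x hx]
      exact key _ _ _ _ _ t x (by simp [jumpMatrix, phase])
  | arc k s hs hn =>
    have him : (C.arc k s).im ≠ 0 := fun h0 => hn (C.meet_real_mem k s (Ioo_subset_Icc_self hs) h0)
    have he : Tendsto (eta n) (𝓝 (C.arc k s)) (𝓝 (eta n (C.arc k s))) :=
      (differentiableAt_eta n him).continuousAt
    refine ⟨eta n (C.arc k s), eta n (C.arc k s), fun x => Jarc (C.arc k s),
      ⟨hP, hleP, hnm.1, he.mono_left hleP, hlP⟩, ⟨hN, hleN, hnm.2, he.mono_left hleN, hlN⟩,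
      fun _ x _ y _ => rfl, fun x h0 => absurd h0 him, hdet, hb, fun t ht x hx => ?_⟩
    rw [hb t ht x hx]
    exact key _ _ _ _ _ t x (by simp [jumpMatrix, phase, him])

lemma approach_above {l : ℝ} (hl : (l : ℂ) ∉ C.nodes) :
    Approach n C T X M l (etaPlus n l) (above l) := by
  have hs : C.HasSides _ _ _ := .real l hl
  exact ⟨hs.neBot_left, hs.le_nhds_left, hs.eventually_notMem.1, tendsto_eta_above n l,
    fun t ht x hx => ((S.sol t ht x hx).jump _ _ _ hs).imp fun A h => h.1⟩

lemma approach_below {l : ℝ} (hl : (l : ℂ) ∉ C.nodes) :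
    Approach n C T X M l (etaMinus n l) (below l) := by
  have hs : C.HasSides _ _ _ := .real l hl
  exact ⟨hs.neBot_right, hs.le_nhds_right, hs.eventually_notMem.2, tendsto_eta_below n l,
    fun t ht x hx => let ⟨_, h⟩ := (S.sol t ht x hx).jump _ _ _ hs; ⟨_, h.2⟩⟩

/-- `det M` has no jump, since `det J = 1`, and tends to `1` at infinity. -/
lemma det_M (ht : t ∈ T) (hx : x ∈ X) (hw : w ∉ C.carrier) : (M t x w).det = 1 := by
  have hol : DifferentiableOn ℂ (fun w => (M t x w).det - 1) C.carrierᶜ := by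
    have h := S.matHolo_M ht hx
    simp only [Matrix.det_fin_two]
    exact (((h 0 0).mul (h 1 1)).sub ((h 0 1).mul (h 1 0))).sub_const 1
  have hdec : Decays C fun w => (M t x w).det - 1 := by
    have h := S.matDecays_M ht hx
    have hb := S.matBdd_M ht hx
    have h1 := (((h 0 0).mul_bdd (hb 1 1)).add (h 1 1)).add ((h 0 1).mul_bdd (hb 1 0)).neg
    obtain ⟨K, hK⟩ := h1
    refine ⟨K, fun z hz => ?_⟩
    convert hK z hz using 2
    simp [Matrix.det_fin_two]
    ring
  have hj : HasJump C (fun w => (M t x w).det - 1) 0 := by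
    refine ⟨hol, hdec.bdd, fun z P N h => ?_⟩
    obtain ⟨eP, eN, K, hP, hN, -, -, hdet, hb, -⟩ := S.exists_approach h
    refine ⟨_, _, (tendsto_det (hP.tendsto_M ht hx)).sub_const 1,
      (tendsto_det (hN.tendsto_M ht hx)).sub_const 1, ?_⟩
    rw [hb t ht x hx, Matrix.det_mul, hdet t ht x hx, mul_one, sub_self]
    rfl
  exact sub_eq_zero.1 (eq_zero_of_no_jump hj hdec hw)

lemma det_bdry (hP : Approach n C T X M z e P) (ht : t ∈ T) (hx : x ∈ X) :
    (bdry P (M t x)).det = 1 := by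
  have := hP.neBot
  refine tendsto_nhds_unique (tendsto_det (hP.tendsto_M ht hx)) (tendsto_const_nhds.congr' ?_)
  filter_upwards [hP.notMem] with w hw
  exact (S.det_M ht hx hw).symm

/-- The boundary value of `M` is differentiable in `t`, and its derivative is the boundary value of
`M_t`. -/
lemma bdry_dT (hP : Approach n C T X M z e P) (ht : t ∈ T) (hx : x ∈ X)
    (hd : ∀ i j, DifferentiableAt ℝ (fun τ => B i j (τ, x)) t) :
    Tendsto (unweightMat C (dT B t x)) P (𝓝 (bdry P (unweightMat C (dT B t x)))) ∧
    HasMatDerivAt (fun τ => bdry P (M τ x)) (bdry P (unweightMat C (dT B t x))) t := by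
  have hnear := S.isOpen_T.mem_nhds ht
  refine hasMatDerivAt_bdry hP.neBot hP.notMem (A₀ := 1) (fun i j => (hd i j).hasDerivAt) ?_ ?_
  · filter_upwards [hnear] with τ hτ w hw
    exact S.eq_unweight hτ hx hw
  · filter_upwards [hnear] with τ hτ
    exact hP.exists_lim τ hτ x hx

lemma bdry_dX (hP : Approach n C T X M z e P) (ht : t ∈ T) (hx : x ∈ X)
    (hd : ∀ i j, DifferentiableAt ℝ (fun ξ => B i j (t, ξ)) x) :
    Tendsto (unweightMat C (dX B t x)) P (𝓝 (bdry P (unweightMat C (dX B t x)))) ∧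
    HasMatDerivAt (fun ξ => bdry P (M t ξ)) (bdry P (unweightMat C (dX B t x))) x := by
  have hnear := S.isOpen_X.mem_nhds hx
  refine hasMatDerivAt_bdry hP.neBot hP.notMem (A₀ := 1) (fun i j => (hd i j).hasDerivAt) ?_ ?_
  · filter_upwards [hnear] with ξ hξ w hw
    exact S.eq_unweight ht hξ hw
  · filter_upwards [hnear] with ξ hξ
    exact hP.exists_lim t ht ξ hξ

lemma matHolo_dT (ht : t ∈ T) (hx : x ∈ X)
    (hd : ∀ i j, DifferentiableAt ℝ (fun τ => B i j (τ, x)) t) :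
    MatHolo C (unweightMat C (dT B t x)) := by
  refine matHolo_deriv (fun i j => (hd i j).hasDerivAt) ?_
  filter_upwards [S.isOpen_T.mem_nhds ht] with τ hτ
  exact S.matHolo_unweight hτ hx

lemma matHolo_dX (ht : t ∈ T) (hx : x ∈ X)
    (hd : ∀ i j, DifferentiableAt ℝ (fun ξ => B i j (t, ξ)) x) :
    MatHolo C (unweightMat C (dX B t x)) := by
  refine matHolo_deriv (fun i j => (hd i j).hasDerivAt) ?_
  filter_upwards [S.isOpen_X.mem_nhds hx] with ξ hξ
  exact S.matHolo_unweight ht hξ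

/-! ### The equation in `t` -/

/-- `Φ_t Φ⁻¹ + i z σ₃` has no jump and is bounded, hence constant. -/
lemma waveT_eq (ht : t ∈ T) (hx : x ∈ X)
    (hd : ∀ i j, DifferentiableAt ℝ (fun τ => B i j (τ, x)) t)
    {z₀ : ℂ} (hz₀ : z₀ ∉ C.carrier) (hw : w ∉ C.carrier) :
    waveT M B t x w = -((I * w) • sigma3 + potential M B z₀ t x) := by
  have hM := S.matHolo_M ht hx
  -- the growing terms combine to `i [σ₃, w (M - I)]`, which is bounded
  have hform : ∀ w ∉ C.carrier, waveT M B t x w + (I * w) • sigma3 =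
      unweightMat C (dT B t x) w * (M t x w).adjugate +
        I • (sigma3 * (w • (M t x w - 1)) + -(w • (M t x w - 1)) * sigma3) * (M t x w).adjugate := by
    intro w hw
    have h1 := mul_adjugate_of_det (S.det_M ht hx hw)
    have h2 : (I * w) • sigma3 = (I * w) • (sigma3 * (M t x w * (M t x w).adjugate)) := by rw [h1, mul_one]
    rw [waveT, waveLogDeriv, h2]
    simp only [Matrix.mul_sub, Matrix.sub_mul, add_mul, mul_assoc, Matrix.mul_smul, Matrix.smul_mul, smul_sub,
      smul_add, neg_mul, neg_smul, smul_neg, mul_one, one_mul, smul_smul]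
    abel
  have hhol : MatHolo C fun w => waveT M B t x w + (I * w) • sigma3 :=
    (((S.matHolo_dT ht hx hd).add (MatHolo.smul (c := fun w => -(I * w)) (by fun_prop)
      (hM.mul (matHolo_const sigma3)))).mul hM.adjugate).add
      (MatHolo.smul (by fun_prop) (matHolo_const sigma3))
  have hwM := (S.matDecays_M ht hx).matBdd_smul
  have hbdd : MatBdd C fun w => waveT M B t x w + (I * w) • sigma3 := by
    have hadj := (S.matBdd_M ht hx).adjugate
    refine MatBdd.congr (((matDecays_unweightMat (dT B t x)).bdd.mul hadj).add
      ((MatBdd.mul (matBdd_const (I • 1)) (((matBdd_const sigma3).mul hwM).add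
      (hwM.mul (matBdd_const (-sigma3))))).mul hadj)) fun w hw => ?_
    rw [hform w hw]
    simp only [Matrix.smul_mul, one_mul, mul_neg, neg_mul]
  have hconst := mat_eq_of_no_jump hhol hbdd (fun z P N h => ?_) hz₀ hw
  · rw [potential, ← hconst]
    abel
  obtain ⟨eP, eN, K, hP, hN, -, -, -, -, hj⟩ := S.exists_approach h
  have hlim : ∀ {e P}, Approach n C T X M z e P → Tendsto (fun w => waveT M B t x w + (I * w) • sigma3) P
      (𝓝 (waveLogDeriv (bdry P (M t x)) (bdry P (unweightMat C (dT B t x))) (-(I * z)) +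
        (I * z) • sigma3)) := by
    intro e P hP
    have hid : Tendsto (fun w : ℂ => I * w) P (𝓝 (I * z)) :=
      (tendsto_id.mono_left hP.le_nhds).const_mul I
    exact (tendsto_waveLogDeriv (hP.tendsto_M ht hx) (S.bdry_dT hP ht hx hd).1 hid.neg).add
      (hid.smul_const sigma3)
  refine ⟨_, hlim hP, ?_⟩
  have he := waveLogDeriv_eq_of_jump (K := K x) (S.bdry_dT hP ht hx hd).2 (S.bdry_dT hN ht hx hd).2
    (hasDerivAt_phase_t z eP t x) (hasDerivAt_phase_t z eN t x) (S.det_bdry hP ht hx) (S.det_bdry hN ht hx)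
    (by
      filter_upwards [S.isOpen_T.mem_nhds ht] with τ hτ
      exact hj τ hτ x hx)
  rw [← he]
  exact hlim hN

end SolutionFamily


variable {n : SchwartzMap ℝ ℝ} {C : Contour} {T X : Set ℝ} {Jarc : ℂ → Mat2}
  {Jreal : ℝ → ℝ → Mat2} {M : ℝ → ℝ → ℂ → Mat2} {B : Fin 2 → Fin 2 → ℝ × ℝ → (OffPt C →ᵇ ℂ)}

/-! ### The jump of the logarithmic `x`-derivative -/

/-- The matrix function `F` with `π n F / 2 = R₊ - R₋`, set to `0` at the zeros of `n` and at the
nodes. -/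
noncomputable def jumpF (n : SchwartzMap ℝ ℝ) (M : ℝ → ℝ → ℂ → Mat2)
    (B : Fin 2 → Fin 2 → ℝ × ℝ → (OffPt C →ᵇ ℂ)) (z₀ : ℂ) (t x l : ℝ) : Mat2 :=
  if n l = 0 ∨ (l : ℂ) ∈ C.nodes then 0 else
    ((2 / (Real.pi * n l) : ℝ) : ℂ) •
      (bdry (above l) (remainder n M B z₀ t x) - bdry (below l) (remainder n M B z₀ t x))

/-- The jump of `R` lives on the real line: a real point of an arc is a node, where `F = 0`. -/
lemma cint_jumpF {z₀ : ℂ} {t x : ℝ} (ψ : ℂ → ℂ) (i j : Fin 2) :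
    (C.cint fun z => ψ z * (if z.im = 0 then
      ((Real.pi * n z.re / 2 : ℝ) : ℂ) • jumpF n M B z₀ t x z.re else 0) i j) =
      ∫ l : ℝ, ψ l * (((Real.pi * n l / 2 : ℝ) : ℂ) * jumpF n M B z₀ t x l i j) := by
  have harc : ∀ k, ∫ s in (0 : ℝ)..1, deriv (C.arc k) s * (ψ (C.arc k s) *
      (if (C.arc k s).im = 0 then ((Real.pi * n (C.arc k s).re / 2 : ℝ) : ℂ) •
        jumpF n M B z₀ t x (C.arc k s).re else 0) i j) = 0 := by
    intro k
    refine intervalIntegral.integral_zero_ae (ae_of_all _ fun s hs => ?_)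
    rw [uIoc_of_le zero_le_one] at hs
    by_cases him : (C.arc k s).im = 0
    · have hn := C.meet_real_mem k s (Ioc_subset_Icc_self hs) him
      have hre : ((C.arc k s).re : ℂ) = C.arc k s := by
        apply Complex.ext <;> simp [him]
      have : jumpF n M B z₀ t x (C.arc k s).re = 0 := by
        rw [jumpF, if_pos (Or.inr (by rwa [hre]))]
      simp [him, this]
    · simp [him]
  rw [Contour.cint, Finset.sum_congr rfl fun k _ => harc k, Finset.sum_const_zero, add_zero]
  simp

lemma waveLogDeriv_add (m m₁ m₂ : Mat2) (a b : ℂ) :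
    waveLogDeriv m m₁ a + waveLogDeriv m m₂ b = (m₁ + m₂) * m.adjugate + (a + b) • (m * sigma3 * m.adjugate) := by
  simp only [waveLogDeriv, add_mul, add_smul, Matrix.smul_mul]
  abel

lemma exists_base_point (C : Contour) : ∃ z₀ : ℂ, z₀ ∉ C.carrier := by
  obtain ⟨R, hR, h⟩ := C.exists_arc_bound
  refine ⟨I * ((R + 1 : ℝ) : ℂ), ?_⟩
  rintro (hz | hz)
  · have : R + 1 = 0 := by simpa using hz
    linarith
  · obtain ⟨k, s, hs, hz⟩ := mem_iUnion.1 hz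
    have := h k s hs
    rw [hz, norm_mul, Complex.norm_I, one_mul, Complex.norm_real, Real.norm_eq_abs] at this
    linarith [le_abs_self (R + 1)]

lemma tendsto_I_mul_smul {P : Filter ℂ} {z : ℂ} (h : P ≤ 𝓝 z) :
    Tendsto (fun w : ℂ => (I * w) • sigma3) P (𝓝 ((I * z) • sigma3)) :=
  ((tendsto_id.mono_left h).const_mul I).smul_const sigma3

namespace SolutionFamily

variable (S : SolutionFamily n C T X Jarc Jreal M B) {t x : ℝ} {z e w z₀ : ℂ} {P N : Filter ℂ}
include S

/-- `Φ_t Φ⁻¹ = -(i z σ₃ + H)` for the boundary values. -/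
lemma bdry_waveT (hP : Approach n C T X M z e P) (ht : t ∈ T) (hx : x ∈ X)
    (hd : ∀ i j, DifferentiableAt ℝ (fun τ => B i j (τ, x)) t) (hz₀ : z₀ ∉ C.carrier) :
    waveLogDeriv (bdry P (M t x)) (bdry P (unweightMat C (dT B t x))) (-(I * z)) =
      -((I * z) • sigma3 + potential M B z₀ t x) := by
  have := hP.neBot
  have hid : Tendsto (fun w : ℂ => I * w) P (𝓝 (I * z)) := (tendsto_id.mono_left hP.le_nhds).const_mul I
  have h1 := tendsto_waveLogDeriv (hP.tendsto_M ht hx) (S.bdry_dT hP ht hx hd).1 hid.neg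
  refine tendsto_nhds_unique h1 ?_
  refine (((tendsto_I_mul_smul hP.le_nhds).add_const _).neg).congr' ?_
  filter_upwards [hP.notMem] with w hw
  exact (S.waveT_eq ht hx hd hz₀ hw).symm

/-- The equation in `t` for `Φ` and its boundary values. -/
lemma hasMatDerivAt_wave_t (hP : Approach n C T X M z e P) (ht : t ∈ T) (hx : x ∈ X)
    (hd : ∀ i j, DifferentiableAt ℝ (fun τ => B i j (τ, x)) t) (hz₀ : z₀ ∉ C.carrier) :
    HasMatDerivAt (fun τ => bdry P (M τ x) * expSigma3 (phase z e τ x))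
      (-((I * z) • sigma3 + potential M B z₀ t x) * (bdry P (M t x) * expSigma3 (phase z e t x))) t := by
  rw [← S.bdry_waveT hP ht hx hd hz₀]
  exact hasMatDerivAt_wave (S.bdry_dT hP ht hx hd).2 (hasDerivAt_phase_t z e t x) (S.det_bdry hP ht hx)

/-- The equation in `t` for `M`. -/
lemma bdry_dT_eq (hP : Approach n C T X M z e P) (ht : t ∈ T) (hx : x ∈ X)
    (hd : ∀ i j, DifferentiableAt ℝ (fun τ => B i j (τ, x)) t) (hz₀ : z₀ ∉ C.carrier) :
    bdry P (unweightMat C (dT B t x)) = (I * z) • (bdry P (M t x) * sigma3) -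
      ((I * z) • sigma3 + potential M B z₀ t x) * bdry P (M t x) := by
  have h := congrArg (· * bdry P (M t x)) (S.bdry_waveT hP ht hx hd hz₀)
  simp only [waveLogDeriv, mul_assoc, adjugate_mul_of_det (S.det_bdry hP ht hx), mul_one, neg_mul, neg_smul] at h
  rw [← sub_eq_add_neg, sub_eq_iff_eq_add] at h
  rw [h]
  abel

/-! ### The equation in `x` -/

lemma tendsto_waveX (hP : Approach n C T X M z e P) (ht : t ∈ T) (hx : x ∈ X)
    (hd : ∀ i j, DifferentiableAt ℝ (fun ξ => B i j (t, ξ)) x) :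
    Tendsto (waveX n M B t x) P
      (𝓝 (waveLogDeriv (bdry P (M t x)) (bdry P (unweightMat C (dX B t x))) (I * e))) :=
  tendsto_waveLogDeriv (hP.tendsto_M ht hx) (S.bdry_dX hP ht hx hd).1 (hP.tendsto_eta.const_mul I)

lemma bdry_waveX (hP : Approach n C T X M z e P) (ht : t ∈ T) (hx : x ∈ X)
    (hd : ∀ i j, DifferentiableAt ℝ (fun ξ => B i j (t, ξ)) x) :
    bdry P (waveX n M B t x) =
      waveLogDeriv (bdry P (M t x)) (bdry P (unweightMat C (dX B t x))) (I * e) :=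
  bdry_eq hP.neBot (S.tendsto_waveX hP ht hx hd)

lemma tendsto_remainder (hP : Approach n C T X M z e P) (ht : t ∈ T) (hx : x ∈ X)
    (hd : ∀ i j, DifferentiableAt ℝ (fun ξ => B i j (t, ξ)) x) :
    Tendsto (remainder n M B z₀ t x) P
      (𝓝 (bdry P (waveX n M B t x) - (I * z) • sigma3 - potential M B z₀ t x)) := by
  rw [S.bdry_waveX hP ht hx hd]
  exact ((S.tendsto_waveX hP ht hx hd).sub (tendsto_I_mul_smul hP.le_nhds)).sub_const _

lemma bdry_remainder (hP : Approach n C T X M z e P) (ht : t ∈ T) (hx : x ∈ X)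
    (hd : ∀ i j, DifferentiableAt ℝ (fun ξ => B i j (t, ξ)) x) :
    bdry P (remainder n M B z₀ t x) =
      bdry P (waveX n M B t x) - (I * z) • sigma3 - potential M B z₀ t x :=
  bdry_eq hP.neBot (S.tendsto_remainder hP ht hx hd)

/-- The equation in `x` for `Φ` and its boundary values. -/
lemma hasMatDerivAt_wave_x (hP : Approach n C T X M z e P) (ht : t ∈ T) (hx : x ∈ X)
    (hd : ∀ i j, DifferentiableAt ℝ (fun ξ => B i j (t, ξ)) x) :
    HasMatDerivAt (fun ξ => bdry P (M t ξ) * expSigma3 (phase z e t ξ))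
      (bdry P (waveX n M B t x) * (bdry P (M t x) * expSigma3 (phase z e t x))) x := by
  rw [S.bdry_waveX hP ht hx hd]
  exact hasMatDerivAt_wave (S.bdry_dX hP ht hx hd).2 (hasDerivAt_phase_x z e t x) (S.det_bdry hP ht hx)

lemma bdry_dX_eq (hP : Approach n C T X M z e P) (ht : t ∈ T) (hx : x ∈ X)
    (hd : ∀ i j, DifferentiableAt ℝ (fun ξ => B i j (t, ξ)) x) :
    bdry P (unweightMat C (dX B t x)) =
      bdry P (waveX n M B t x) * bdry P (M t x) - (I * e) • (bdry P (M t x) * sigma3) := by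
  rw [S.bdry_waveX hP ht hx hd, waveLogDeriv, mul_assoc, adjugate_mul_of_det (S.det_bdry hP ht hx), mul_one,
    add_sub_cancel_right]

/-- The logarithmic `x`-derivative of `Φ` is continuous across the contour where `Ĵ` does not depend
on `x`. -/
lemma bdry_waveX_eq (h : C.HasSides z P N) (ht : t ∈ T) (hx : x ∈ X)
    (hd : ∀ i j, DifferentiableAt ℝ (fun ξ => B i j (t, ξ)) x) (hz : z.im ≠ 0 ∨ n z.re = 0) :
    bdry N (waveX n M B t x) = bdry P (waveX n M B t x) := by
  obtain ⟨eP, eN, K, hP, hN, hK, -, -, -, hj⟩ := S.exists_approach h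
  have he := waveLogDeriv_eq_of_jump (K := K x) (S.bdry_dX hP ht hx hd).2 (S.bdry_dX hN ht hx hd).2
    (hasDerivAt_phase_x z eP t x) (hasDerivAt_phase_x z eN t x) (S.det_bdry hP ht hx) (S.det_bdry hN ht hx)
    (by
      filter_upwards [S.isOpen_X.mem_nhds hx] with ξ hξ
      rw [hj t ht ξ hξ, hK hz ξ hξ x hx])
  rw [S.bdry_waveX hP ht hx hd, S.bdry_waveX hN ht hx hd]
  exact he

variable (hdt : ∀ i j, DifferentiableAt ℝ (fun τ => B i j (τ, x)) t)
  (hdx : ∀ i j, DifferentiableAt ℝ (fun ξ => B i j (t, ξ)) x)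
include hdt hdx

omit hdx in
/-- Replacing `H` by `-(Φ_t Φ⁻¹ + i z σ₃)` cancels the terms of `R` which grow at infinity: what is left
is built from `M_x`, `M_t` and `η - z`, all of which decay. -/
lemma remainder_eq (ht : t ∈ T) (hx : x ∈ X) (hz₀ : z₀ ∉ C.carrier) (hw : w ∉ C.carrier) :
    remainder n M B z₀ t x w =
      (unweightMat C (dX B t x) w + unweightMat C (dT B t x) w) * (M t x w).adjugate +
        (eta n w - w) • (I • (M t x w * sigma3 * (M t x w).adjugate)) := by
  have h := S.waveT_eq ht hx hdt hz₀ hw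
  have h2 := waveLogDeriv_add (M t x w) (unweightMat C (dX B t x) w) (unweightMat C (dT B t x) w)
    (I * eta n w) (-(I * w))
  rw [remainder, waveX, smul_smul, show (eta n w - w) * I = I * eta n w + -(I * w) by ring, ← h2]
  rw [waveT] at h
  rw [h]
  abel

omit hdx in
lemma matDecays_remainder (ht : t ∈ T) (hx : x ∈ X) (hz₀ : z₀ ∉ C.carrier) :
    MatDecays C (remainder n M B z₀ t x) := by
  have hb := S.matBdd_M ht hx
  refine MatDecays.congr ((((matDecays_unweightMat (dX B t x)).add
    (matDecays_unweightMat (dT B t x))).mul_bdd hb.adjugate).add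
    (MatDecays.smul decays_eta_sub (f := fun w => I • (M t x w * sigma3 * (M t x w).adjugate)) ?_))
    fun w hw => S.remainder_eq hdt ht hx hz₀ hw
  refine ((matBdd_const (I • 1)).mul ((hb.mul (matBdd_const sigma3)).mul hb.adjugate)).congr fun w _ => ?_
  simp

omit hdt in
lemma matHolo_remainder (ht : t ∈ T) (hx : x ∈ X) : MatHolo C (remainder n M B z₀ t x) := by
  have hM := S.matHolo_M ht hx
  exact ((((S.matHolo_dX ht hx hdx).add (MatHolo.smul (c := fun w => I * eta n w)
      (differentiableOn_eta.const_mul I) (hM.mul (matHolo_const sigma3)))).mul hM.adjugate).sub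
      (MatHolo.smul (c := fun w => I * w) (by fun_prop) (matHolo_const sigma3))).sub (matHolo_const _)

/-- `R` jumps only on the real line, by `π n F / 2`. -/
lemma matJump_remainder (ht : t ∈ T) (hx : x ∈ X) (hz₀ : z₀ ∉ C.carrier) :
    MatJump C (remainder n M B z₀ t x) fun z =>
      if z.im = 0 then ((Real.pi * n z.re / 2 : ℝ) : ℂ) • jumpF n M B z₀ t x z.re else 0 := by
  refine matJump_of_tendsto (S.matHolo_remainder hdx ht hx)
    (S.matDecays_remainder hdt ht hx hz₀).bdd fun z P N h => ?_
  obtain ⟨eP, eN, K, hP, hN, -⟩ := S.exists_approach h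
  have h1 := S.tendsto_remainder (z₀ := z₀) hP ht hx hdx
  have h2 := S.tendsto_remainder (z₀ := z₀) hN ht hx hdx
  refine ⟨_, _, h1, h2, ?_⟩
  by_cases hz : z.im ≠ 0 ∨ n z.re = 0
  · rw [S.bdry_waveX_eq h ht hx hdx hz, sub_self]
    rcases hz with hz | hz <;> simp [hz]
  · push Not at hz
    cases h with
    | real l hl =>
      rw [if_pos hz.1, jumpF, if_neg (by simpa using ⟨by simpa using hz.2, hl⟩), smul_smul]
      have hn : n l ≠ 0 := by simpa using hz.2
      have : ((Real.pi * n (l : ℂ).re / 2 : ℝ) : ℂ) * ((2 / (Real.pi * n (l : ℂ).re) : ℝ) : ℂ) = 1 := by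
        rw [← Complex.ofReal_mul]
        have := Real.pi_ne_zero
        simp only [ofReal_re]
        norm_cast
        field_simp
      rw [this, one_smul, ofReal_re, bdry_eq hP.neBot h1, bdry_eq hN.neBot h2]
    | arc k s hs hn =>
      exact absurd (C.meet_real_mem k s (Ioo_subset_Icc_self hs) hz.1) hn

lemma jump_remainder (ht : t ∈ T) (hx : x ∈ X) (hz₀ : z₀ ∉ C.carrier) {l : ℝ} (hl : (l : ℂ) ∉ C.nodes) :
    ((Real.pi * n l / 2 : ℝ) : ℂ) • jumpF n M B z₀ t x l =
      bdry (above l) (remainder n M B z₀ t x) - bdry (below l) (remainder n M B z₀ t x) := by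
  have h := S.matJump_remainder hdt hdx ht hx hz₀
  ext i j
  obtain ⟨a, b, ha, hb, hab⟩ := (h i j).jump _ _ _ (Contour.HasSides.real l hl)
  obtain ⟨eP, eN, K, hP, hN, -⟩ := S.exists_approach (Contour.HasSides.real (C := C) l hl)
  have h1 := S.tendsto_remainder (z₀ := z₀) hP ht hx hdx
  have h2 := S.tendsto_remainder (z₀ := z₀) hN ht hx hdx
  have := hP.neBot
  have := hN.neBot
  rw [bdry_eq hP.neBot h1, bdry_eq hN.neBot h2, Matrix.sub_apply,
    ← tendsto_nhds_unique ha (tendsto_mat_iff.1 h1 i j),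
    ← tendsto_nhds_unique hb (tendsto_mat_iff.1 h2 i j), ← hab]
  simp

lemma integrable_gKernel (ht : t ∈ T) (hx : x ∈ X) (hz₀ : z₀ ∉ C.carrier) (hz : z.im ≠ 0) (i j : Fin 2) :
    Integrable (fun s : ℝ => (n s : ℂ) / ((s : ℂ) - z) * jumpF n M B z₀ t x s i j) := by
  have hj := S.matJump_remainder hdt hdx ht hx hz₀ i j
  obtain ⟨K, hK0, hK⟩ := (S.matDecays_remainder hdt ht hx hz₀ i j).jump_le hj
  obtain ⟨D, hD0, hD⟩ := exists_norm_inv_sub_le hz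
  have hm : AEStronglyMeasurable (fun s : ℝ => ((s : ℂ) - z)⁻¹) :=
    ((Complex.measurable_ofReal.sub_const z).inv).aestronglyMeasurable
  have hφ : AEStronglyMeasurable (fun s : ℝ => ((Real.pi * n s / 2 : ℝ) : ℂ) * jumpF n M B z₀ t x s i j) := by
    simpa using hj.cmeas.1
  have hint : Integrable (fun s : ℝ => ((s : ℂ) - z)⁻¹ *
      (((Real.pi * n s / 2 : ℝ) : ℂ) * jumpF n M B z₀ t x s i j)) := by
    refine (integrable_inv_one_add_abs_sq.const_mul (D * K)).mono' (hm.mul hφ) ?_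
    filter_upwards [C.ae_real] with l hl
    have h1 := hK _ _ _ (Contour.HasSides.real l hl)
    simp only [ofReal_im, if_true, ofReal_re, Matrix.smul_apply, smul_eq_mul, Complex.norm_real,
      Real.norm_eq_abs] at h1
    rw [norm_mul]
    refine (mul_le_mul (hD l) h1 (norm_nonneg _) (by positivity)).trans (le_of_eq ?_)
    field_simp
  refine (hint.const_mul (2 / (Real.pi : ℂ))).congr (ae_of_all _ fun s => ?_)
  have h0 : (Real.pi : ℂ) ≠ 0 := by exact_mod_cast Real.pi_ne_zero
  have h1 := ofReal_sub_ne_zero hz s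
  simp only
  push_cast
  field_simp

/-- `R = -i G`: both sides decay and have the same jump. -/
lemma remainder_eq_gMatrix (ht : t ∈ T) (hx : x ∈ X) (hz₀ : z₀ ∉ C.carrier) (hw : w ∉ C.carrier) :
    remainder n M B z₀ t x w = -(I • gMatrix n (jumpF n M B z₀ t x) w) := by
  ext i j
  have hj := S.matJump_remainder hdt hdx ht hx hz₀ i j
  rw [cauchy_formula hj (S.matDecays_remainder hdt ht hx hz₀ i j) hw,
    cint_jumpF (fun s => (s - w)⁻¹)]
  have hint : ∫ l : ℝ, ((l : ℂ) - w)⁻¹ * (((Real.pi * n l / 2 : ℝ) : ℂ) * jumpF n M B z₀ t x l i j) =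
      (Real.pi / 2 : ℂ) * ∫ s : ℝ, (n s : ℂ) / ((s : ℂ) - w) * jumpF n M B z₀ t x s i j := by
    rw [← integral_const_mul]
    refine integral_congr_ae (ae_of_all _ fun s => ?_)
    push_cast
    ring
  rw [hint]
  simp only [gMatrix, Matrix.neg_apply, Matrix.smul_apply, Matrix.of_apply, smul_eq_mul]
  have h0 : (Real.pi : ℂ) ≠ 0 := by exact_mod_cast Real.pi_ne_zero
  generalize ∫ s : ℝ, (n s : ℂ) / ((s : ℂ) - w) * jumpF n M B z₀ t x s i j = c
  field_simp
  rw [show (2 : ℂ) ^ 2 = 4 by norm_num, show I ^ 2 = -1 from Complex.I_sq]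
  ring

end SolutionFamily


variable {n : SchwartzMap ℝ ℝ} {C : Contour} {T X : Set ℝ} {Jarc : ℂ → Mat2}
  {Jreal : ℝ → ℝ → Mat2} {M : ℝ → ℝ → ℂ → Mat2} {B : Fin 2 → Fin 2 → ℝ × ℝ → (OffPt C →ᵇ ℂ)}

/-! ### The singular integral equation and the potential -/

/-- Jacobi's formula for a curve of matrices of determinant one. -/
lemma trace_waveLogDeriv {m : ℝ → Mat2} {m' : Mat2} {s : ℝ} (hm : HasMatDerivAt m m' s)
    (hdet : ∀ᶠ τ in 𝓝 s, (m τ).det = 1) (c : ℂ) : (waveLogDeriv (m s) m' c).trace = 0 := by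
  have h1 : HasDerivAt (fun τ => (m τ).det)
      ((m' 0 0 * m s 1 1 + m s 0 0 * m' 1 1) - (m' 0 1 * m s 1 0 + m s 0 1 * m' 1 0)) s := by
    simp only [Matrix.det_fin_two]
    exact ((hm 0 0).mul (hm 1 1)).sub ((hm 0 1).mul (hm 1 0))
  have h2 : HasDerivAt (fun τ => (m τ).det) 0 s := (hasDerivAt_const s (1 : ℂ)).congr_of_eventuallyEq hdet
  have h3 := h1.unique h2
  simp only [waveLogDeriv, sigma3, Matrix.trace_fin_two, Matrix.mul_apply, Matrix.add_apply, Matrix.smul_apply,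
    Fin.sum_univ_two, Matrix.adjugate_fin_two, Matrix.of_apply, Matrix.cons_val', Matrix.cons_val_zero,
    Matrix.cons_val_one, Matrix.cons_val_fin_one, smul_eq_mul]
  linear_combination h3

lemma tendsto_I_mul_atTop (C : Contour) : Tendsto (fun y : ℝ => I * (y : ℂ)) atTop
    (Bornology.cobounded ℂ ⊓ 𝓟 C.carrierᶜ) := by
  obtain ⟨R, hR, harc⟩ := C.exists_arc_bound
  refine tendsto_inf.2 ⟨?_, tendsto_principal.2 ?_⟩
  · rw [← tendsto_norm_atTop_iff_cobounded]
    simpa using tendsto_abs_atTop_atTop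
  · filter_upwards [eventually_gt_atTop R] with y hy hmem
    rcases hmem with h | h
    · have : y = 0 := by simpa using h
      linarith
    · obtain ⟨k, s, hs, hz⟩ := mem_iUnion.1 h
      have := harc k s hs
      rw [hz, norm_mul, Complex.norm_I, one_mul, Complex.norm_real, Real.norm_eq_abs] at this
      linarith [le_abs_self y]

lemma Decays.tendsto_zero {f : ℂ → ℂ} (h : Decays C f) :
    Tendsto f (Bornology.cobounded ℂ ⊓ 𝓟 C.carrierᶜ) (𝓝 0) := by
  obtain ⟨K, hK⟩ := h
  have h1 : Tendsto (fun z : ℂ => K / (1 + ‖z‖)) (Bornology.cobounded ℂ ⊓ 𝓟 C.carrierᶜ) (𝓝 0) :=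
    (tendsto_const_nhds.div_atTop (tendsto_atTop_add_const_left _ 1 tendsto_norm_cobounded_atTop)).mono_left
      inf_le_left
  refine squeeze_zero_norm' ?_ h1
  filter_upwards [mem_inf_of_right (mem_principal_self _)] with z hz using hK z hz

lemma MatDecays.tendsto_zero {f : ℂ → Mat2} (h : MatDecays C f) :
    Tendsto f (Bornology.cobounded ℂ ⊓ 𝓟 C.carrierᶜ) (𝓝 0) :=
  tendsto_mat_iff.2 fun i j => (h i j).tendsto_zero

/-- If two decaying functions `f` and `g` have jumps `φ` and `χ` with `|χ(z)| = |z φ(z)|`, then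
`φ = O(1/z²)`, and `φ` is integrable along the contour. -/
lemma cintegrable_of_decays {f φ g χ : ℂ → ℂ} (hf : HasJump C f φ) (hdf : Decays C f)
    (hg : HasJump C g χ) (hdg : Decays C g) (hχ : ∀ z P N, C.HasSides z P N → ‖χ z‖ = ‖z‖ * ‖φ z‖) :
    C.CIntegrable φ := by
  obtain ⟨K, hK0, hK⟩ := hdf.jump_le hf
  obtain ⟨L, hL0, hL⟩ := hdg.jump_le hg
  refine hf.cmeas.cintegrable (D := K) (integrable_inv_one_add_abs_sq.const_mul (K + L))
    (fun l hl => ?_) fun k s hs hn => ?_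
  · have h1 := hK _ _ _ (.real l hl)
    have h2 := hL _ _ _ (.real l hl)
    rw [hχ _ _ _ (.real l hl)] at h2
    rw [Complex.norm_real, Real.norm_eq_abs, le_div_iff₀ (by positivity)] at h1 h2
    rw [← div_eq_mul_inv, le_div_iff₀ (by positivity)]
    nlinarith
  · exact (hK _ _ _ (.arc k s hs hn)).trans (div_le_self hK0 (by linarith [norm_nonneg (C.arc k s)]))

open Classical in
/-- `Q = M₊ - I` on the contour, with the value `0` at the nodes. -/
noncomputable def boundaryQ (C : Contour) (M : ℝ → ℝ → ℂ → Mat2) (t x : ℝ) (z : ℂ) : Mat2 :=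
  if h : ∃ P N, C.HasSides z P N then bdry h.choose (M t x) - 1 else 0

lemma boundaryQ_eq {z : ℂ} {P N : Filter ℂ} (h : C.HasSides z P N) (t x : ℝ) :
    1 + boundaryQ C M t x z = bdry P (M t x) := by
  have hex : ∃ P N, C.HasSides z P N := ⟨P, N, h⟩
  rw [boundaryQ, dif_pos hex, (hex.choose_spec.choose_spec.unique h).1, add_sub_cancel]

lemma Contour.integral_apply (C : Contour) (f : ℂ → Mat2) (i j : Fin 2) :
    C.integral f i j = C.cint fun s => f s i j := rfl

lemma lie_sigma3 (A : Mat2) : ⁅sigma3, A⁆ = sigma3 * A - A * sigma3 := rfl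

lemma lie_sigma3_smul (c : ℂ) (A : Mat2) : ⁅sigma3, c • A⁆ = c • ⁅sigma3, A⁆ := by
  rw [lie_sigma3, lie_sigma3, smul_sub, Matrix.mul_smul, Matrix.smul_mul]

lemma lie_sigma3_one_sub (A J : Mat2) (i j : Fin 2) :
    ⁅sigma3, A * (1 - J)⁆ i j = -⁅sigma3, A * (J - 1)⁆ i j := by
  have : ⁅sigma3, A * (1 - J)⁆ = -⁅sigma3, A * (J - 1)⁆ := by
    rw [lie_sigma3, lie_sigma3]
    noncomm_ring
  rw [this]
  rfl

lemma Approach.tendsto_waveMatrix {t x : ℝ} {z e : ℂ} {P : Filter ℂ} (hP : Approach n C T X M z e P)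
    (ht : t ∈ T) (hx : x ∈ X) :
    Tendsto (waveMatrix n M t x) P (𝓝 (bdry P (M t x) * expSigma3 (phase z e t x))) := by
  refine (hP.tendsto_M ht hx).mul ((continuous_expSigma3.tendsto _).comp ?_)
  have h1 : Tendsto (fun w : ℂ => w) P (𝓝 z) := hP.le_nhds
  exact (((h1.mul_const _).sub (hP.tendsto_eta.const_mul _)).const_mul I).neg

namespace SolutionFamily

variable (S : SolutionFamily n C T X Jarc Jreal M B) {t x : ℝ} {z e w z₀ : ℂ} {P N : Filter ℂ}
include S

lemma matJump_M (ht : t ∈ T) (hx : x ∈ X) : MatJump C (fun w => M t x w - 1) fun s =>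
    (1 + boundaryQ C M t x s) * (1 - jumpMatrix n Jarc Jreal t x s) := by
  refine matJump_of_tendsto ((S.matHolo_M ht hx).sub (matHolo_const 1)) (S.matDecays_M ht hx).bdd
    fun z P N h => ?_
  obtain ⟨eP, eN, K, hP, hN, -, -, -, hb, -⟩ := S.exists_approach h
  refine ⟨_, _, (hP.tendsto_M ht hx).sub_const 1, (hN.tendsto_M ht hx).sub_const 1, ?_⟩
  rw [boundaryQ_eq h, hb t ht x hx, mul_sub, mul_one]
  abel

lemma integrableAlong_cauchy (ht : t ∈ T) (hx : x ∈ X) (hw : w ∉ C.carrier) :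
    C.IntegrableAlong fun s => (s - w)⁻¹ •
      ((1 + boundaryQ C M t x s) * (1 - jumpMatrix n Jarc Jreal t x s)) := fun i j =>
  cintegrable_cauchy (S.matJump_M ht hx i j) (S.matDecays_M ht hx i j) hw

/-- `M - I` is the Cauchy integral of its own jump `M₊ (I - J)`. -/
lemma cauchy_M (ht : t ∈ T) (hx : x ∈ X) (hw : w ∉ C.carrier) :
    (2 * (Real.pi : ℂ) * I)⁻¹ • C.integral (fun s => (s - w)⁻¹ •
      ((1 + boundaryQ C M t x s) * (1 - jumpMatrix n Jarc Jreal t x s))) = M t x w - 1 := by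
  ext i j
  exact (cauchy_formula (S.matJump_M ht hx i j) (S.matDecays_M ht hx i j) hw).symm

/-- The singular integral equation: the `+` boundary value of the Cauchy integral is `M₊ - I = Q`. -/
lemma tendsto_cauchy (ht : t ∈ T) (hx : x ∈ X) (h : C.HasSides z P N) :
    Tendsto (fun w : ℂ => (2 * (Real.pi : ℂ) * I)⁻¹ • C.integral (fun s => (s - w)⁻¹ •
      ((1 + boundaryQ C M t x s) * (1 - jumpMatrix n Jarc Jreal t x s)))) P
      (𝓝 (boundaryQ C M t x z)) := by
  obtain ⟨eP, eN, K, hP, -⟩ := S.exists_approach h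
  have h1 := (hP.tendsto_M ht hx).sub_const 1
  rw [← boundaryQ_eq h, add_sub_cancel_left] at h1
  refine h1.congr' ?_
  filter_upwards [hP.notMem] with w hw
  exact (S.cauchy_M ht hx hw).symm

lemma trace_bdry_waveX (hP : Approach n C T X M z e P) (ht : t ∈ T) (hx : x ∈ X)
    (hd : ∀ i j, DifferentiableAt ℝ (fun ξ => B i j (t, ξ)) x) : (bdry P (waveX n M B t x)).trace = 0 := by
  rw [S.bdry_waveX hP ht hx hd]
  refine trace_waveLogDeriv (S.bdry_dX hP ht hx hd).2 ?_ _
  filter_upwards [S.isOpen_X.mem_nhds hx] with ξ hξ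
  exact S.det_bdry hP ht hξ

variable (hdt : ∀ i j, DifferentiableAt ℝ (fun τ => B i j (τ, x)) t)

lemma trace_jumpF (hdx : ∀ i j, DifferentiableAt ℝ (fun ξ => B i j (t, ξ)) x)
    (ht : t ∈ T) (hx : x ∈ X) (l : ℝ) : (jumpF n M B z₀ t x l).trace = 0 := by
  by_cases h : n l = 0 ∨ (l : ℂ) ∈ C.nodes
  · rw [jumpF, if_pos h, Matrix.trace_zero]
  · obtain ⟨eP, eN, K, hP, hN, -⟩ := S.exists_approach (Contour.HasSides.real l (not_or.1 h).2)
    rw [jumpF, if_neg h, S.bdry_remainder hP ht hx hdx, S.bdry_remainder hN ht hx hdx]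
    simp [Matrix.trace_sub, S.trace_bdry_waveX hP ht hx hdx, S.trace_bdry_waveX hN ht hx hdx]

include hdt

/-- `-i[σ₃, z(M - I)] = M_t + H M` off the contour. -/
lemma lie_M_eq (ht : t ∈ T) (hx : x ∈ X) (hz₀ : z₀ ∉ C.carrier) (hw : w ∉ C.carrier) :
    (-I) • ⁅sigma3, w • (M t x w - 1)⁆ =
      unweightMat C (dT B t x) w + potential M B z₀ t x * M t x w := by
  have hP : Approach n C T X M w (eta n w) (pure w) := approach_pure hw
  have h := S.bdry_dT_eq hP ht hx hdt hz₀
  rw [bdry_pure, bdry_pure] at h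
  rw [h, lie_sigma3]
  simp only [Matrix.mul_smul, Matrix.smul_mul, mul_sub, sub_mul, mul_one, one_mul, add_mul, smul_sub, smul_smul]
  module

/-- `H = -i [σ₃, m]`, from `-i[σ₃, z(M - I)] = M_t + H M`, where `M_t → 0` and `M → I`. -/
lemma tendsto_lie_M (ht : t ∈ T) (hx : x ∈ X) (hz₀ : z₀ ∉ C.carrier) :
    Tendsto (fun z : ℂ => (-I) • ⁅sigma3, z • (M t x z - 1)⁆)
      (Bornology.cobounded ℂ ⊓ 𝓟 C.carrierᶜ) (𝓝 (potential M B z₀ t x)) := by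
  have h1 := (matDecays_unweightMat (dT B t x)).tendsto_zero
  have h2 := (S.matDecays_M ht hx).tendsto_zero
  have h3 := h1.add ((h2.const_mul (potential M B z₀ t x)).add_const (potential M B z₀ t x))
  rw [mul_zero, zero_add, zero_add] at h3
  refine h3.congr' ?_
  filter_upwards [mem_inf_of_right (mem_principal_self _)] with z hz
  rw [S.lie_M_eq hdt ht hx hz₀ hz, mul_sub, mul_one, sub_add_cancel]

omit hdt in
lemma matJump_lie (ht : t ∈ T) (hx : x ∈ X) : MatJump C (fun w => ⁅sigma3, M t x w - 1⁆) fun s =>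
    ⁅sigma3, (1 + boundaryQ C M t x s) * (1 - jumpMatrix n Jarc Jreal t x s)⁆ := by
  have hM := (S.matHolo_M ht hx).sub (matHolo_const 1)
  have hb := (S.matDecays_M ht hx).bdd
  refine matJump_of_tendsto (((matHolo_const sigma3).mul hM).sub (hM.mul (matHolo_const sigma3)))
    ((((matBdd_const sigma3).mul hb).add (hb.mul (matBdd_const (-sigma3)))).congr fun w _ => by
      rw [lie_sigma3, mul_neg, sub_eq_add_neg]) fun z P N h => ?_
  obtain ⟨eP, eN, K, hP, hN, -, -, -, hb, -⟩ := S.exists_approach h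
  have hl : ∀ {P A}, Tendsto (M t x) P (𝓝 A) →
      Tendsto (fun w => ⁅sigma3, M t x w - 1⁆) P (𝓝 ⁅sigma3, A - 1⁆) := fun h =>
    ((h.sub_const 1).const_mul sigma3).sub ((h.sub_const 1).mul_const sigma3)
  refine ⟨_, _, hl (hP.tendsto_M ht hx), hl (hN.tendsto_M ht hx), ?_⟩
  rw [boundaryQ_eq h, hb t ht x hx, mul_sub, mul_one, lie_sigma3, lie_sigma3, lie_sigma3]
  noncomm_ring

omit hdt in
lemma matDecays_lie (ht : t ∈ T) (hx : x ∈ X) : MatDecays C fun w => ⁅sigma3, M t x w - 1⁆ := by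
  have h := S.matDecays_M ht hx
  exact (MatDecays.bdd_mul (matBdd_const sigma3) h).sub (h.mul_bdd (matBdd_const sigma3))

/-- The jump of `[σ₃, M]` is integrable along the contour: by the equation in `t`, its product with `-i z`
is the jump of the decaying function `M_t + H (M - I)`. -/
lemma cintegrable_lie (ht : t ∈ T) (hx : x ∈ X) (hz₀ : z₀ ∉ C.carrier) (i j : Fin 2) :
    C.CIntegrable fun s =>
      ⁅sigma3, (1 + boundaryQ C M t x s) * (1 - jumpMatrix n Jarc Jreal t x s)⁆ i j := by
  have hj := S.matJump_lie ht hx i j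
  have hdec := S.matDecays_lie ht hx i j
  have hM := (S.matHolo_M ht hx).sub (matHolo_const 1)
  have hgd : MatDecays C fun w => unweightMat C (dT B t x) w + potential M B z₀ t x * (M t x w - 1) :=
    (matDecays_unweightMat _).add (MatDecays.bdd_mul (matBdd_const _) (S.matDecays_M ht hx))
  have hgj : MatJump C (fun w => unweightMat C (dT B t x) w + potential M B z₀ t x * (M t x w - 1)) fun s =>
      (-I * s) • ⁅sigma3, (1 + boundaryQ C M t x s) * (1 - jumpMatrix n Jarc Jreal t x s)⁆ := by
    refine matJump_of_tendsto ((S.matHolo_dT ht hx hdt).add ((matHolo_const _).mul hM)) hgd.bdd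
      fun z P N h => ?_
    obtain ⟨eP, eN, K, hP, hN, -, -, -, hb, -⟩ := S.exists_approach h
    refine ⟨_, _, (S.bdry_dT hP ht hx hdt).1.add (((hP.tendsto_M ht hx).sub_const 1).const_mul _),
      (S.bdry_dT hN ht hx hdt).1.add (((hN.tendsto_M ht hx).sub_const 1).const_mul _), ?_⟩
    rw [S.bdry_dT_eq hP ht hx hdt hz₀, S.bdry_dT_eq hN ht hx hdt hz₀, boundaryQ_eq h, mul_sub, mul_one,
      ← hb t ht x hx, lie_sigma3]
    simp only [mul_sub, sub_mul, mul_one, add_mul, Matrix.smul_mul]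
    module
  refine cintegrable_of_decays hj hdec (hgj i j) (hgd i j) fun z P N _ => ?_
  simp

lemma integrableAlong_lie (ht : t ∈ T) (hx : x ∈ X) (hz₀ : z₀ ∉ C.carrier) :
    C.IntegrableAlong fun s =>
      ⁅sigma3, (1 + boundaryQ C M t x s) * (jumpMatrix n Jarc Jreal t x s - 1)⁆ := by
  intro i j
  have h := S.cintegrable_lie hdt ht hx hz₀ i j
  simp only [lie_sigma3_one_sub] at h
  refine ⟨h.1.neg.congr (ae_of_all _ fun l => ?_), fun k => (h.2 k).neg.congr (fun s _ => ?_)⟩ <;> simp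

/-- The integral representation of the potential: the integral of the jump of `[σ₃, M]` is the moment at
infinity, which is computed by `tendsto_lie_M`. -/
lemma potential_eq_integral (ht : t ∈ T) (hx : x ∈ X) (hz₀ : z₀ ∉ C.carrier) :
    potential M B z₀ t x = (-I) • (2 * (Real.pi : ℂ) * I)⁻¹ • C.integral (fun s =>
      ⁅sigma3, (1 + boundaryQ C M t x s) * (jumpMatrix n Jarc Jreal t x s - 1)⁆) := by
  ext i j
  have h1 := tendsto_moment (S.matJump_lie ht hx i j) (S.matDecays_lie ht hx i j)
    (S.cintegrable_lie hdt ht hx hz₀ i j)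
  have h2 := tendsto_mat_iff.1 ((S.tendsto_lie_M hdt ht hx hz₀).comp (tendsto_I_mul_atTop C)) i j
  have h3 := h1.const_mul (-I)
  have h4 : potential M B z₀ t x i j = _ := tendsto_nhds_unique h2 (h3.congr fun y => by
    simp only [Function.comp, lie_sigma3_smul, Matrix.smul_apply, smul_eq_mul])
  have he : C.cint (fun s => ⁅sigma3, (1 + boundaryQ C M t x s) * (1 - jumpMatrix n Jarc Jreal t x s)⁆ i j) =
      -C.integral (fun s =>
        ⁅sigma3, (1 + boundaryQ C M t x s) * (jumpMatrix n Jarc Jreal t x s - 1)⁆) i j := by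
    rw [← neg_one_mul, Contour.integral_apply, ← C.cint_const_mul]
    simp only [lie_sigma3_one_sub, neg_one_mul]
  rw [h4, he]
  simp only [Matrix.smul_apply, smul_eq_mul]
  ring

end SolutionFamily


/-! ### Reflection in the real axis -/

namespace Contour

variable (C : Contour)

lemma conj_arc_mem {k : Fin C.p} {s : ℝ} (hs : s ∈ Icc (0 : ℝ) 1) :
    (starRingEnd ℂ) (C.arc k s) = C.arc (C.mirror k) (1 - s) := by
  have h := C.arc_mirror k (1 - s) ⟨by linarith [hs.2], by linarith [hs.1]⟩
  rw [sub_sub_cancel] at h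
  exact h.symm

lemma conj_mem_carrier {z : ℂ} (hz : z ∈ C.carrier) : (starRingEnd ℂ) z ∈ C.carrier := by
  rcases hz with h | h
  · left
    have h : z.im = 0 := h
    simp [h]
  · obtain ⟨k, s, hs, rfl⟩ := mem_iUnion.1 h
    rw [C.conj_arc_mem hs]
    exact Or.inr (mem_iUnion.2 ⟨C.mirror k, 1 - s, ⟨by linarith [hs.2], by linarith [hs.1]⟩, rfl⟩)

lemma conj_notMem_carrier {z : ℂ} (hz : z ∉ C.carrier) : (starRingEnd ℂ) z ∉ C.carrier := fun h =>
  hz (by simpa using C.conj_mem_carrier h)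

open Classical in
/-- The same contour, with the mirror images of the nodes added to the nodes. -/
noncomputable def symmNodes : Contour :=
  { C with
    nodes := C.nodes ∪ C.nodes.image (starRingEnd ℂ)
    arc_zero_mem := fun k => Finset.mem_union_left _ (C.arc_zero_mem k)
    arc_one_mem := fun k => Finset.mem_union_left _ (C.arc_one_mem k)
    meet_mem := fun k l h s hs u hu he => Finset.mem_union_left _ (C.meet_mem k l h s hs u hu he)
    meet_real_mem := fun k s hs h => Finset.mem_union_left _ (C.meet_real_mem k s hs h) }

lemma notMem_nodes_of_symmNodes {z : ℂ} (hz : z ∉ C.symmNodes.nodes) :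
    z ∉ C.nodes ∧ (starRingEnd ℂ) z ∉ C.nodes := by
  constructor
  · exact fun h => hz (Finset.mem_union_left _ h)
  · exact fun h => hz (Finset.mem_union_right _ (Finset.mem_image.2 ⟨_, h, by simp⟩))

variable {C}

/-- The reflection maps the left-hand side of an arc to the left-hand side of its mirror image. -/
lemma tendsto_conj_side {k : Fin C.p} {s : ℝ} (hs : s ∈ Ioo (0 : ℝ) 1) (L : Filter ℝ) :
    Tendsto (starRingEnd ℂ)
      (Filter.map (fun q : ℝ × ℝ => C.arc k q.1 + (q.2 : ℂ) * (I * deriv (C.arc k) s)) (𝓝 s ×ˢ L))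
      (Filter.map (fun q : ℝ × ℝ => C.arc (C.mirror k) q.1 +
        (q.2 : ℂ) * (I * deriv (C.arc (C.mirror k)) (1 - s))) (𝓝 (1 - s) ×ˢ L)) := by
  have hs' : 1 - s ∈ Ioo (0 : ℝ) 1 := ⟨by linarith [hs.2], by linarith [hs.1]⟩
  have hd : deriv (C.arc (C.mirror k)) (1 - s) = -(starRingEnd ℂ) (deriv (C.arc k) s) := by
    have h1 : HasDerivAt (C.arc k) (deriv (C.arc k) s) (1 - (1 - s)) := by
      rw [sub_sub_cancel]
      exact (C.hasStrictDerivAt_arc k hs).hasDerivAt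
    have h2 : HasDerivAt (fun u : ℝ => 1 - u) (-1) (1 - s) := by
      simpa using (hasDerivAt_id (1 - s)).const_sub 1
    have h3 := Complex.conjCLE.toContinuousLinearMap.hasFDerivAt.comp_hasDerivAt (1 - s)
      (h1.scomp (1 - s) h2)
    have h4 : C.arc (C.mirror k) =ᶠ[𝓝 (1 - s)] fun u => (starRingEnd ℂ) (C.arc k (1 - u)) := by
      filter_upwards [Icc_mem_nhds hs'.1 hs'.2] with u hu using C.arc_mirror k u hu
    rw [(h3.congr_of_eventuallyEq h4).deriv]
    simp
  rw [tendsto_map'_iff]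
  have hm : Tendsto (fun q : ℝ × ℝ => (1 - q.1, q.2)) (𝓝 s ×ˢ L) (𝓝 (1 - s) ×ˢ L) :=
    ((tendsto_const_nhds.sub tendsto_id).comp tendsto_fst).prodMk tendsto_snd
  refine (tendsto_map.comp hm).congr' ?_
  have hev : ∀ᶠ q : ℝ × ℝ in 𝓝 s ×ˢ L, q.1 ∈ Icc (0 : ℝ) 1 :=
    tendsto_fst.eventually (Icc_mem_nhds hs.1 hs.2)
  filter_upwards [hev] with q hq
  simp only [Function.comp, map_add, map_mul, Complex.conj_I, Complex.conj_ofReal]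
  rw [C.conj_arc_mem hq, hd]
  ring

end Contour

lemma lie_sigma3_diag (A : Mat2) (i : Fin 2) : ⁅sigma3, A⁆ i i = 0 := by
  rw [lie_sigma3, Matrix.sub_apply, Matrix.mul_apply, Matrix.mul_apply, Fin.sum_univ_two, Fin.sum_univ_two]
  fin_cases i <;> simp [sigma3]

lemma conjTranspose_tendsto {α : Type*} {f : α → Mat2} {P : Filter α} {A : Mat2}
    (h : Tendsto f P (𝓝 A)) : Tendsto (fun z => (f z)ᴴ) P (𝓝 Aᴴ) :=
  ((Continuous.matrix_conjTranspose continuous_id).tendsto A).comp h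

lemma HasMatDerivAt.conjTranspose {f : ℝ → Mat2} {f' : Mat2} {t : ℝ} (hf : HasMatDerivAt f f' t) :
    HasMatDerivAt (fun τ => (f τ)ᴴ) f'ᴴ t := fun i j =>
  Complex.conjCLE.toContinuousLinearMap.hasFDerivAt.comp_hasDerivAt t (hf j i)

/-- If `Φ₁ Φ₂ᴴ = 1`, the logarithmic derivatives satisfy `W₁ + W₂ᴴ = 0`. -/
lemma waveLogDeriv_add_conjTranspose {m₁ m₂ : ℝ → Mat2} {m₁' m₂' : Mat2} {θ₁ θ₂ : ℝ → ℂ} {θ₁' θ₂' : ℂ}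
    {t : ℝ} (h₁ : HasMatDerivAt m₁ m₁' t) (h₂ : HasMatDerivAt m₂ m₂' t)
    (hθ₁ : HasDerivAt θ₁ θ₁' t) (hθ₂ : HasDerivAt θ₂ θ₂' t)
    (hd₁ : (m₁ t).det = 1) (hd₂ : (m₂ t).det = 1) (hθ : ∀ τ, (starRingEnd ℂ) (θ₂ τ) = -θ₁ τ)
    (hj : ∀ᶠ τ in 𝓝 t, m₁ τ * (m₂ τ)ᴴ = 1) :
    waveLogDeriv (m₁ t) m₁' θ₁' + (waveLogDeriv (m₂ t) m₂' θ₂')ᴴ = 0 := by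
  have key : ∀ τ, m₁ τ * (m₂ τ)ᴴ = 1 →
      (m₁ τ * expSigma3 (θ₁ τ)) * (m₂ τ * expSigma3 (θ₂ τ))ᴴ = 1 := by
    intro τ h
    rw [Matrix.conjTranspose_mul, conjTranspose_expSigma3, hθ, mul_assoc, ← mul_assoc (expSigma3 _),
      expSigma3_mul_neg, one_mul, h]
  have e := (hasMatDerivAt_wave h₁ hθ₁ hd₁).mul (hasMatDerivAt_wave h₂ hθ₂ hd₂).conjTranspose
  have h := e.unique ((hasMatDerivAt_const 1 t).congr (hj.mono fun τ h => key τ h))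
  rw [Matrix.conjTranspose_mul (waveLogDeriv _ _ _), mul_assoc, ← mul_assoc (m₁ t * _),
    key t hj.self_of_nhds, mul_one, one_mul] at h
  exact h

lemma conj_phase (z e : ℂ) (t x : ℝ) :
    (starRingEnd ℂ) (phase ((starRingEnd ℂ) z) ((starRingEnd ℂ) e) t x) = -phase z e t x := by
  simp [phase]

variable {n : SchwartzMap ℝ ℝ} {C : Contour} {T X : Set ℝ} {Jarc : ℂ → Mat2}
  {Jreal : ℝ → ℝ → Mat2} {M : ℝ → ℝ → ℂ → Mat2} {B : Fin 2 → Fin 2 → ℝ × ℝ → (OffPt C →ᵇ ℂ)}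

namespace SolutionFamily

variable (S : SolutionFamily n C T X Jarc Jreal M B) {t x : ℝ} {z e w z₀ : ℂ} {P N : Filter ℂ}
  (hrefl : ∀ z ∈ C.carrier, z.im ≠ 0 → z ∉ C.nodes → (Jarc z)⁻¹ = (Jarc ((starRingEnd ℂ) z))ᴴ)
  (hherm : ∀ x ∈ X, ∀ l : ℝ, (Jreal x l).IsHermitian)

include S hrefl hherm

/-- The product `M(w) M(w̄)ᴴ` has no jump and tends to `I` at infinity. Its boundary values are known
where neither a point nor its mirror image is a node, so the jump is considered on the contour
`symmNodes`. -/
lemma mul_conjTranspose_M (ht : t ∈ T) (hx : x ∈ X) (hw : w ∉ C.carrier) :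
    M t x w * (M t x ((starRingEnd ℂ) w))ᴴ = 1 := by
  have hM := S.matHolo_M ht hx
  have hMd := S.matDecays_M ht hx
  have hMc : MatHolo C fun w => (M t x ((starRingEnd ℂ) w))ᴴ := by
    intro i j z hz
    have h1 : DifferentiableAt ℂ (fun z => M t x z j i) ((starRingEnd ℂ) z) :=
      (hM j i).differentiableAt (C.isOpen_compl_carrier.mem_nhds (C.conj_notMem_carrier hz))
    have h2 := h1.conj_conj
    rw [Complex.conj_conj] at h2
    exact h2.differentiableWithinAt
  have hdec : MatDecays C fun w => (M t x ((starRingEnd ℂ) w))ᴴ - 1 := by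
    intro i j
    obtain ⟨K, hK⟩ := hMd j i
    refine ⟨K, fun z hz => ?_⟩
    have h := hK _ (C.conj_notMem_carrier hz)
    rw [Complex.norm_conj] at h
    have he : (M t x ((starRingEnd ℂ) z))ᴴ - 1 = (M t x ((starRingEnd ℂ) z) - 1)ᴴ := by
      rw [Matrix.conjTranspose_sub, Matrix.conjTranspose_one]
    simpa only [he, Matrix.conjTranspose_apply, norm_star] using h
  have hdD : MatDecays C fun w => M t x w * (M t x ((starRingEnd ℂ) w))ᴴ - 1 :=
    ((hMd.mul_bdd (((matBdd_const 1).add hdec.bdd))).add hdec).congr fun z _ => by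
      noncomm_ring
  have hholo : MatHolo C fun w => M t x w * (M t x ((starRingEnd ℂ) w))ᴴ - 1 :=
    (hM.mul hMc).sub (matHolo_const 1)
  have hjump : MatJump C.symmNodes (fun w => M t x w * (M t x ((starRingEnd ℂ) w))ᴴ - 1) fun _ => 0 := by
    refine matJump_of_tendsto hholo hdD.bdd fun z P N h => ?_
    have hlim : ∀ {P P' : Filter ℂ} {A A' : Mat2}, Tendsto (M t x) P (𝓝 A) → Tendsto (M t x) P' (𝓝 A') →
        Tendsto (starRingEnd ℂ) P P' →
        Tendsto (fun w => M t x w * (M t x ((starRingEnd ℂ) w))ᴴ - 1) P (𝓝 (A * A'ᴴ - 1)) :=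
      fun h1 h2 h3 => (h1.mul (conjTranspose_tendsto (h2.comp h3))).sub_const 1
    cases h with
    | real l hl =>
      -- the reflection interchanges the two sides of the real line, and `J` is Hermitian there
      have hl' := (C.notMem_nodes_of_symmNodes hl).1
      obtain ⟨A, h1, h2⟩ := (S.sol t ht x hx).jump _ _ _ (.real l hl')
      refine ⟨_, _, hlim h1 h2 (tendsto_conj_above l), hlim h2 h1 (tendsto_conj_below l), ?_⟩
      have hJ : (jumpMatrix n Jarc Jreal t x l)ᴴ = jumpMatrix n Jarc Jreal t x l := by
        simp only [jumpMatrix, ofReal_im, if_true, Matrix.conjTranspose_mul, conjTranspose_expSigma3,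
          ofReal_re, (hherm x hx l).eq, etaMinus_eq, mul_assoc]
        simp
      rw [Matrix.conjTranspose_mul, hJ, mul_assoc, sub_self]
    | arc k s hs hn =>
      -- the reflection preserves the left-hand side of the arcs, and `J(s) J(s̄)ᴴ = 1`
      obtain ⟨hn1, hn2⟩ := C.notMem_nodes_of_symmNodes hn
      have hs' : 1 - s ∈ Ioo (0 : ℝ) 1 := ⟨by linarith [hs.2], by linarith [hs.1]⟩
      have him : (C.arc k s).im ≠ 0 := fun h0 => hn1 (C.meet_real_mem k s (Ioo_subset_Icc_self hs) h0)
      have hconj := C.conj_arc_mem (k := k) (Ioo_subset_Icc_self hs)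
      change C.arc k s ∉ C.nodes at hn1
      change (starRingEnd ℂ) (C.arc k s) ∉ C.nodes at hn2
      rw [hconj] at hn2
      have hside : C.HasSides (C.arc k s) (leftOf (C.arc k) s) (rightOf (C.arc k) s) :=
        Contour.HasSides.arc (C := C) k s hs hn1
      obtain ⟨A, h1, h2⟩ := (S.sol t ht x hx).jump _ _ _ hside
      obtain ⟨A', h1', h2'⟩ := (S.sol t ht x hx).jump _ _ _ (.arc (C.mirror k) (1 - s) hs' hn2)
      refine ⟨_, _, hlim h1 h1' (Contour.tendsto_conj_side hs _), hlim h2 h2' (Contour.tendsto_conj_side hs _), ?_⟩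
      have hdet := (S.sol t ht x hx).det_jump _ hside.mem_carrier hn1
      have hJ : jumpMatrix n Jarc Jreal t x (C.arc k s) *
          (jumpMatrix n Jarc Jreal t x (C.arc (C.mirror k) (1 - s)))ᴴ = 1 := by
        have hr := hrefl _ hside.mem_carrier him hn1
        rw [← hconj]
        have him' : ((starRingEnd ℂ) (C.arc k s)).im ≠ 0 := by simpa using him
        simp only [jumpMatrix, him, him', if_false] at hdet ⊢
        rw [Matrix.det_mul, Matrix.det_mul, det_expSigma3, det_expSigma3, one_mul, mul_one] at hdet
        have hcan : Jarc (C.arc k s) * (Jarc (C.arc k s))⁻¹ = 1 :=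
          Matrix.mul_nonsing_inv _ (by rw [hdet]; exact isUnit_one)
        have h1 := conj_phase (C.arc k s) (eta n (C.arc k s)) t x
        rw [phase, phase, neg_neg] at h1
        have h2 := congrArg Neg.neg h1
        rw [← map_neg, neg_neg] at h2
        rw [Matrix.conjTranspose_mul, Matrix.conjTranspose_mul, conjTranspose_expSigma3,
          conjTranspose_expSigma3, ← hr, eta_conj, h1, h2]
        generalize I * (C.arc k s * t - x * eta n (C.arc k s)) = a
        rw [mul_assoc (expSigma3 (-a) * _), ← mul_assoc (expSigma3 a), expSigma3_mul_neg, one_mul,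
          mul_assoc, ← mul_assoc (Jarc _), hcan, one_mul, expSigma3_neg_mul]
      rw [Matrix.conjTranspose_mul, mul_assoc, ← mul_assoc (jumpMatrix _ _ _ _ _ _), hJ, one_mul, sub_self]
  ext i j
  exact sub_eq_zero.1 (eq_zero_of_no_jump (hjump i j) (hdD i j) hw)

/-- Under the reflection `z ↦ z̄` an approach `P` is carried to an approach `P'`, and the product of
the boundary values of `M` at `P` and (adjointed) at `P'` is the identity. -/
lemma bdry_mul_conjTranspose {P' : Filter ℂ} {e' : ℂ} (hP : Approach n C T X M z e P)
    (hP' : Approach n C T X M ((starRingEnd ℂ) z) e' P') (hc : Tendsto (starRingEnd ℂ) P P')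
    (ht : t ∈ T) (hx : x ∈ X) : bdry P (M t x) * (bdry P' (M t x))ᴴ = 1 := by
  have := hP.neBot
  refine tendsto_nhds_unique ((hP.tendsto_M ht hx).mul
    (conjTranspose_tendsto ((hP'.tendsto_M ht hx).comp hc))) (tendsto_const_nhds.congr' ?_)
  filter_upwards [hP.notMem] with w hw
  exact (S.mul_conjTranspose_M hrefl hherm ht hx hw).symm

/-- `H` is skew-Hermitian: `Φ_t Φ⁻¹` at a base point and at its mirror image are negative adjoints of
each other. -/
lemma potential_add_conjTranspose (ht : t ∈ T) (hx : x ∈ X)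
    (hd : ∀ i j, DifferentiableAt ℝ (fun τ => B i j (τ, x)) t) (hz₀ : z₀ ∉ C.carrier) :
    potential M B z₀ t x + (potential M B z₀ t x)ᴴ = 0 := by
  have hP : Approach n C T X M z₀ (eta n z₀) (pure z₀) := approach_pure hz₀
  have hP' : Approach n C T X M ((starRingEnd ℂ) z₀) (eta n ((starRingEnd ℂ) z₀)) (pure ((starRingEnd ℂ) z₀)) :=
    approach_pure (C.conj_notMem_carrier hz₀)
  have h := waveLogDeriv_add_conjTranspose (S.bdry_dT hP ht hx hd).2 (S.bdry_dT hP' ht hx hd).2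
    (hasDerivAt_phase_t z₀ (eta n z₀) t x)
    (hasDerivAt_phase_t ((starRingEnd ℂ) z₀) ((starRingEnd ℂ) (eta n z₀)) t x) (S.det_bdry hP ht hx)
    (S.det_bdry hP' ht hx) (fun τ => conj_phase _ _ τ x) (by
      filter_upwards [S.isOpen_T.mem_nhds ht] with τ hτ
      exact S.bdry_mul_conjTranspose hrefl hherm hP hP' tendsto_map hτ hx)
  rw [S.bdry_waveT hP ht hx hd hz₀, S.bdry_waveT hP' ht hx hd hz₀] at h
  have hs : (sigma3)ᴴ = sigma3 := by
    ext i j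
    fin_cases i <;> fin_cases j <;> simp [sigma3, Matrix.conjTranspose_apply]
  have h3 : star (I * (starRingEnd ℂ) z₀) = -(I * z₀) := by simp
  rw [Matrix.conjTranspose_neg, Matrix.conjTranspose_add, Matrix.conjTranspose_smul, hs, h3] at h
  rw [← neg_eq_zero, ← h]
  module

omit hrefl hherm in
lemma potential_diag (ht : t ∈ T) (hx : x ∈ X)
    (hd : ∀ i j, DifferentiableAt ℝ (fun τ => B i j (τ, x)) t) (hz₀ : z₀ ∉ C.carrier) (i : Fin 2) :
    potential M B z₀ t x i i = 0 := by
  have h2 := tendsto_mat_iff.1 ((S.tendsto_lie_M hd ht hx hz₀).comp (tendsto_I_mul_atTop C)) i i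
  refine tendsto_nhds_unique h2 (tendsto_const_nhds.congr fun y => ?_)
  simp [lie_sigma3_diag]

/-- `F` is Hermitian: the reflection turns the boundary value of `Φ_x Φ⁻¹` at `l + i0` into minus the
adjoint of the one at `l - i0`. -/
lemma conjTranspose_jumpF (ht : t ∈ T) (hx : x ∈ X)
    (hd : ∀ i j, DifferentiableAt ℝ (fun ξ => B i j (t, ξ)) x) (l : ℝ) :
    (jumpF n M B z₀ t x l)ᴴ = jumpF n M B z₀ t x l := by
  by_cases h : n l = 0 ∨ (l : ℂ) ∈ C.nodes
  · rw [jumpF, if_pos h, Matrix.conjTranspose_zero]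
  have hl := (not_or.1 h).2
  have hP := S.approach_above hl
  have hN : Approach n C T X M ((starRingEnd ℂ) l) (etaMinus n l) (below l) := by
    rw [Complex.conj_ofReal]
    exact S.approach_below hl
  have h1 := waveLogDeriv_add_conjTranspose (S.bdry_dX hP ht hx hd).2 (S.bdry_dX hN ht hx hd).2
    (hasDerivAt_phase_x l (etaPlus n l) t x)
    (hasDerivAt_phase_x ((starRingEnd ℂ) l) ((starRingEnd ℂ) (etaPlus n l)) t x) (S.det_bdry hP ht hx)
    (S.det_bdry hN ht hx) (fun τ => conj_phase _ _ t τ) (by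
      filter_upwards [S.isOpen_X.mem_nhds hx] with ξ hξ
      exact S.bdry_mul_conjTranspose hrefl hherm hP hN (tendsto_conj_above l) ht hξ)
  rw [← etaMinus_eq, ← S.bdry_waveX hP ht hx hd, ← S.bdry_waveX hN ht hx hd] at h1
  have h2 := congrArg Matrix.conjTranspose h1
  rw [Matrix.conjTranspose_add, Matrix.conjTranspose_conjTranspose, Matrix.conjTranspose_zero] at h2
  rw [jumpF, if_neg h, S.bdry_remainder hP ht hx hd, S.bdry_remainder hN ht hx hd, Complex.conj_ofReal,
    sub_sub_sub_cancel_right, sub_sub_sub_cancel_right, Matrix.conjTranspose_smul, Matrix.conjTranspose_sub,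
    Complex.star_def, Complex.conj_ofReal, eq_neg_of_add_eq_zero_left h1,
    Matrix.conjTranspose_neg, Matrix.conjTranspose_conjTranspose]
  congr 1
  abel

end SolutionFamily


/-! ### Second derivatives in `t` and `x` -/

section Partial

variable {E : Type*} [NormedAddCommGroup E] [NormedSpace ℝ E] {b : ℝ × ℝ → E} {t x : ℝ}

lemma hasDerivAt_fst_of_differentiableAt {F : Type*} [NormedAddCommGroup F] [NormedSpace ℝ F] {b : ℝ × ℝ → F}
    (hb : DifferentiableAt ℝ b (t, x)) :
    HasDerivAt (fun τ => b (τ, x)) (fderiv ℝ b (t, x) (1, 0)) t :=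
  hb.hasFDerivAt.comp_hasDerivAt t ((hasDerivAt_id t).prodMk (hasDerivAt_const t x))

lemma hasDerivAt_snd_of_differentiableAt {F : Type*} [NormedAddCommGroup F] [NormedSpace ℝ F] {b : ℝ × ℝ → F}
    (hb : DifferentiableAt ℝ b (t, x)) :
    HasDerivAt (fun ξ => b (t, ξ)) (fderiv ℝ b (t, x) (0, 1)) x :=
  hb.hasFDerivAt.comp_hasDerivAt x ((hasDerivAt_const x t).prodMk (hasDerivAt_id x))

variable (hb : ContDiffAt ℝ ∞ b (t, x))
include hb

lemma differentiableAt_fderiv_of_contDiffAt : DifferentiableAt ℝ (fderiv ℝ b) (t, x) :=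
  (hb.fderiv_right (m := ∞) (by simp)).differentiableAt (by simp)

lemma fderiv_fderiv_symm (v w : ℝ × ℝ) :
    fderiv ℝ (fderiv ℝ b) (t, x) v w = fderiv ℝ (fderiv ℝ b) (t, x) w v :=
  hb.isSymmSndFDerivAt (by
    rw [minSmoothness_of_isRCLikeNormedField]
    exact ENat.LEInfty.out) v w

lemma hasDerivAt_fst_fderiv (v : ℝ × ℝ) :
    HasDerivAt (fun τ => fderiv ℝ b (τ, x) v) (fderiv ℝ (fderiv ℝ b) (t, x) (1, 0) v) t :=
  (ContinuousLinearMap.apply ℝ E v).hasFDerivAt.comp_hasDerivAt t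
    (hasDerivAt_fst_of_differentiableAt (differentiableAt_fderiv_of_contDiffAt hb))

lemma hasDerivAt_snd_fderiv (v : ℝ × ℝ) :
    HasDerivAt (fun ξ => fderiv ℝ b (t, ξ) v) (fderiv ℝ (fderiv ℝ b) (t, x) (0, 1) v) x :=
  (ContinuousLinearMap.apply ℝ E v).hasFDerivAt.comp_hasDerivAt x
    (hasDerivAt_snd_of_differentiableAt (differentiableAt_fderiv_of_contDiffAt hb))

end Partial

lemma HasMatDerivAt.adjugate {f : ℝ → Mat2} {f' : Mat2} {t : ℝ} (hf : HasMatDerivAt f f' t) :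
    HasMatDerivAt (fun τ => (f τ).adjugate) f'.adjugate t := by
  intro i j
  fin_cases i <;> fin_cases j <;> simp only [Matrix.adjugate_fin_two]
  · exact hf 1 1
  · exact (hf 0 1).neg
  · exact (hf 1 0).neg
  · exact hf 0 0

variable {n : SchwartzMap ℝ ℝ} {C : Contour} {T X : Set ℝ} {Jarc : ℂ → Mat2}
  {Jreal : ℝ → ℝ → Mat2} {M : ℝ → ℝ → ℂ → Mat2} {B : Fin 2 → Fin 2 → ℝ × ℝ → (OffPt C →ᵇ ℂ)}

/-- The second derivative of the weighted solution in the directions `v` and `w`. -/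
noncomputable def secondDeriv (B : Fin 2 → Fin 2 → ℝ × ℝ → (OffPt C →ᵇ ℂ)) (t x : ℝ) (v w : ℝ × ℝ)
    (i j : Fin 2) : OffPt C →ᵇ ℂ := fderiv ℝ (fderiv ℝ (B i j)) (t, x) v w

namespace SolutionFamily

variable (S : SolutionFamily n C T X Jarc Jreal M B) {t x : ℝ} {z e w z₀ : ℂ} {P N : Filter ℂ}
  (hsm : ∀ i j, ContDiffOn ℝ ∞ (B i j) (T ×ˢ X))
include S hsm

lemma contDiffAt_B (ht : t ∈ T) (hx : x ∈ X) (i j : Fin 2) : ContDiffAt ℝ ∞ (B i j) (t, x) :=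
  (hsm i j).contDiffAt ((S.isOpen_T.prod S.isOpen_X).mem_nhds ⟨ht, hx⟩)

lemma differentiableAt_B (ht : t ∈ T) (hx : x ∈ X) (i j : Fin 2) : DifferentiableAt ℝ (B i j) (t, x) :=
  (S.contDiffAt_B hsm ht hx i j).differentiableAt (by simp)

lemma diff_t (ht : t ∈ T) (hx : x ∈ X) (i j : Fin 2) : DifferentiableAt ℝ (fun τ => B i j (τ, x)) t :=
  (hasDerivAt_fst_of_differentiableAt (S.differentiableAt_B hsm ht hx i j)).differentiableAt

lemma diff_x (ht : t ∈ T) (hx : x ∈ X) (i j : Fin 2) : DifferentiableAt ℝ (fun ξ => B i j (t, ξ)) x :=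
  (hasDerivAt_snd_of_differentiableAt (S.differentiableAt_B hsm ht hx i j)).differentiableAt

lemma dT_eq (ht : t ∈ T) (hx : x ∈ X) : dT B t x = fun i j => fderiv ℝ (B i j) (t, x) (1, 0) := by
  ext1 i
  ext1 j
  exact (hasDerivAt_fst_of_differentiableAt (S.differentiableAt_B hsm ht hx i j)).deriv

lemma dX_eq (ht : t ∈ T) (hx : x ∈ X) : dX B t x = fun i j => fderiv ℝ (B i j) (t, x) (0, 1) := by
  ext1 i
  ext1 j
  exact (hasDerivAt_snd_of_differentiableAt (S.differentiableAt_B hsm ht hx i j)).deriv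

lemma hasDerivAt_dT_t (ht : t ∈ T) (hx : x ∈ X) (i j : Fin 2) :
    HasDerivAt (fun τ => dT B τ x i j) (secondDeriv B t x (1, 0) (1, 0) i j) t := by
  refine (hasDerivAt_fst_fderiv (S.contDiffAt_B hsm ht hx i j) (1, 0)).congr_of_eventuallyEq ?_
  filter_upwards [S.isOpen_T.mem_nhds ht] with τ hτ
  rw [S.dT_eq hsm hτ hx]

lemma hasDerivAt_dX_t (ht : t ∈ T) (hx : x ∈ X) (i j : Fin 2) :
    HasDerivAt (fun τ => dX B τ x i j) (secondDeriv B t x (1, 0) (0, 1) i j) t := by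
  refine (hasDerivAt_fst_fderiv (S.contDiffAt_B hsm ht hx i j) (0, 1)).congr_of_eventuallyEq ?_
  filter_upwards [S.isOpen_T.mem_nhds ht] with τ hτ
  rw [S.dX_eq hsm hτ hx]

lemma hasDerivAt_dT_x (ht : t ∈ T) (hx : x ∈ X) (i j : Fin 2) :
    HasDerivAt (fun ξ => dT B t ξ i j) (secondDeriv B t x (1, 0) (0, 1) i j) x := by
  have h := hasDerivAt_snd_fderiv (S.contDiffAt_B hsm ht hx i j) (1, 0)
  rw [fderiv_fderiv_symm (S.contDiffAt_B hsm ht hx i j)] at h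
  refine h.congr_of_eventuallyEq ?_
  filter_upwards [S.isOpen_X.mem_nhds hx] with ξ hξ
  rw [S.dT_eq hsm ht hξ]

lemma bdry_dT_t (hP : Approach n C T X M z e P) (ht : t ∈ T) (hx : x ∈ X) :
    HasMatDerivAt (fun τ => bdry P (unweightMat C (dT B τ x)))
      (bdry P (unweightMat C (secondDeriv B t x (1, 0) (1, 0)))) t := by
  refine (hasMatDerivAt_bdry hP.neBot hP.notMem (A₀ := 0) (S.hasDerivAt_dT_t hsm ht hx)
    (Eventually.of_forall fun τ w _ => (zero_add _).symm) ?_).2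
  filter_upwards [S.isOpen_T.mem_nhds ht] with τ hτ
  exact ⟨_, (S.bdry_dT hP hτ hx (S.diff_t hsm hτ hx)).1⟩

lemma bdry_dX_t (hP : Approach n C T X M z e P) (ht : t ∈ T) (hx : x ∈ X) :
    HasMatDerivAt (fun τ => bdry P (unweightMat C (dX B τ x)))
      (bdry P (unweightMat C (secondDeriv B t x (1, 0) (0, 1)))) t := by
  refine (hasMatDerivAt_bdry hP.neBot hP.notMem (A₀ := 0) (S.hasDerivAt_dX_t hsm ht hx)
    (Eventually.of_forall fun τ w _ => (zero_add _).symm) ?_).2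
  filter_upwards [S.isOpen_T.mem_nhds ht] with τ hτ
  exact ⟨_, (S.bdry_dX hP hτ hx (S.diff_x hsm hτ hx)).1⟩

lemma bdry_dT_x (hP : Approach n C T X M z e P) (ht : t ∈ T) (hx : x ∈ X) :
    HasMatDerivAt (fun ξ => bdry P (unweightMat C (dT B t ξ)))
      (bdry P (unweightMat C (secondDeriv B t x (1, 0) (0, 1)))) x := by
  refine (hasMatDerivAt_bdry hP.neBot hP.notMem (A₀ := 0) (S.hasDerivAt_dT_x hsm ht hx)
    (Eventually.of_forall fun τ w _ => (zero_add _).symm) ?_).2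
  filter_upwards [S.isOpen_X.mem_nhds hx] with ξ hξ
  exact ⟨_, (S.bdry_dT hP ht hξ (S.diff_t hsm ht hξ)).1⟩

lemma exists_hasMatDerivAt_potential_t (ht : t ∈ T) (hx : x ∈ X) (hz₀ : z₀ ∉ C.carrier) :
    ∃ H', HasMatDerivAt (fun τ => potential M B z₀ τ x) H' t := by
  have hP : Approach n C T X M z₀ (eta n z₀) (pure z₀) := approach_pure hz₀
  have h1 := S.bdry_dT_t hsm hP ht hx
  have h2 := (S.bdry_dT hP ht hx (S.diff_t hsm ht hx)).2
  simp only [bdry_pure] at h1 h2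
  exact ⟨_, ((((h1.add ((h2.mul_const sigma3).const_smul (-(I * z₀)))).mul h2.adjugate).add
    (hasMatDerivAt_const _ t)).neg)⟩

lemma exists_hasMatDerivAt_potential_x (ht : t ∈ T) (hx : x ∈ X) (hz₀ : z₀ ∉ C.carrier) :
    ∃ H', HasMatDerivAt (fun ξ => potential M B z₀ t ξ) H' x := by
  have hP : Approach n C T X M z₀ (eta n z₀) (pure z₀) := approach_pure hz₀
  have h1 := S.bdry_dT_x hsm hP ht hx
  have h2 := (S.bdry_dX hP ht hx (S.diff_x hsm ht hx)).2
  simp only [bdry_pure] at h1 h2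
  exact ⟨_, ((((h1.add ((h2.mul_const sigma3).const_smul (-(I * z₀)))).mul h2.adjugate).add
    (hasMatDerivAt_const _ x)).neg)⟩

/-! ### The zero-curvature equation -/

omit S hsm in
/-- The algebra of the compatibility condition: equality of the mixed second derivatives of `m`
gives the zero-curvature equation. -/
lemma zeroCurvature_of_mixed_deriv {m m_t m_x m_tx U V V_t H_x : Mat2} {a b : ℂ} (hdet : m.det = 1)
    (ht : m_t = a • (m * sigma3) + U * m) (hx : m_x = V * m - b • (m * sigma3))
    (htx : m_tx = a • (m_x * sigma3) + (-H_x * m + U * m_x))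
    (hxt : m_tx = (V_t * m + V * m_t) - b • (m_t * sigma3)) : V_t = -H_x + (U * V - V * U) := by
  have h1 : V_t * m = (-H_x + (U * V - V * U)) * m := by
    have h := hxt.symm.trans htx
    rw [ht, hx] at h
    simp only [mul_add, add_mul, mul_sub, sub_mul, smul_add, smul_sub, Matrix.mul_smul, Matrix.smul_mul,
      mul_assoc, neg_mul, smul_smul, mul_comm b a] at h ⊢
    rw [← sub_eq_zero] at h ⊢
    rw [← h]
    abel
  have h2 := congrArg (· * m.adjugate) h1
  simpa only [mul_assoc, mul_adjugate_of_det hdet, mul_one] using h2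

/-- The zero-curvature equation for `V = Φ_x Φ⁻¹` and `U = -(i z σ₃ + H)`, at points off the contour and
for the boundary values: `V_t = U_x + [U, V]` with `U_x = -H_x`. -/
lemma hasMatDerivAt_bdry_waveX (hP : Approach n C T X M z e P) (ht : t ∈ T) (hx : x ∈ X)
    (hz₀ : z₀ ∉ C.carrier) {H_x : Mat2} (hH : HasMatDerivAt (fun ξ => potential M B z₀ t ξ) H_x x) :
    HasMatDerivAt (fun τ => bdry P (waveX n M B τ x))
      (-H_x + (-((I * z) • sigma3 + potential M B z₀ t x) * bdry P (waveX n M B t x) -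
        bdry P (waveX n M B t x) * -((I * z) • sigma3 + potential M B z₀ t x))) t := by
  have hm_t := (S.bdry_dT hP ht hx (S.diff_t hsm ht hx)).2
  have hm_x := (S.bdry_dX hP ht hx (S.diff_x hsm ht hx)).2
  have hmxt := S.bdry_dX_t hsm hP ht hx
  have hmtx := S.bdry_dT_x hsm hP ht hx
  -- the logarithmic derivative is differentiable in `t`
  obtain ⟨V_t, hV⟩ : ∃ V_t, HasMatDerivAt (fun τ => bdry P (waveX n M B τ x)) V_t t := by
    refine ⟨_, ((hmxt.add ((hm_t.mul_const sigma3).const_smul (I * e))).mul hm_t.adjugate).congr ?_⟩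
    filter_upwards [S.isOpen_T.mem_nhds ht] with τ hτ
    rw [S.bdry_waveX hP hτ hx (S.diff_x hsm hτ hx), waveLogDeriv]
  have hxt : bdry P (unweightMat C (secondDeriv B t x (1, 0) (0, 1))) = _ := hmxt.unique
    (((hV.mul hm_t).sub ((hm_t.mul_const sigma3).const_smul (I * e))).congr (by
      filter_upwards [S.isOpen_T.mem_nhds ht] with τ hτ
      exact S.bdry_dX_eq hP hτ hx (S.diff_x hsm hτ hx)))
  have htx : bdry P (unweightMat C (secondDeriv B t x (1, 0) (0, 1))) = _ := hmtx.unique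
    ((((hm_x.mul_const sigma3).const_smul (I * z)).sub
      (((hasMatDerivAt_const ((I * z) • sigma3) x).add hH).mul hm_x)).congr (by
      filter_upwards [S.isOpen_X.mem_nhds hx] with ξ hξ
      exact S.bdry_dT_eq hP ht hξ (S.diff_t hsm ht hξ) hz₀))
  have hm_t' := S.bdry_dT_eq hP ht hx (S.diff_t hsm ht hx) hz₀
  have hm_x' := S.bdry_dX_eq hP ht hx (S.diff_x hsm ht hx)
  have key := zeroCurvature_of_mixed_deriv (U := -((I * z) • sigma3 + potential M B z₀ t x)) (H_x := H_x)
    (S.det_bdry hP ht hx) (by rw [hm_t', neg_mul, sub_eq_add_neg]) hm_x'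
    (by rw [htx, zero_add, neg_mul, neg_mul]; abel) hxt
  rwa [key] at hV

/-- The zero-curvature equation in terms of `R`: `R_t = -(H_t + H_x) - [i z σ₃ + H, R]`. -/
lemma hasMatDerivAt_bdry_remainder (hP : Approach n C T X M z e P) (ht : t ∈ T) (hx : x ∈ X)
    (hz₀ : z₀ ∉ C.carrier) {H_t H_x : Mat2} (hHt : HasMatDerivAt (fun τ => potential M B z₀ τ x) H_t t)
    (hHx : HasMatDerivAt (fun ξ => potential M B z₀ t ξ) H_x x) :
    HasMatDerivAt (fun τ => bdry P (remainder n M B z₀ τ x))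
      (-(H_t + H_x) - (((I * z) • sigma3 + potential M B z₀ t x) * bdry P (remainder n M B z₀ t x) -
        bdry P (remainder n M B z₀ t x) * ((I * z) • sigma3 + potential M B z₀ t x))) t := by
  have h := ((S.hasMatDerivAt_bdry_waveX hsm hP ht hx hz₀ hHx).sub
    (hasMatDerivAt_const ((I * z) • sigma3) t)).sub hHt
  have h2 := h.congr (g := fun τ => bdry P (remainder n M B z₀ τ x)) (by
    filter_upwards [S.isOpen_T.mem_nhds ht] with τ hτ
    exact S.bdry_remainder hP hτ hx (S.diff_x hsm hτ hx))
  convert h2 using 1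
  rw [S.bdry_remainder hP ht hx (S.diff_x hsm ht hx)]
  generalize (I * z) • sigma3 = s
  noncomm_ring

/-- The evolution `F_t = -[i l σ₃ + H, F]`: the term `H_t + H_x` in the equation for `R` has no jump. -/
lemma hasMatDerivAt_jumpF (ht : t ∈ T) (hx : x ∈ X) (hz₀ : z₀ ∉ C.carrier) (l : ℝ) :
    HasMatDerivAt (fun τ => jumpF n M B z₀ τ x l)
      (-(((I * l) • sigma3 + potential M B z₀ t x) * jumpF n M B z₀ t x l -
        jumpF n M B z₀ t x l * ((I * l) • sigma3 + potential M B z₀ t x))) t := by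
  by_cases h : n l = 0 ∨ (l : ℂ) ∈ C.nodes
  · simp only [jumpF, if_pos h, mul_zero, zero_mul, sub_zero, neg_zero]
    exact hasMatDerivAt_const 0 t
  obtain ⟨H_t, hHt⟩ := S.exists_hasMatDerivAt_potential_t hsm ht hx hz₀
  obtain ⟨H_x, hHx⟩ := S.exists_hasMatDerivAt_potential_x hsm ht hx hz₀
  obtain ⟨eP, eN, K, hP, hN, -⟩ := S.exists_approach (.real l (not_or.1 h).2)
  have h1 := S.hasMatDerivAt_bdry_remainder hsm hP ht hx hz₀ hHt hHx
  have h2 := S.hasMatDerivAt_bdry_remainder hsm hN ht hx hz₀ hHt hHx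
  have h3 := (h1.sub h2).const_smul ((2 / (Real.pi * n l) : ℝ) : ℂ)
  simp only [jumpF, if_neg h]
  convert h3 using 1
  simp only [Matrix.mul_smul, Matrix.smul_mul, ← smul_sub, ← smul_neg]
  congr 1
  generalize (I * (l : ℂ)) • sigma3 + potential M B z₀ t x = U
  noncomm_ring

/-- The limit form of the field equation: `z R₀₁(z)` tends to `-(H_t + H_x)₀₁/(2i)` at infinity, at the
rate `O(1/z)`. -/
lemma decays_mul_remainder (ht : t ∈ T) (hx : x ∈ X) (hz₀ : z₀ ∉ C.carrier) {H_t H_x : Mat2}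
    (hHt : HasMatDerivAt (fun τ => potential M B z₀ τ x) H_t t)
    (hHx : HasMatDerivAt (fun ξ => potential M B z₀ t ξ) H_x x) :
    Decays C fun w => w * remainder n M B z₀ t x w 0 1 + (2 * I)⁻¹ * (H_t + H_x) 0 1 := by
  have hb := S.matBdd_M ht hx
  have hT := matDecays_unweightMat (dT B t x)
  have hsum : MatDecays C fun w => unweightMat C (dX B t x) w + unweightMat C (dT B t x) w :=
    (matDecays_unweightMat (dX B t x)).add hT
  have hR := S.matDecays_remainder (n := n) (z₀ := z₀) (S.diff_t hsm ht hx) ht hx hz₀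
  -- the derivative of `R` in `t` decays
  have hR' : MatDecays C fun w =>
      ((unweightMat C (secondDeriv B t x (1, 0) (0, 1)) w + unweightMat C (secondDeriv B t x (1, 0) (1, 0)) w) *
        (M t x w).adjugate + (unweightMat C (dX B t x) w + unweightMat C (dT B t x) w) *
        (unweightMat C (dT B t x) w).adjugate) + (eta n w - w) • (I •
        (unweightMat C (dT B t x) w * sigma3 * (M t x w).adjugate +
          M t x w * sigma3 * (unweightMat C (dT B t x) w).adjugate)) := by
    refine ((((matDecays_unweightMat _).add (matDecays_unweightMat _)).mul_bdd hb.adjugate).add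
      (hsum.mul_bdd hT.bdd.adjugate)).add (MatDecays.smul decays_eta_sub ?_)
    have h1 := ((hT.bdd.mul (matBdd_const sigma3)).mul hb.adjugate).add
      ((hb.mul (matBdd_const sigma3)).mul hT.bdd.adjugate)
    exact ((matBdd_const (I • 1)).mul h1).congr fun w _ => by simp
  have hcomm : MatDecays C fun w => potential M B z₀ t x * remainder n M B z₀ t x w -
      remainder n M B z₀ t x w * potential M B z₀ t x :=
    (MatDecays.bdd_mul (matBdd_const _) hR).sub (hR.mul_bdd (matBdd_const _))
  obtain ⟨K, hK⟩ := ((hR'.add hcomm).const_smul (-(2 * I)⁻¹)) 0 1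
  refine ⟨K, fun w hw => ?_⟩
  have hP : Approach n C T X M w (eta n w) (pure w) := approach_pure hw
  have h1 := S.hasMatDerivAt_bdry_remainder hsm hP ht hx hz₀ hHt hHx
  simp only [bdry_pure] at h1
  have hXt := S.bdry_dX_t hsm hP ht hx
  have hTt := S.bdry_dT_t hsm hP ht hx
  have hMt := (S.bdry_dT hP ht hx (S.diff_t hsm ht hx)).2
  simp only [bdry_pure] at hXt hTt hMt
  have h2 := (((hXt.add hTt).mul hMt.adjugate).add
    ((((hMt.mul_const sigma3).mul hMt.adjugate).const_smul I).const_smul (eta n w - w))).congr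
    (g := fun τ => remainder n M B z₀ τ x w) (by
      filter_upwards [S.isOpen_T.mem_nhds ht] with τ hτ
      exact S.remainder_eq (S.diff_t hsm hτ hx) hτ hx hz₀ hw)
  have h3 := h1.unique h2
  have hI : (2 * I) ≠ 0 := by simp
  have h5 : w * remainder n M B z₀ t x w 0 1 + (2 * I)⁻¹ * (H_t + H_x) 0 1 =
      (-(2 * I)⁻¹ • ((-(H_t + H_x) - (((I * w) • sigma3 + potential M B z₀ t x) * remainder n M B z₀ t x w -
        remainder n M B z₀ t x w * ((I * w) • sigma3 + potential M B z₀ t x))) +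
        (potential M B z₀ t x * remainder n M B z₀ t x w -
          remainder n M B z₀ t x w * potential M B z₀ t x))) 0 1 := by
    have h6 : ((-(H_t + H_x) - (((I * w) • sigma3 + potential M B z₀ t x) * remainder n M B z₀ t x w -
        remainder n M B z₀ t x w * ((I * w) • sigma3 + potential M B z₀ t x))) +
        (potential M B z₀ t x * remainder n M B z₀ t x w -
          remainder n M B z₀ t x w * potential M B z₀ t x)) =
        -(H_t + H_x) - (I * w) • (sigma3 * remainder n M B z₀ t x w - remainder n M B z₀ t x w * sigma3) := by
      simp only [add_mul, mul_add, Matrix.smul_mul, Matrix.mul_smul, smul_sub]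
      abel
    rw [h6]
    simp only [Matrix.smul_apply, Matrix.sub_apply, Matrix.neg_apply, Matrix.mul_apply, Fin.sum_univ_two, sigma3,
      smul_eq_mul]
    simp
    field_simp
    linear_combination (2 * w * remainder n M B z₀ t x w 0 1) * Complex.I_sq
  rw [h3] at h5
  exact (congrArg norm h5).trans_le (hK w hw)

end SolutionFamily


variable {n : SchwartzMap ℝ ℝ} {C : Contour} {T X : Set ℝ} {Jarc : ℂ → Mat2}
  {Jreal : ℝ → ℝ → Mat2} {M : ℝ → ℝ → ℂ → Mat2} {B : Fin 2 → Fin 2 → ℝ × ℝ → (OffPt C →ᵇ ℂ)}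

/-! ### The field equation -/

lemma mul_inv_of_det {A W : Mat2} (h : A.det = 1) : W * A * A⁻¹ = W :=
  Matrix.mul_nonsing_inv_cancel_right A W (by rw [h]; exact isUnit_one)

namespace SolutionFamily

variable (S : SolutionFamily n C T X Jarc Jreal M B) {t x : ℝ} {z e w z₀ : ℂ} {P N : Filter ℂ}
include S

/-- The field equation: the `1/z`-coefficient of `R₀₁` is known from the zero-curvature equation, and it
is also the integral of the jump `π n F₀₁ / 2`. -/
lemma integral_jumpF (hsm : ∀ i j, ContDiffOn ℝ ∞ (B i j) (T ×ˢ X)) (ht : t ∈ T) (hx : x ∈ X)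
    (hz₀ : z₀ ∉ C.carrier) {H_t H_x : Mat2} (hHt : HasMatDerivAt (fun τ => potential M B z₀ τ x) H_t t)
    (hHx : HasMatDerivAt (fun ξ => potential M B z₀ t ξ) H_x x) :
    Integrable (fun l : ℝ => (n l : ℂ) * jumpF n M B z₀ t x l 0 1) ∧
      2 * (H_t + H_x) 0 1 = ∫ l : ℝ, (n l : ℂ) * jumpF n M B z₀ t x l 0 1 := by
  have hdt := S.diff_t hsm ht hx
  have hf := S.matJump_remainder hdt (S.diff_x hsm ht hx) ht hx hz₀ 0 1
  have hdf := S.matDecays_remainder hdt ht hx hz₀ 0 1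
  have hdg := S.decays_mul_remainder hsm ht hx hz₀ hHt hHx
  have hg : HasJump C (fun w => w * remainder n M B z₀ t x w 0 1 + (2 * I)⁻¹ * (H_t + H_x) 0 1)
      (fun z => z * (if z.im = 0 then
        ((Real.pi * n z.re / 2 : ℝ) : ℂ) • jumpF n M B z₀ t x z.re else 0) 0 1) := by
    refine ⟨(differentiableOn_id.mul hf.diff).add_const _, hdg.bdd, fun z P N h => ?_⟩
    obtain ⟨a, b, ha, hb, hab⟩ := hf.jump z P N h
    have hP : Tendsto (fun w : ℂ => w) P (𝓝 z) := h.le_nhds_left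
    have hN : Tendsto (fun w : ℂ => w) N (𝓝 z) := h.le_nhds_right
    refine ⟨_, _, (hP.mul ha).add_const _, (hN.mul hb).add_const _, ?_⟩
    simp only at hab
    rw [hab]
    ring
  have hint := cintegrable_of_decays hf hdf hg hdg fun z P N _ => norm_mul _ _
  have hpi : (Real.pi : ℂ) ≠ 0 := by exact_mod_cast Real.pi_ne_zero
  constructor
  · refine (hint.1.const_mul (2 / (Real.pi : ℂ))).congr (ae_of_all _ fun l => ?_)
    simp only [ofReal_im, if_true, ofReal_re, Matrix.smul_apply, smul_eq_mul]
    push_cast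
    field_simp
  · have h1 := tendsto_moment hf hdf hint
    have h2 := hdg.tendsto_zero.comp (tendsto_I_mul_atTop C)
    have h3 := (h2.sub_const ((2 * I)⁻¹ * (H_t + H_x) 0 1)).congr fun y => by
      simp only [Function.comp, add_sub_cancel_right]
      rfl
    have h4 := tendsto_nhds_unique h1 h3
    have h5 := cint_jumpF (n := n) (M := M) (B := B) (z₀ := z₀) (t := t) (x := x) (fun _ => 1) 0 1
    simp only [one_mul] at h5
    have h6 : ∫ l : ℝ, ((Real.pi * n l / 2 : ℝ) : ℂ) * jumpF n M B z₀ t x l 0 1 =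
        (Real.pi / 2 : ℂ) * ∫ l : ℝ, (n l : ℂ) * jumpF n M B z₀ t x l 0 1 := by
      rw [← integral_const_mul]
      refine integral_congr_ae (ae_of_all _ fun s => ?_)
      push_cast
      ring
    rw [h5, h6] at h4
    generalize ∫ l : ℝ, (n l : ℂ) * jumpF n M B z₀ t x l 0 1 = c at h4 ⊢
    generalize (H_t + H_x) 0 1 = d at h4 ⊢
    field_simp at h4
    linear_combination h4

/-! ### The Lax pair -/

lemma hasMatDerivAt_waveMatrix_t (ht : t ∈ T) (hx : x ∈ X)
    (hdt : ∀ i j, DifferentiableAt ℝ (fun τ => B i j (τ, x)) t) (hz₀ : z₀ ∉ C.carrier) (hw : w ∉ C.carrier) :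
    HasMatDerivAt (fun τ => waveMatrix n M τ x w)
      (-((I * w) • sigma3 + potential M B z₀ t x) * waveMatrix n M t x w) t := by
  have h := S.hasMatDerivAt_wave_t (approach_pure hw) ht hx hdt hz₀
  simp only [bdry_pure] at h
  exact h

lemma hasMatDerivAt_waveMatrix_x (ht : t ∈ T) (hx : x ∈ X)
    (hdx : ∀ i j, DifferentiableAt ℝ (fun ξ => B i j (t, ξ)) x) (hw : w ∉ C.carrier) :
    HasMatDerivAt (fun ξ => waveMatrix n M t ξ w) (waveX n M B t x w * waveMatrix n M t x w) x := by
  have h := S.hasMatDerivAt_wave_x (approach_pure hw) ht hx hdx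
  simp only [bdry_pure] at h
  exact h

lemma tendsto_matDeriv_mul_inv (hP : Approach n C T X M z e P) (ht : t ∈ T) (hx : x ∈ X)
    (hdx : ∀ i j, DifferentiableAt ℝ (fun ξ => B i j (t, ξ)) x) :
    Tendsto (fun z => matDeriv (fun ξ => waveMatrix n M t ξ z) x * (waveMatrix n M t x z)⁻¹) P
      (𝓝 (bdry P (waveX n M B t x))) := by
  have h := S.tendsto_waveX hP ht hx hdx
  rw [← S.bdry_waveX hP ht hx hdx] at h
  refine h.congr' ?_
  filter_upwards [hP.notMem] with w hw
  rw [(S.hasMatDerivAt_waveMatrix_x ht hx hdx hw).matDeriv_eq]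
  refine (mul_inv_of_det ?_).symm
  rw [waveMatrix, Matrix.det_mul, S.det_M ht hx hw, det_expSigma3, one_mul]

variable (hdt : ∀ i j, DifferentiableAt ℝ (fun τ => B i j (τ, x)) t)
  (hdx : ∀ i j, DifferentiableAt ℝ (fun ξ => B i j (t, ξ)) x)
include hdt hdx

lemma gMatrix_eq (ht : t ∈ T) (hx : x ∈ X) (hz₀ : z₀ ∉ C.carrier) (hw : w ∉ C.carrier) :
    gMatrix n (jumpF n M B z₀ t x) w = I • remainder n M B z₀ t x w := by
  rw [S.remainder_eq_gMatrix hdt hdx ht hx hz₀ hw, smul_neg, smul_smul, Complex.I_mul_I, neg_one_smul, neg_neg]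

lemma waveX_eq (ht : t ∈ T) (hx : x ∈ X) (hz₀ : z₀ ∉ C.carrier) (hw : w ∉ C.carrier) :
    waveX n M B t x w = (I * w) • sigma3 + potential M B z₀ t x -
      I • gMatrix n (jumpF n M B z₀ t x) w := by
  have h := S.remainder_eq_gMatrix hdt hdx ht hx hz₀ hw
  rw [sub_eq_add_neg, ← h, remainder]
  abel

/-- The boundary values of `G`, and the equation in `x` for the boundary values of `Φ`. -/
lemma exists_tendsto_gMatrix (hP : Approach n C T X M z e P) (ht : t ∈ T) (hx : x ∈ X) (hz₀ : z₀ ∉ C.carrier) :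
    ∃ G : Mat2, Tendsto (gMatrix n (jumpF n M B z₀ t x)) P (𝓝 G) ∧
      HasMatDerivAt (fun ξ => bdry P (M t ξ) * expSigma3 (phase z e t ξ))
        (((I * z) • sigma3 + potential M B z₀ t x - I • G) *
          (bdry P (M t x) * expSigma3 (phase z e t x))) x := by
  have h := S.tendsto_remainder (z₀ := z₀) hP ht hx hdx
  refine ⟨I • (bdry P (waveX n M B t x) - (I * z) • sigma3 - potential M B z₀ t x), ?_, ?_⟩
  · refine (h.const_smul I).congr' ?_
    filter_upwards [hP.notMem] with w hw
    exact (S.gMatrix_eq hdt hdx ht hx hz₀ hw).symm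
  · have he : (I * z) • sigma3 + potential M B z₀ t x -
        I • I • (bdry P (waveX n M B t x) - (I * z) • sigma3 - potential M B z₀ t x) =
        bdry P (waveX n M B t x) := by
      rw [smul_smul, Complex.I_mul_I, neg_one_smul]
      abel
    rw [he]
    exact S.hasMatDerivAt_wave_x hP ht hx hdx

lemma jumpF_eq (ht : t ∈ T) (hx : x ∈ X) (hz₀ : z₀ ∉ C.carrier) {l : ℝ} (hl : (l : ℂ) ∉ C.nodes) :
    ((Real.pi * n l / 2 : ℝ) : ℂ) • jumpF n M B z₀ t x l =
      bdry (above l) (waveX n M B t x) - bdry (below l) (waveX n M B t x) := by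
  rw [S.jump_remainder hdt hdx ht hx hz₀ hl, S.bdry_remainder (S.approach_above hl) ht hx hdx,
    S.bdry_remainder (S.approach_below hl) ht hx hdx]
  abel

end SolutionFamily

end MaxwellBloch

/-! ### The Maxwell-Bloch equations -/

open MaxwellBloch in
theorem mainTheorem3
    -- the inhomogeneous broadening
    (n : SchwartzMap ℝ ℝ) (hn : ∫ s : ℝ, n s = 1 ∨ ∫ s : ℝ, n s = -1)
    -- the contour, and the ranges of the variables `t` and `x`
    (C : Contour) (T X : Set ℝ) (hT : IsOpen T) (hX : IsOpen X)
    -- the data of the jump matrix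
    (Jarc : ℂ → Mat2) (Jreal : ℝ → ℝ → Mat2)
    (hrefl : ∀ z ∈ C.carrier, z.im ≠ 0 → z ∉ C.nodes →
      (Jarc z)⁻¹ = (Jarc ((starRingEnd ℂ) z))ᴴ)
    (hpos : ∀ x ∈ X, ∀ l : ℝ, ((1 / 2 : ℂ) • (Jreal x l + (Jreal x l)ᴴ)).PosDef)
    (hasymp : ∀ x ∈ X, ∀ i j,
      (fun l : ℝ => (Jreal x l - 1) i j) =O[Filter.cocompact ℝ] (fun l : ℝ => l⁻¹))
    (hzero : ∀ l : ℝ, n l = 0 → ∀ x ∈ X, ∀ y ∈ X, Jreal x l = Jreal y l)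
    -- the solution of the Riemann-Hilbert problem
    (M : ℝ → ℝ → ℂ → Mat2)
    (hM : ∀ t ∈ T, ∀ x ∈ X, IsRHSolution C (jumpMatrix n Jarc Jreal t x) (M t x))
    -- the entries of `(1 + |z|) (M - I)` as maps from the `(t,x)`-plane to the Banach space of
    -- bounded continuous functions off the contour
    (B : Fin 2 → Fin 2 → ℝ × ℝ → ({z : ℂ // z ∉ C.carrier} →ᵇ ℂ))
    (hB : ∀ t ∈ T, ∀ x ∈ X, ∀ (z : {z : ℂ // z ∉ C.carrier}) (i j : Fin 2),
      B i j (t, x) z = ((1 + ‖(z : ℂ)‖ : ℝ) : ℂ) * (M t x z - 1) i j) :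
    ∃ (H : ℝ → ℝ → Mat2) (F : ℝ → ℝ → ℝ → Mat2) (Q : ℝ → ℝ → ℂ → Mat2)
      (Φp Φm : ℝ → ℝ → ℝ → Mat2),
      -- `Q = M₊ - I` solves the singular integral equation, and `Φ` has boundary values on `ℝ`
      (∀ t ∈ T, ∀ x ∈ X,
        (∀ (z : ℂ), z ∉ C.carrier → C.IntegrableAlong (fun s =>
          (s - z)⁻¹ • ((1 + Q t x s) * (1 - jumpMatrix n Jarc Jreal t x s)))) ∧
        (∀ (z : ℂ) (P N : Filter ℂ), C.HasSides z P N →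
          Tendsto (M t x) P (𝓝 (1 + Q t x z)) ∧
          Tendsto (fun w : ℂ => (2 * (Real.pi : ℂ) * I)⁻¹ • C.integral (fun s =>
              (s - w)⁻¹ • ((1 + Q t x s) * (1 - jumpMatrix n Jarc Jreal t x s))))
            P (𝓝 (Q t x z))) ∧
        (∀ l : ℝ, (l : ℂ) ∉ C.nodes →
          Tendsto (waveMatrix n M t x) (above l) (𝓝 (Φp t x l)) ∧
          Tendsto (waveMatrix n M t x) (below l) (𝓝 (Φm t x l)))) ∧
      -- at every point where `M` is differentiable in `t` and in `x`
      (∀ t ∈ T, ∀ x ∈ X,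
        (∀ i j, DifferentiableAt ℝ (fun τ => B i j (τ, x)) t) →
        (∀ i j, DifferentiableAt ℝ (fun ξ => B i j (t, ξ)) x) →
        -- `H = -i[σ₃, m]`, with `m` the `1/z`-term of `M`, and its integral representation
        Tendsto (fun z : ℂ => (-I) • ⁅sigma3, z • (M t x z - 1)⁆)
          (Bornology.cobounded ℂ ⊓ 𝓟 C.carrierᶜ) (𝓝 (H t x)) ∧
        C.IntegrableAlong (fun s =>
          ⁅sigma3, (1 + Q t x s) * (jumpMatrix n Jarc Jreal t x s - 1)⁆) ∧
        H t x = (-I) • (2 * (Real.pi : ℂ) * I)⁻¹ • C.integral (fun s =>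
          ⁅sigma3, (1 + Q t x s) * (jumpMatrix n Jarc Jreal t x s - 1)⁆) ∧
        -- the Ablowitz-Kaup-Newell-Segur equations off the contour
        (∀ z : ℂ, z.im ≠ 0 → ∀ i j,
          Integrable (fun s : ℝ => (n s : ℂ) / ((s : ℂ) - z) * F t x s i j)) ∧
        (∀ z ∉ C.carrier,
          HasMatDerivAt (fun τ => waveMatrix n M τ x z)
            (-((I * z) • sigma3 + H t x) * waveMatrix n M t x z) t ∧
          HasMatDerivAt (fun ξ => waveMatrix n M t ξ z)
            (((I * z) • sigma3 + H t x - I • gMatrix n (F t x) z) * waveMatrix n M t x z) x) ∧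
        -- the equations on the two banks of the real line
        (∀ l : ℝ, (l : ℂ) ∉ C.nodes →
          HasMatDerivAt (fun τ => Φp τ x l)
            (-((I * (l : ℂ)) • sigma3 + H t x) * Φp t x l) t ∧
          HasMatDerivAt (fun τ => Φm τ x l)
            (-((I * (l : ℂ)) • sigma3 + H t x) * Φm t x l) t ∧
          ∃ Gp Gm : Mat2,
            Tendsto (gMatrix n (F t x)) (above l) (𝓝 Gp) ∧
            Tendsto (gMatrix n (F t x)) (below l) (𝓝 Gm) ∧
            HasMatDerivAt (fun ξ => Φp t ξ l)
              (((I * (l : ℂ)) • sigma3 + H t x - I • Gp) * Φp t x l) x ∧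
            HasMatDerivAt (fun ξ => Φm t ξ l)
              (((I * (l : ℂ)) • sigma3 + H t x - I • Gm) * Φm t x l) x) ∧
        -- reconstruction of `F` from the jump of `Φ_x Φ⁻¹`
        (∀ l : ℝ, (l : ℂ) ∉ C.nodes → ∃ Lp Lm : Mat2,
          Tendsto (fun z => matDeriv (fun ξ => waveMatrix n M t ξ z) x * (waveMatrix n M t x z)⁻¹)
            (above l) (𝓝 Lp) ∧
          Tendsto (fun z => matDeriv (fun ξ => waveMatrix n M t ξ z) x * (waveMatrix n M t x z)⁻¹)
            (below l) (𝓝 Lm) ∧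
          ((Real.pi * n l / 2 : ℝ) : ℂ) • F t x l = Lp - Lm) ∧
        (∀ l : ℝ, (F t x l).trace = 0)) ∧
      -- the Hermitian case
      ((∀ x ∈ X, ∀ l : ℝ, (Jreal x l).IsHermitian) →
        ∃ (E : ℝ → ℝ → ℂ) (𝒩 : ℝ → ℝ → ℝ → ℝ) (ρ : ℝ → ℝ → ℝ → ℂ),
          (∀ t ∈ T, ∀ x ∈ X,
            (∀ i j, DifferentiableAt ℝ (fun τ => B i j (τ, x)) t) →
            (∀ i j, DifferentiableAt ℝ (fun ξ => B i j (t, ξ)) x) →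
            H t x = (1 / 2 : ℂ) • !![0, E t x; -(starRingEnd ℂ) (E t x), 0] ∧
            ∀ l : ℝ, F t x l =
              !![(𝒩 t x l : ℂ), ρ t x l; (starRingEnd ℂ) (ρ t x l), -(𝒩 t x l : ℂ)]) ∧
          -- if `M` is smooth in `(t,x)`, the Maxwell-Bloch equations hold
          ((∀ i j, ContDiffOn ℝ ∞ (B i j) (T ×ˢ X)) → ∀ t ∈ T, ∀ x ∈ X,
            DifferentiableAt ℝ (fun τ => E τ x) t ∧
            DifferentiableAt ℝ (fun ξ => E t ξ) x ∧
            Integrable (fun l : ℝ => (n l : ℂ) * ρ t x l) ∧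
            deriv (fun τ => E τ x) t + deriv (fun ξ => E t ξ) x =
              ∫ l : ℝ, (n l : ℂ) * ρ t x l ∧
            ∀ l : ℝ,
              HasDerivAt (fun τ => ρ τ x l)
                ((𝒩 t x l : ℂ) * E t x - 2 * I * (l : ℂ) * ρ t x l) t ∧
              HasDerivAt (fun τ => (𝒩 τ x l : ℂ))
                (-(1 / 2) * ((starRingEnd ℂ) (E t x) * ρ t x l +
                  E t x * (starRingEnd ℂ) (ρ t x l))) t)) := by
  -- the choice of the base point `z₀` in the definition of the potential does not matter: `H` is the
  -- limit at infinity by `tendsto_lie_M`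
  have S : SolutionFamily n C T X Jarc Jreal M B := ⟨hT, hX, hzero, hM, hB⟩
  obtain ⟨z₀, hz₀⟩ := exists_base_point C
  refine ⟨potential M B z₀, jumpF n M B z₀, boundaryQ C M,
    fun t x l => bdry (above l) (M t x) * expSigma3 (phase l (etaPlus n l) t x),
    fun t x l => bdry (below l) (M t x) * expSigma3 (phase l (etaMinus n l) t x), ?_, ?_, ?_⟩
  · intro t ht x hx
    refine ⟨fun z hz => S.integrableAlong_cauchy ht hx hz, fun z P N h => ⟨?_, S.tendsto_cauchy ht hx h⟩,
      fun l hl => ⟨(S.approach_above hl).tendsto_waveMatrix ht hx,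
        (S.approach_below hl).tendsto_waveMatrix ht hx⟩⟩
    obtain ⟨eP, eN, K, hP, -⟩ := S.exists_approach h
    rw [boundaryQ_eq h]
    exact hP.tendsto_M ht hx
  · intro t ht x hx hdt hdx
    refine ⟨S.tendsto_lie_M hdt ht hx hz₀, S.integrableAlong_lie hdt ht hx hz₀,
      S.potential_eq_integral hdt ht hx hz₀, fun z hz i j => S.integrable_gKernel hdt hdx ht hx hz₀ hz i j,
      fun z hz => ⟨S.hasMatDerivAt_waveMatrix_t ht hx hdt hz₀ hz, ?_⟩, fun l hl => ?_, fun l hl => ?_,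
      S.trace_jumpF hdx ht hx⟩
    · rw [← S.waveX_eq hdt hdx ht hx hz₀ hz]
      exact S.hasMatDerivAt_waveMatrix_x ht hx hdx hz
    · obtain ⟨Gp, hGp, hp⟩ := S.exists_tendsto_gMatrix hdt hdx (S.approach_above hl) ht hx hz₀
      obtain ⟨Gm, hGm, hm⟩ := S.exists_tendsto_gMatrix hdt hdx (S.approach_below hl) ht hx hz₀
      exact ⟨S.hasMatDerivAt_wave_t (S.approach_above hl) ht hx hdt hz₀,
        S.hasMatDerivAt_wave_t (S.approach_below hl) ht hx hdt hz₀, Gp, Gm, hGp, hGm, hp, hm⟩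
    · exact ⟨_, _, S.tendsto_matDeriv_mul_inv (S.approach_above hl) ht hx hdx,
        S.tendsto_matDeriv_mul_inv (S.approach_below hl) ht hx hdx, S.jumpF_eq hdt hdx ht hx hz₀ hl⟩
  · intro hherm
    -- `H` is skew-Hermitian with vanishing diagonal, `F` is Hermitian with vanishing trace
    have hH : ∀ t ∈ T, ∀ x ∈ X, (∀ i j, DifferentiableAt ℝ (fun τ => B i j (τ, x)) t) →
        potential M B z₀ t x = (1 / 2 : ℂ) • !![0, 2 * potential M B z₀ t x 0 1;
          -(starRingEnd ℂ) (2 * potential M B z₀ t x 0 1), 0] := by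
      intro t ht x hx hdt
      have h := congrFun (congrFun (S.potential_add_conjTranspose hrefl hherm ht hx hdt hz₀) 1) 0
      have h10 : potential M B z₀ t x 1 0 = -(starRingEnd ℂ) (potential M B z₀ t x 0 1) :=
        eq_neg_of_add_eq_zero_left h
      ext i j
      fin_cases i <;> fin_cases j
      · simpa using S.potential_diag ht hx hdt hz₀ 0
      · simp
      · have h2 : (starRingEnd ℂ) 2 = 2 := map_ofNat _ 2
        simp [h10, h2]
      · simpa using S.potential_diag ht hx hdt hz₀ 1
    have hF : ∀ t ∈ T, ∀ x ∈ X, (∀ i j, DifferentiableAt ℝ (fun ξ => B i j (t, ξ)) x) → ∀ l : ℝ,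
        jumpF n M B z₀ t x l = !![((jumpF n M B z₀ t x l 0 0).re : ℂ), jumpF n M B z₀ t x l 0 1;
          (starRingEnd ℂ) (jumpF n M B z₀ t x l 0 1), -((jumpF n M B z₀ t x l 0 0).re : ℂ)] := by
      intro t ht x hx hdx l
      have hc := S.conjTranspose_jumpF (z₀ := z₀) hrefl hherm ht hx hdx l
      have h00 : (starRingEnd ℂ) (jumpF n M B z₀ t x l 0 0) = jumpF n M B z₀ t x l 0 0 :=
        congrFun (congrFun hc 0) 0
      have h10 : (starRingEnd ℂ) (jumpF n M B z₀ t x l 0 1) = jumpF n M B z₀ t x l 1 0 :=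
        congrFun (congrFun hc 1) 0
      have htr := S.trace_jumpF (z₀ := z₀) hdx ht hx l
      rw [Matrix.trace_fin_two] at htr
      rw [Complex.conj_eq_iff_re] at h00
      rw [h00]
      ext i j
      fin_cases i <;> fin_cases j
      · simp
      · simp
      · simp [h10]
      · simpa using eq_neg_of_add_eq_zero_right htr
    refine ⟨fun t x => 2 * potential M B z₀ t x 0 1, fun t x l => (jumpF n M B z₀ t x l 0 0).re,
      fun t x l => jumpF n M B z₀ t x l 0 1, fun t ht x hx hdt hdx => ⟨hH t ht x hx hdt, hF t ht x hx hdx⟩,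
      fun hsm t ht x hx => ?_⟩
    obtain ⟨H_t, hHt⟩ := S.exists_hasMatDerivAt_potential_t hsm ht hx hz₀
    obtain ⟨H_x, hHx⟩ := S.exists_hasMatDerivAt_potential_x hsm ht hx hz₀
    obtain ⟨hint, hfield⟩ := S.integral_jumpF hsm ht hx hz₀ hHt hHx
    have hEt := (hHt 0 1).const_mul 2
    have hEx := (hHx 0 1).const_mul 2
    refine ⟨hEt.differentiableAt, hEx.differentiableAt, hint, ?_, fun l => ?_⟩
    · rw [hEt.deriv, hEx.deriv, ← hfield, Matrix.add_apply, mul_add]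
    · have hFt := S.hasMatDerivAt_jumpF hsm ht hx hz₀ l
      have hHe := hH t ht x hx (S.diff_t hsm ht hx)
      have hFe := hF t ht x hx (S.diff_x hsm ht hx) l
      -- the entries of `-[i l σ₃ + H, F]`
      have hcomm : ∀ (E r : ℂ) (N : ℝ), -(((I * (l : ℂ)) • sigma3 +
          (1 / 2 : ℂ) • !![0, E; -(starRingEnd ℂ) E, 0]) * !![(N : ℂ), r; (starRingEnd ℂ) r, -(N : ℂ)] -
          !![(N : ℂ), r; (starRingEnd ℂ) r, -(N : ℂ)] * ((I * (l : ℂ)) • sigma3 +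
          (1 / 2 : ℂ) • !![0, E; -(starRingEnd ℂ) E, 0])) =
          !![-(1 / 2) * ((starRingEnd ℂ) E * r + E * (starRingEnd ℂ) r), N * E - 2 * I * l * r;
            N * (starRingEnd ℂ) E + 2 * I * l * (starRingEnd ℂ) r,
            (1 / 2) * ((starRingEnd ℂ) E * r + E * (starRingEnd ℂ) r)] := by
        intro E r N
        ext i j
        fin_cases i <;> fin_cases j <;> simp [sigma3] <;> ring
      rw [hHe] at hFt
      constructor
      · have h := hFt 0 1
        rw [hFe, hcomm] at h
        exact h
      · have h := hFt 0 0
        rw [hFe, hcomm] at h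
        -- the entry `F₀₀` is real for all `τ` near `t`, and therefore equal to its real part
        refine h.congr_of_eventuallyEq ?_
        filter_upwards [S.isOpen_T.mem_nhds ht] with τ hτ
        exact (congrFun (congrFun (hF τ hτ x hx (S.diff_x hsm hτ hx) l) 0) 0).symm
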